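/- Let $M=\mathbb{P}(T\mathbb{P}^2)$ be the projectivized tangent bundle of the complex projective plane, identified with the incidence variety $\{(x,\ell)\in\mathbb{P}^2\times\check{\mathbb{P}}^2 : x\in \ell\}$, with projections $\pi:M\to\mathbb{P}^2$ and $\check\pi:M\to\check{\mathbb{P}}^2$. Let $\mathcal{O}_M(a,b)=\pi^*\mathcal{O}_{\mathbb{P}^2}(a)\otimes\check\pi^*\mathcal{O}_{\check{\mathbb{P}}^2}(b)$, and let $\mathcal{D}\subset TM$ be the contact distribution, whose plane at $(x,\ell)$ is $(d\pi)^{-1}(T_x\ell)$. For integers $a,b\ge 1$ let $\mathbb{E}(a,b)=\mathbb{P}H^0(M,\mathcal{D}\otimes\mathcal{O}_M(a,b))$ be the space of second order differential equations of bidegree $(a,b)$ on $\mathbb{P}^2$. An algebraic curve $C\subset M$ is invariant for an element $[X]\in\mathbb{E}(a,b)$ if $X$ is tangent to $C$ at every smooth point of $C$ (zeros of $X$ on $C$ being allowed). The lift to $M$ of a line $\ell\subset\mathbb{P}^2$ is $\check\pi^{-1}(\ell)=\{(x,\ell): x\in \ell\}$; the lift to $M$ of the line of $\check{\mathbb{P}}^2$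 formed by the lines through a point $q\in\mathbb{P}^2$ is the fiber $\pi^{-1}(q)$. A property holds for the generic element of $\mathbb{E}(a,b)$ if it holds for all elements of a non-empty (hence dense) Zariski open subset. For all integers $a,b\ge 1$: 1. Every element of $\mathbb{E}(1,b)$ has a one-parameter family of invariant curves which are lifts of lines of $\mathbb{P}^2$, that is, there is an irreducible algebraic curve $\Gamma\subset\check{\mathbb{P}}^2$ such that the lift of every line $\ell\in\Gamma$ is invariant. The generic element of $\mathbb{E}(2,b)$ has exactly $(b+2)^2+(b+2)+1$ invariant curves which are lifts of lines of $\mathbb{P}^2$. 2. Every element of $\mathbb{E}(a,1)$ has a one-parameter family of invariant curves which are lifts of lines of $\check{\mathbb{P}}^2$ (fibers of $\pi$), that is, there is an irreducible algebraic curve $\Gamma\subset\mathbb{P}^2$ such that the fiber of $\pi$ over every point of $\Gamma$ is invariant. The generic element of $\mathbb{E}(a,2)$ has exactly $(a+2)^2+(a+2)+1$ invariant curves which are fibers of $\pi$. -/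

import Mathlib

open scoped Matrix Topology

namespace SecondOrderODE

noncomputable section

/-- Homogeneous coordinates on the projective plane and on its dual. -/
abbrev Vec3 : Type := Fin 3 → ℂ

/-- The complex projective plane. -/
abbrev Plane : Type := Projectivization ℂ Vec3

/-- The dual projective plane; `[ξ]` is the line `{x | ξ ⬝ x = 0}`. -/
abbrev DualPlane : Type := Projectivization ℂ Vec3

/-- The contact variety `M = ℙ(Tℙ²)`, as the incidence variety of points and lines: the pair
`([x], [ξ])` is the point `[x]` together with the tangent direction at `[x]` of the line `[ξ]`. -/
abbrev ContactVariety : Type :=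
  {m : Plane × DualPlane // Projectivization.orthogonal m.1 m.2}

/-- The projection `π : M → ℙ²`. -/
def ContactVariety.point (m : ContactVariety) : Plane := m.1.1

/-- The projection `π̌ : M → ℙ̌²`. -/
def ContactVariety.line (m : ContactVariety) : DualPlane := m.1.2

/-- Homogeneous coordinates of the points of `M`. This is a principal bundle over `M` with group
`ℂˣ × ℂˣ`, acting by `(λ, μ) • (x, ξ) = (λ x, μ ξ)`. -/
def Cone : Set (Vec3 × Vec3) := {z | z.1 ≠ 0 ∧ z.2 ≠ 0 ∧ z.1 ⬝ᵥ z.2 = 0}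

/-- The point `([x], [ξ])` of `M` with homogeneous coordinates `(x, ξ)`. -/
def toContactVariety (z : Cone) : ContactVariety :=
  ⟨(Projectivization.mk ℂ z.1.1 z.2.1, Projectivization.mk ℂ z.1.2 z.2.2.1),
    (Projectivization.orthogonal_mk z.2.1 z.2.2.1).2 z.2.2.2⟩

/-- The action of `ℂˣ × ℂˣ` on the homogeneous coordinates. -/
def coneScale (s t : ℂˣ) (z : Cone) : Cone :=
  ⟨((s : ℂ) • z.1.1, (t : ℂ) • z.1.2), smul_ne_zero s.ne_zero z.2.1,
    smul_ne_zero t.ne_zero z.2.2.1, by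
      rw [smul_dotProduct, dotProduct_smul, z.2.2.2, smul_zero, smul_zero]⟩

/-- The tangent space at `z = (x, ξ)` to the orbit of `z`. -/
def eulerSpace (z : Cone) : Submodule ℂ (Vec3 × Vec3) :=
  Submodule.span ℂ {(z.1.1, 0), (0, z.1.2)}

/-- The tangent space of the product of the two planes at the point with homogeneous coordinates
`z`, identified by means of `z` with a quotient of `ℂ³ × ℂ³`. -/
abbrev TangentFibre (z : Cone) : Type := (Vec3 × Vec3) ⧸ eulerSpace z

/-- The vectors `(v, w)` at `z = (x, ξ)` which are tangent to the incidence variety `x ⬝ ξ = 0`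
and whose image under `dπ`, the class of `v` modulo `x`, lies in the direction of the line
`[ξ]`. -/
def contactSpace (z : Cone) : Submodule ℂ (Vec3 × Vec3) where
  carrier := {p | p.1 ⬝ᵥ z.1.2 + z.1.1 ⬝ᵥ p.2 = 0 ∧ p.1 ⬝ᵥ z.1.2 = 0}
  add_mem' := by
    rintro p q ⟨hp, hp'⟩ ⟨hq, hq'⟩
    constructor
    · simp only [Prod.fst_add, Prod.snd_add, add_dotProduct, dotProduct_add]
      linear_combination hp + hq
    · simp only [Prod.fst_add, add_dotProduct]
      linear_combination hp' + hq'
  zero_mem' := by constructor <;> simp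
  smul_mem' := by
    rintro c p ⟨hp, hp'⟩
    constructor
    · simp only [Prod.smul_fst, Prod.smul_snd, smul_dotProduct, dotProduct_smul, smul_eq_mul]
      linear_combination c * hp
    · simp only [Prod.smul_fst, smul_dotProduct, smul_eq_mul]
      linear_combination c * hp'

/-- The plane of the contact distribution `𝒟 ⊆ TM` at the point with homogeneous
coordinates `z`. -/
def contactFibre (z : Cone) : Submodule ℂ (TangentFibre z) :=
  (contactSpace z).map (eulerSpace z).mkQ

/-- The differential `(v, w) ↦ (s v, t w)` of the action of `(s, t)`. -/
def scaleLinear (s t : ℂˣ) : (Vec3 × Vec3) →ₗ[ℂ] (Vec3 × Vec3) :=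
  LinearMap.prodMap ((s : ℂ) • LinearMap.id) ((t : ℂ) • LinearMap.id)

theorem eulerSpace_le_comap (s t : ℂˣ) (z : Cone) :
    eulerSpace z ≤ (eulerSpace (coneScale s t z)).comap (scaleLinear s t) := by
  refine Submodule.span_le.2 ?_
  rintro p (rfl | rfl)
  · refine Submodule.subset_span (Or.inl ?_)
    simp [scaleLinear, coneScale]
  · refine Submodule.subset_span (Or.inr ?_)
    simp [scaleLinear, coneScale]

/-- The differential of the action of `(s, t)`, modulo the tangent spaces to the orbits. -/
def scaleFibre (s t : ℂˣ) (z : Cone) : TangentFibre z →ₗ[ℂ] TangentFibre (coneScale s t z) :=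
  (eulerSpace z).mapQ (eulerSpace (coneScale s t z)) (scaleLinear s t) (eulerSpace_le_comap s t z)

/-- The space `H⁰(M, 𝒟 ⊗ 𝒪_M(a, b))` of global holomorphic sections, as the equivariant sections
over the cone: a contact vector `X z` at each `z`, which locally lifts to a holomorphic map to
`ℂ³ × ℂ³`, and which is equivariant for the action of `ℂˣ × ℂˣ` on the tangent vectors twisted
by the character `s ^ a t ^ b` of `𝒪_M(a, b)`. -/
def Sections (a b : ℕ) : Submodule ℂ ((z : Cone) → TangentFibre z) where
  carrier := {X |
    (∀ z, X z ∈ contactFibre z) ∧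
    (∀ (s t : ℂˣ) (z : Cone),
      X (coneScale s t z) = ((s : ℂ) ^ a * (t : ℂ) ^ b) • scaleFibre s t z (X z)) ∧
    (∀ z₀ : Cone, ∃ (N : Set (Vec3 × Vec3)) (Y : Vec3 × Vec3 → Vec3 × Vec3),
      IsOpen N ∧ z₀.1 ∈ N ∧ DifferentiableOn ℂ Y N ∧
        ∀ z : Cone, z.1 ∈ N → X z = Submodule.Quotient.mk (Y z.1))}
  add_mem' := by
    rintro X X' ⟨h1, h2, h3⟩ ⟨h1', h2', h3'⟩
    refine ⟨fun z => Submodule.add_mem _ (h1 z) (h1' z), fun s t z => ?_, fun z₀ => ?_⟩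
    · rw [Pi.add_apply, Pi.add_apply, h2, h2', map_add, smul_add]
    · obtain ⟨N, Y, hN, hz, hY, hX⟩ := h3 z₀
      obtain ⟨N', Y', hN', hz', hY', hX'⟩ := h3' z₀
      refine ⟨N ∩ N', Y + Y', hN.inter hN', ⟨hz, hz'⟩,
        (hY.mono Set.inter_subset_left).add (hY'.mono Set.inter_subset_right), fun z h => ?_⟩
      rw [Pi.add_apply, hX z h.1, hX' z h.2, Pi.add_apply, Submodule.Quotient.mk_add]
  zero_mem' := by
    refine ⟨fun z => Submodule.zero_mem _, fun s t z => ?_, fun z₀ => ?_⟩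
    · rw [Pi.zero_apply, Pi.zero_apply, map_zero, smul_zero]
    · exact ⟨Set.univ, 0, isOpen_univ, trivial, differentiableOn_const 0, fun z _ => rfl⟩
  smul_mem' := by
    rintro c X ⟨h1, h2, h3⟩
    refine ⟨fun z => Submodule.smul_mem _ _ (h1 z), fun s t z => ?_, fun z₀ => ?_⟩
    · rw [Pi.smul_apply, Pi.smul_apply, h2, map_smul, smul_comm]
    · obtain ⟨N, Y, hN, hz, hY, hX⟩ := h3 z₀
      refine ⟨N, c • Y, hN, hz, hY.const_smul c, fun z h => ?_⟩
      rw [Pi.smul_apply, hX z h, Pi.smul_apply, Submodule.Quotient.mk_smul]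

/-- The space `𝔼(a, b) = ℙ H⁰(M, 𝒟 ⊗ 𝒪_M(a, b))` of second order differential equations of
bidegree `(a, b)`. -/
abbrev SecondOrderEq (a b : ℕ) : Type := Projectivization ℂ (Sections a b)

/-- Polynomials in the homogeneous coordinates `(x, ξ)`. -/
abbrev CoordPoly : Type := MvPolynomial (Fin 3 ⊕ Fin 3) ℂ

/-- The polynomial `P` vanishes on the subset `C` of `M`: it is zero at all the homogeneous
coordinates of all the points of `C`. -/
def VanishesOn (P : CoordPoly) (C : Set ContactVariety) : Prop :=
  ∀ z : Cone, toContactVariety z ∈ C → MvPolynomial.eval (Sum.elim z.1.1 z.1.2) P = 0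

/-- The derivative of `P` at `z` along the vector `p`. -/
def dirDeriv (P : CoordPoly) (z : Cone) (p : Vec3 × Vec3) : ℂ :=
  ∑ k, MvPolynomial.eval (Sum.elim z.1.1 z.1.2) (MvPolynomial.pderiv k P) * Sum.elim p.1 p.2 k

/-- A closed algebraic subset `C` of `M` is invariant for the equation defined by `X` when `X` is
tangent to `C`: the derivative along `X` of each polynomial which vanishes on `C` vanishes on `C`.
Points where `X` is zero are allowed on `C`. -/
def IsInvariant {a b : ℕ} (F : SecondOrderEq a b) (C : Set ContactVariety) : Prop :=
  ∀ P : CoordPoly, VanishesOn P C →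
    ∀ z : Cone, toContactVariety z ∈ C →
      ∀ p : Vec3 × Vec3, Submodule.Quotient.mk p = F.rep.1 z → dirDeriv P z p = 0

/-- The lift to `M` of the line `l` of `ℙ²`: the points of `l` with the direction of `l`. -/
def lineLift (l : DualPlane) : Set ContactVariety := {m | m.line = l}

/-- The fibre of `π` over the point `q`, that is, the lift to `M` of the line of `ℙ̌²` formed by
the lines through `q`. -/
def pointFibre (q : Plane) : Set ContactVariety := {m | m.point = q}

/-- `Γ` is an irreducible algebraic curve in the projective plane. -/
def IsIrreducibleCurve (Γ : Set (Projectivization ℂ Vec3)) : Prop :=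
  ∃ (n : ℕ) (G : MvPolynomial (Fin 3) ℂ), G.IsHomogeneous n ∧ Irreducible G ∧
    Γ = {q | MvPolynomial.eval q.rep G = 0}

/-- The Zariski topology of `ℙ(V)`: the complements of the zero loci of homogeneous polynomials in
the linear coordinates on `V` form a basis. -/
abbrev zariskiTopology (V : Type) [AddCommGroup V] [Module ℂ V] :
    TopologicalSpace (Projectivization ℂ V) :=
  TopologicalSpace.generateFrom
    {U | ∃ (n : ℕ) (P : MvPolynomial (Module.Dual ℂ V) ℂ), P.IsHomogeneous n ∧
      U = {F | MvPolynomial.eval (fun φ => φ F.rep) P ≠ 0}}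

/-- A generic element of `ℙ(V)` satisfies `p`: all the elements of some non-empty (and dense)
Zariski open set do. -/
def HoldsGenerically {V : Type} [AddCommGroup V] [Module ℂ V]
    (p : Projectivization ℂ V → Prop) : Prop :=
  ∃ U : Set (Projectivization ℂ V), IsOpen[zariskiTopology V] U ∧ U.Nonempty ∧
    @Dense _ (zariskiTopology V) U ∧ ∀ F ∈ U, p F

end

end SecondOrderODE

/-!
Let a section `X` of `𝒟 ⊗ 𝒪(a, b)` be represented at the point with homogeneous coordinates `(x, ξ)`
by a pair `(v, w)`. The contact conditions say that `v` and `w` satisfy `v ⬝ ξ = 0` and `x ⬝ w = 0`.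
Hence `ξ × w` is a multiple `d(x, ξ) x` of `x`, and `d` (`fibreComponent`) is a holomorphic function
on the cone over the incidence variety, of bidegree `(a - 1, b + 2)`. The lift of the line `[l]` is
invariant if and only if `d(·, l)` vanishes on the points of the line (`isTangent_lineLift_iff`),
and every bihomogeneous `d` comes from some section (`exists_section_of_isBihomogeneous`).

For `a = 1` the function `d` does not depend on `x`, by Liouville's theorem on the line `[ξ]`, and
is a homogeneous polynomial `P(ξ)` of degree `b + 2`. The lines in the zero locus of an irreducible
factor of `P` are therefore invariant (`exists_irreducibleCurve`).

For `a = 2`, growth estimates show that `d` is linear in `x`, and `d(x, ξ) = A(ξ) ⬝ x` for a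
homogeneous polynomial vector field `A` of degree `n = b + 2`. Indeed `ξ ↦ d(η × ξ, ξ)` is a
polynomial `η ⬝ E(ξ)` with `E(ξ) ⬝ ξ = 0`, and such an `E` is `ξ × A` for a multiple `A` of the curl
of `E` (`IsBihomogeneous.eq_sum_potential`). The field `A` depends linearly on the section, and the
lift of `[l]` is invariant if and only if `A(l)` is a multiple of `l`. The lines with this property
are counted by means of the fixed points of `A` on `ℂ³`: if there are `n ^ 3` of them and `A` has
finitely many zeros, then each of the fixed lines carries `n - 1` nonzero fixed points, and the
number of the fixed lines is `(n ^ 3 - 1) / (n - 1) = n ^ 2 + n + 1` (`ncard_fixedLines`).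

It remains to see that this happens generically (`exists_polyFun_ncard_fixedPoints`). For a system
of equations `B = 0` of degree at most `n`, the linear independence of the products
`X ^ α * B ^ β`, with the exponents `α` less than `n`, up to some explicit degree implies that the
monomials `X ^ α` are a basis of the quotient algebra; in particular the zeros are finitely many. If
moreover the Jacobian determinant is a unit in this algebra, then the algebra is reduced and the
Nullstellensatz gives as many zeros as there are such monomials (`ncard_zeros`). These conditions
are expressed by the linear independence of finitely many polynomials which depend polynomially on
the section, so they are open; and they hold for the section with
`A(ξ) = (ξ 1 ^ n, ξ 2 ^ n, ξ 0 ^ n)` (`linearIndepOn_quasiMonomial`, `isUnit_jacobian_cyclic`).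

The statements on the fibres of `π` follow by exchanging the coordinates of points and lines
(`swapSections`).
-/

namespace SecondOrderODE

open MvPolynomial

/-! ### Polynomial functions on a vector space and Zariski-generic properties -/

section

variable {V : Type} [AddCommGroup V] [Module ℂ V]

variable (V) in
/-- The function on a complex vector space defined by a polynomial in its linear functionals. -/
noncomputable def dualEval : MvPolynomial (Module.Dual ℂ V) ℂ →ₐ[ℂ] V → ℂ :=
  aeval fun φ v => φ v

variable (V) in
/-- The algebra of polynomial functions on a complex vector space: those which are polynomials in
finitely many linear functionals. -/
noncomputable def polyFun : Subalgebra ℂ (V → ℂ) :=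
  (dualEval V).range

theorem dualEval_apply (P : MvPolynomial (Module.Dual ℂ V) ℂ) (v : V) :
    dualEval V P v = eval (fun φ => φ v) P := by
  have h : (Pi.evalAlgHom ℂ (fun _ : V => ℂ) v).comp (dualEval V) = aeval fun φ => φ v :=
    MvPolynomial.algHom_ext fun φ => by simp [dualEval]
  exact AlgHom.congr_fun h P

theorem mem_polyFun {f : V → ℂ} :
    f ∈ polyFun V ↔ ∃ P : MvPolynomial (Module.Dual ℂ V) ℂ, ∀ v, f v = eval (fun φ => φ v) P := by
  simp_rw [polyFun, AlgHom.mem_range, ← dualEval_apply]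
  exact exists_congr fun P => ⟨fun h v => (congrFun h v).symm, fun h => (funext h).symm⟩

theorem dual_mem_polyFun (φ : Module.Dual ℂ V) : (fun v => φ v) ∈ polyFun V :=
  mem_polyFun.2 ⟨X φ, fun v => by simp⟩

theorem eval_smul_of_isHomogeneous {σ : Type*} {n : ℕ} {P : MvPolynomial σ ℂ}
    (hP : P.IsHomogeneous n) (c : ℂ) (x : σ → ℂ) :
    eval (fun i => c * x i) P = c ^ n * eval x P := by
  rw [eval_eq, eval_eq, Finset.mul_sum]
  refine Finset.sum_congr rfl fun d hd => ?_
  have hdeg : ∑ i ∈ d.support, d i = n := by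
    simpa [Finsupp.weight_apply, Finsupp.sum] using hP (mem_support_iff.1 hd)
  simp_rw [mul_pow]
  rw [Finset.prod_mul_distrib, Finset.prod_pow_eq_pow_sum, hdeg]
  ring

/-- A polynomial function restricts to a polynomial on every affine line. -/
theorem exists_polynomial_of_mem_polyFun {f : V → ℂ} (hf : f ∈ polyFun V) (v w : V) :
    ∃ p : Polynomial ℂ, ∀ t : ℂ, f (v + t • w) = p.eval t := by
  obtain ⟨P, hP⟩ := mem_polyFun.1 hf
  refine ⟨aeval (fun φ : Module.Dual ℂ V => Polynomial.C (φ v) + Polynomial.X * Polynomial.C (φ w))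
    P, fun t => ?_⟩
  rw [hP]
  have : (Polynomial.evalRingHom t).comp (aeval (R := ℂ) (fun φ : Module.Dual ℂ V =>
      Polynomial.C (φ v) + Polynomial.X * Polynomial.C (φ w))).toRingHom =
      eval (fun φ => φ (v + t • w)) := by
    refine MvPolynomial.ringHom_ext (fun r => ?_) fun φ => ?_
    · simp
    · simp only [RingHom.comp_apply, AlgHom.toRingHom_eq_coe, RingHom.coe_coe, aeval_X,
        Polynomial.coe_evalRingHom, Polynomial.eval_mul, Polynomial.eval_C,
        Polynomial.eval_X, eval_X, map_add, map_smul, smul_eq_mul]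
  exact (RingHom.congr_fun this P).symm

/-- Two polynomial functions which do not vanish identically have a common point where they do not
vanish, because the polynomials in one variable form a domain. -/
theorem exists_ne_zero_and_ne_zero {f g : V → ℂ} (hf : f ∈ polyFun V) (hg : g ∈ polyFun V)
    {v w : V} (hv : f v ≠ 0) (hw : g w ≠ 0) : ∃ u, f u ≠ 0 ∧ g u ≠ 0 := by
  obtain ⟨p, hp⟩ := exists_polynomial_of_mem_polyFun hf v (w - v)
  obtain ⟨q, hq⟩ := exists_polynomial_of_mem_polyFun hg v (w - v)
  have hp0 : p ≠ 0 := by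
    rintro rfl
    exact hv (by simpa using hp 0)
  have hq0 : q ≠ 0 := by
    rintro rfl
    exact hw (by simpa using hq 1)
  obtain ⟨t, ht⟩ : ∃ t, (p * q).eval t ≠ 0 := by
    by_contra! h
    exact mul_ne_zero hp0 hq0 (Polynomial.funext fun t => by simpa using h t)
  rw [Polynomial.eval_mul] at ht
  exact ⟨v + t • (w - v), hp t ▸ left_ne_zero_of_mul ht, hq t ▸ right_ne_zero_of_mul ht⟩

theorem isBasis_zariskiTopology :
    @TopologicalSpace.IsTopologicalBasis _ (zariskiTopology V)
      {U | ∃ (n : ℕ) (P : MvPolynomial (Module.Dual ℂ V) ℂ), P.IsHomogeneous n ∧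
        U = {F : Projectivization ℂ V | eval (fun φ => φ F.rep) P ≠ 0}} := by
  let := zariskiTopology V
  refine TopologicalSpace.isTopologicalBasis_of_subbasis_of_finiteInter rfl ⟨?_, ?_⟩
  · exact ⟨0, 1, isHomogeneous_one _ _, by simp⟩
  · rintro _ ⟨n, P, hP, rfl⟩ _ ⟨m, Q, hQ, rfl⟩
    refine ⟨n + m, P * Q, hP.mul hQ, ?_⟩
    ext F
    simp

/-- A property of the points of a projective space holds generically as soon as it holds where some
polynomial function, not zero at some nonzero vector, does not vanish. The function needs not be
homogeneous: where one of its homogeneous components does not vanish at `v`, the function itself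
does not vanish at some multiple of `v`. -/
theorem holdsGenerically_of_polyFun {p : Projectivization ℂ V → Prop} {f : V → ℂ}
    (hf : f ∈ polyFun V) {v₀ : V} (hv₀ : v₀ ≠ 0) (hfv₀ : f v₀ ≠ 0)
    (hp : ∀ (v : V) (hv : v ≠ 0), f v ≠ 0 → p (Projectivization.mk ℂ v hv)) :
    HoldsGenerically p := by
  obtain ⟨P, hP⟩ := mem_polyFun.1 hf
  -- the expansion of `f` along a line through the origin
  have key : ∀ (v : V) (c : ℂ), f (c • v) =
      (∑ k ∈ Finset.range (P.totalDegree + 1),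
        Polynomial.C (eval (fun φ : Module.Dual ℂ V => φ v) (homogeneousComponent k P)) *
          Polynomial.X ^ k).eval c := by
    intro v c
    rw [hP]
    conv_lhs => rw [← sum_homogeneousComponent P]
    rw [map_sum, Polynomial.eval_finsetSum]
    refine Finset.sum_congr rfl fun k _ => ?_
    have := eval_smul_of_isHomogeneous (homogeneousComponent_isHomogeneous k P) c (fun φ => φ v)
    simp only [map_smul, smul_eq_mul, this, Polynomial.eval_mul, Polynomial.eval_C,
      Polynomial.eval_pow, Polynomial.eval_X]
    ring
  obtain ⟨k, hk, hk0⟩ : ∃ k ∈ Finset.range (P.totalDegree + 1),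
      eval (fun φ => φ v₀) (homogeneousComponent k P) ≠ 0 := by
    by_contra! h
    apply hfv₀
    rw [← one_smul ℂ v₀, key, Finset.sum_eq_zero]
    · simp
    · intro k hk
      rw [h k hk]
      simp
  set Q := homogeneousComponent k P with hQ
  have hQh : Q.IsHomogeneous k := homogeneousComponent_isHomogeneous k P
  have hrep : ∀ (v : V) (hv : v ≠ 0), eval (fun φ => φ v) Q ≠ 0 →
      eval (fun φ => φ (Projectivization.mk ℂ v hv).rep) Q ≠ 0 := by
    intro v hv h
    obtain ⟨a, ha⟩ := Projectivization.exists_smul_eq_mk_rep ℂ v hv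
    have := eval_smul_of_isHomogeneous hQh (a : ℂ) (fun φ => φ v)
    rw [← ha]
    simp only [Units.smul_def, map_smul, smul_eq_mul, this]
    exact mul_ne_zero (pow_ne_zero _ a.ne_zero) h
  let := zariskiTopology V
  refine ⟨{F | eval (fun φ => φ F.rep) Q ≠ 0}, ?_, ⟨Projectivization.mk ℂ v₀ hv₀, hrep v₀ hv₀ hk0⟩,
    ?_, ?_⟩
  · exact TopologicalSpace.isOpen_generateFrom_of_mem ⟨k, Q, hQh, rfl⟩
  · rw [isBasis_zariskiTopology.dense_iff]
    rintro _ ⟨m, R, hR, rfl⟩ ⟨G, hG⟩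
    obtain ⟨φ, hφ⟩ : ∃ φ : Module.Dual ℂ V, φ v₀ ≠ 0 := by
      by_contra! h
      exact hv₀ ((Module.forall_dual_apply_eq_zero_iff ℂ v₀).1 h)
    obtain ⟨u, hu, hu'⟩ := exists_ne_zero_and_ne_zero
      (f := fun v => eval (fun φ : Module.Dual ℂ V => φ v) (Q * X φ))
      (g := fun v => eval (fun φ : Module.Dual ℂ V => φ v) R)
      (mem_polyFun.2 ⟨_, fun _ => rfl⟩) (mem_polyFun.2 ⟨_, fun _ => rfl⟩) (v := v₀) (w := G.rep)
      (by simpa using ⟨hk0, hφ⟩) hG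
    simp only [map_mul, eval_X] at hu
    have hu0 : u ≠ 0 := by
      rintro rfl
      simp at hu
    refine ⟨Projectivization.mk ℂ u hu0, ?_, hrep u hu0 (left_ne_zero_of_mul hu)⟩
    obtain ⟨a, ha⟩ := Projectivization.exists_smul_eq_mk_rep ℂ u hu0
    have := eval_smul_of_isHomogeneous hR (a : ℂ) (fun φ => φ u)
    rw [Set.mem_ofPred_eq, ← ha]
    simp only [Units.smul_def, map_smul, smul_eq_mul, this]
    exact mul_ne_zero (pow_ne_zero _ a.ne_zero) hu'
  · intro F hF
    obtain ⟨c, hc, hc0⟩ : ∃ c : ℂ, f (c • F.rep) ≠ 0 ∧ c ≠ 0 := by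
      by_contra! h
      have hzero : (∑ j ∈ Finset.range (P.totalDegree + 1),
          Polynomial.C (eval (fun φ => φ F.rep) (homogeneousComponent j P)) * Polynomial.X ^ j) *
            Polynomial.X = 0 := by
        refine Polynomial.funext fun c => ?_
        rw [Polynomial.eval_mul, ← key, Polynomial.eval_X, Polynomial.eval_zero]
        by_cases hc : f (c • F.rep) = 0
        · rw [hc, zero_mul]
        · rw [h c hc, mul_zero]
      have hzero' := (mul_eq_zero.1 hzero).resolve_right Polynomial.X_ne_zero
      apply hF
      have := congrArg (fun q => Polynomial.coeff q k) hzero'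
      simpa [Polynomial.finsetSum_coeff, Polynomial.coeff_C_mul, Polynomial.coeff_X_pow,
        Finset.mem_range.1 hk, Nat.lt_succ_iff] using this
    have hne : c • F.rep ≠ 0 := smul_ne_zero hc0 F.rep_nonzero
    have hFmk : F = Projectivization.mk ℂ (c • F.rep) hne := by
      conv_lhs => rw [← F.mk_rep]
      exact (Projectivization.mk_eq_mk_iff' ℂ _ _ _ _).2
        ⟨c⁻¹, by rw [smul_smul, inv_mul_cancel₀ hc0, one_smul]⟩
    rw [hFmk]
    exact hp _ hne hc

/-! ### Polynomial families of polynomials -/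

variable {σ : Type}

/-- The algebra of the families of polynomials, parametrized by a vector space, each of whose
coefficients is a polynomial function of the parameter. -/
def polyFam (V σ : Type) [AddCommGroup V] [Module ℂ V] :
    Subalgebra ℂ (V → MvPolynomial σ ℂ) where
  carrier := {w | ∀ m, (fun v => coeff m (w v)) ∈ polyFun V}
  mul_mem' := by
    classical
    intro w w' hw hw' m
    simp only [Pi.mul_apply, coeff_mul]
    have : (fun v => ∑ x ∈ Finset.HasAntidiagonal.antidiagonal m,
        coeff x.1 (w v) * coeff x.2 (w' v)) = ∑ x ∈ Finset.HasAntidiagonal.antidiagonal m,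
          (fun v => coeff x.1 (w v)) * (fun v => coeff x.2 (w' v)) := by
      ext v
      simp
    rw [this]
    exact Subalgebra.sum_mem _ fun x _ => Subalgebra.mul_mem _ (hw x.1) (hw' x.2)
  add_mem' := by
    intro w w' hw hw' m
    exact Subalgebra.add_mem _ (hw m) (hw' m)
  algebraMap_mem' := by
    intro r m
    exact Subalgebra.algebraMap_mem (polyFun V) (coeff m (algebraMap ℂ (MvPolynomial σ ℂ) r))

theorem const_mem_polyFam (P : MvPolynomial σ ℂ) : (fun _ : V => P) ∈ polyFam V σ := fun m =>
  Subalgebra.algebraMap_mem (polyFun V) (coeff m P)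

theorem linearMap_mem_polyFam (A : V →ₗ[ℂ] MvPolynomial σ ℂ) : (fun v => A v) ∈ polyFam V σ :=
  fun m => dual_mem_polyFun ((lcoeff ℂ m).comp A)

theorem det_mem {V ι A : Type*} [Fintype ι] [DecidableEq ι] [CommRing A] [Algebra ℂ A]
    (S : Subalgebra ℂ (V → A)) {M : V → Matrix ι ι A}
    (hM : ∀ i j, (fun v => M v i j) ∈ S) : (fun v => (M v).det) ∈ S := by
  have : (fun v => (M v).det) = ∑ τ : Equiv.Perm ι,
      ((Equiv.Perm.sign τ : ℤ) : V → A) * ∏ i, fun v => M v (τ i) i := by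
    ext v
    simp [Matrix.det_apply']
  rw [this]
  exact Subalgebra.sum_mem _ fun τ _ => Subalgebra.mul_mem _ (intCast_mem S _)
    (Subalgebra.prod_mem _ fun i _ => hM _ _)

/-- Linear independence of the members of a finite polynomial family is an open condition on the
parameter: some minor which does not vanish at `v₀` certifies it. -/
theorem exists_polyFun_linearIndependent {ι : Type*} [Finite ι]
    {w : ι → V → MvPolynomial σ ℂ} (hw : ∀ i, w i ∈ polyFam V σ) {v₀ : V}
    (h₀ : LinearIndependent ℂ fun i => w i v₀) :
    ∃ f ∈ polyFun V, f v₀ ≠ 0 ∧ ∀ v, f v ≠ 0 → LinearIndependent ℂ fun i => w i v := by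
  classical
  have := Fintype.ofFinite ι
  -- the coefficients which occur in the members of the family at `v₀`
  let s : Finset (σ →₀ ℕ) := Finset.univ.biUnion fun i => (w i v₀).support
  let T : MvPolynomial σ ℂ →ₗ[ℂ] (s → ℂ) := LinearMap.pi fun m => lcoeff ℂ m.1
  have hT : LinearIndependent ℂ fun i => T (w i v₀) := by
    rw [Fintype.linearIndependent_iff] at h₀ ⊢
    intro g hg
    refine h₀ g ?_
    ext m
    by_cases hm : m ∈ s
    · have := congrFun hg ⟨m, hm⟩
      simpa [T, coeff_sum] using this
    · have hz : ∀ i, coeff m (w i v₀) = 0 := fun i => by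
        by_contra h
        exact hm (Finset.mem_biUnion.2 ⟨i, Finset.mem_univ i, mem_support_iff.2 h⟩)
      simp [coeff_sum, hz]
  obtain ⟨L, hL⟩ :=
    (Fintype.linearCombination ℂ fun i => T (w i v₀)).exists_leftInverse_of_injective
      (LinearMap.ker_eq_bot.2 (linearIndependent_iff_injective_fintypeLinearCombination.1 hT))
  have hLi : ∀ i, L (T (w i v₀)) = Pi.single i 1 := fun i => by
    have := LinearMap.congr_fun hL (Pi.single i 1)
    simpa using this
  refine ⟨fun v => (Matrix.of fun i j => L (T (w i v)) j).det,
    det_mem (polyFun V) fun i j => ?_, ?_, fun v hv => ?_⟩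
  · have hexp : (fun v => L (T (w i v)) j) =
        ∑ m : s, (L (Pi.single m 1) j) • fun v => coeff m.1 (w i v) := by
      ext v
      have : T (w i v) = ∑ m : s, coeff m.1 (w i v) • (Pi.single m 1 : s → ℂ) := by
        ext m
        simp [T, Finset.sum_apply, Pi.single_apply]
      rw [this]
      simp [Finset.sum_apply, mul_comm]
    simp only [Matrix.of_apply]
    rw [hexp]
    exact Subalgebra.sum_mem _ fun m _ => Subalgebra.smul_mem _ (hw i m.1) _
  · have : (Matrix.of fun i j => L (T (w i v₀)) j) = (1 : Matrix ι ι ℂ) := by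
      ext i j
      simp [hLi, Matrix.one_apply, Pi.single_apply, eq_comm]
    simp only [this, Matrix.det_one]
    exact one_ne_zero
  · have := Matrix.linearIndependent_rows_of_det_ne_zero hv
    exact LinearIndependent.of_comp (L.comp T) this

end

/-! ### Systems of equations whose leading forms have no common zero -/

section

variable {σ K : Type*} [Field K]

theorem monomial_eq_smul (m : σ →₀ ℕ) (c : K) : monomial m c = c • monomial m (1 : K) := by
  rw [smul_monomial, smul_eq_mul, mul_one]

theorem restrictTotalDegree_le_of_monomial_mem {d : ℕ} {S : Submodule K (MvPolynomial σ K)}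
    (h : ∀ m : σ →₀ ℕ, m.degree ≤ d → monomial m 1 ∈ S) : restrictTotalDegree σ K d ≤ S := by
  intro f hf
  rw [mem_restrictTotalDegree] at hf
  rw [f.as_sum]
  refine Submodule.sum_mem _ fun m hm => ?_
  rw [monomial_eq_smul]
  exact Submodule.smul_mem _ _ (h m ((le_totalDegree hm).trans hf))

theorem monomial_mem_restrictTotalDegree {d : ℕ} {m : σ →₀ ℕ} (h : m.degree ≤ d) (c : K) :
    monomial m c ∈ restrictTotalDegree σ K d :=
  (mem_restrictTotalDegree _ _ _).2 ((totalDegree_monomial_le m c).trans h)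

theorem restrictTotalDegree_mono {d e : ℕ} (h : d ≤ e) :
    restrictTotalDegree σ K d ≤ restrictTotalDegree σ K e := fun _ hf =>
  (mem_restrictTotalDegree _ _ _).2 (((mem_restrictTotalDegree _ _ _).1 hf).trans h)

variable [Fintype σ]

/-- As many polynomials of degree at most `d` as there are monomials of degree at most `d` are
linearly independent if and only if they span. -/
theorem linearIndepOn_iff_le_span {d : ℕ} {w : (σ →₀ ℕ) → MvPolynomial σ K}
    (hw : ∀ m, m.degree ≤ d → w m ∈ restrictTotalDegree σ K d) :
    LinearIndepOn K w {m | m.degree ≤ d} ↔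
      restrictTotalDegree σ K d ≤ Submodule.span K (w '' {m | m.degree ≤ d}) := by
  have : Finite {m : σ →₀ ℕ | m.degree ≤ d} := Finsupp.finite_of_degree_le d
  have := Fintype.ofFinite {m : σ →₀ ℕ | m.degree ≤ d}
  let W : {m : σ →₀ ℕ | m.degree ≤ d} → restrictTotalDegree σ K d := fun m => ⟨w m, hw m m.2⟩
  have hcard : Fintype.card {m : σ →₀ ℕ | m.degree ≤ d} =
      Module.finrank K (restrictTotalDegree σ K d) :=
    (Module.finrank_eq_card_basis (basisRestrictSupport K {m : σ →₀ ℕ | m.degree ≤ d})).symm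
  have hcomp : (restrictTotalDegree σ K d).subtype ∘ W =
      fun m : {m : σ →₀ ℕ | m.degree ≤ d} => w m := rfl
  have hspan : Submodule.span K (w '' {m | m.degree ≤ d}) =
      (Submodule.span K (Set.range W)).map (restrictTotalDegree σ K d).subtype := by
    rw [Submodule.map_span, ← Set.range_comp, hcomp, Set.image_eq_range]
  have hind : LinearIndepOn K w {m | m.degree ≤ d} ↔ LinearIndependent K W := by
    rw [← LinearMap.linearIndependent_iff (restrictTotalDegree σ K d).subtype
      (Submodule.ker_subtype _), hcomp]
    rfl
  rw [hind, hspan]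
  constructor
  · intro h f hf
    have htop := h.span_eq_top_of_card_eq_finrank' hcard
    rw [htop]
    exact ⟨⟨f, hf⟩, trivial, rfl⟩
  · intro h
    refine linearIndependent_of_top_le_span_of_card_eq_finrank (fun f _ => ?_) hcard
    obtain ⟨g, hg, hgf⟩ := h f.2
    rwa [← Subtype.ext hgf]

/-- The product `X ^ α * B ^ β`, where `m = α + n β` is the division with remainder by `n` of the
exponents of the monomial `X ^ m`. -/
noncomputable def quasiMonomial (n : ℕ) (B : σ → MvPolynomial σ K) (m : σ →₀ ℕ) :
    MvPolynomial σ K :=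
  ∏ i, (X i ^ (m i % n) * B i ^ (m i / n))

/-- The linear endomorphism of the space of polynomials which replaces each `X i ^ n` in the
monomials by `B i`, as often as possible. -/
noncomputable def expand (n : ℕ) (B : σ → MvPolynomial σ K) :
    MvPolynomial σ K →ₗ[K] MvPolynomial σ K :=
  (basisMonomials σ K).constr K (quasiMonomial n B)

variable {n : ℕ} {B : σ → MvPolynomial σ K}

theorem expand_monomial (m : σ →₀ ℕ) : expand n B (monomial m 1) = quasiMonomial n B m := by
  have := (basisMonomials σ K).constr_basis K (quasiMonomial n B) m
  simpa [expand] using this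

theorem totalDegree_quasiMonomial_le (hB : ∀ i, (B i).totalDegree ≤ n) (m : σ →₀ ℕ) :
    (quasiMonomial n B m).totalDegree ≤ m.degree := by
  rw [Finsupp.degree_eq_sum]
  refine (totalDegree_finsetProd _ _).trans (Finset.sum_le_sum fun i _ => ?_)
  refine (totalDegree_mul _ _).trans ?_
  rw [totalDegree_X_pow]
  calc m i % n + (B i ^ (m i / n)).totalDegree ≤ m i % n + m i / n * n := by
        gcongr
        exact (totalDegree_pow _ _).trans (Nat.mul_le_mul_left _ (hB i))
    _ = m i := by rw [mul_comm]; exact Nat.mod_add_div _ _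

theorem expand_mem_restrictTotalDegree (hB : ∀ i, (B i).totalDegree ≤ n) {d : ℕ}
    {f : MvPolynomial σ K} (hf : f ∈ restrictTotalDegree σ K d) :
    expand n B f ∈ restrictTotalDegree σ K d := by
  have : restrictTotalDegree σ K d ≤ (restrictTotalDegree σ K d).comap (expand n B) :=
    restrictTotalDegree_le_of_monomial_mem fun m hm => by
      rw [Submodule.mem_comap, expand_monomial, mem_restrictTotalDegree]
      exact (totalDegree_quasiMonomial_le hB m).trans hm
  exact this hf

theorem map_expand_restrictTotalDegree (d : ℕ) :
    (restrictTotalDegree σ K d).map (expand n B) =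
      Submodule.span K (quasiMonomial n B '' {m | m.degree ≤ d}) := by
  have : restrictTotalDegree σ K d = Submodule.span K
      ((fun m => monomial m (1 : K)) '' {m : σ →₀ ℕ | m.degree ≤ d}) :=
    restrictSupport_eq_span _ _
  rw [this, Submodule.map_span, Set.image_image]
  simp only [expand_monomial]

theorem quasiMonomial_add_nsmul (hn : 0 < n) (m β : σ →₀ ℕ) :
    quasiMonomial n B (m + n • β) = quasiMonomial n B m * ∏ i, B i ^ β i := by
  rw [quasiMonomial, quasiMonomial, ← Finset.prod_mul_distrib]
  refine Finset.prod_congr rfl fun i _ => ?_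
  simp only [Finsupp.add_apply, Finsupp.smul_apply, smul_eq_mul, Nat.add_mul_mod_self_left,
    Nat.add_mul_div_left _ _ hn, pow_add, mul_assoc]

theorem expand_mul_monomial_nsmul (hn : 0 < n) (f : MvPolynomial σ K) (β : σ →₀ ℕ) :
    expand n B (f * monomial (n • β) 1) = expand n B f * ∏ i, B i ^ β i := by
  have h : (expand n B).comp (LinearMap.mulRight K (monomial (n • β) (1 : K))) =
      (LinearMap.mulRight K (∏ i, B i ^ β i)).comp (expand n B) :=
    (basisMonomials σ K).ext fun m => by
      simp only [coe_basisMonomials, LinearMap.comp_apply, LinearMap.mulRight_apply, monomial_mul,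
        one_mul, expand_monomial]
      exact quasiMonomial_add_nsmul hn m β
  exact LinearMap.congr_fun h f

theorem expand_mul_X_pow [DecidableEq σ] (hn : 0 < n) (f : MvPolynomial σ K) (i : σ) :
    expand n B (f * X i ^ n) = expand n B f * B i := by
  have := expand_mul_monomial_nsmul (B := B) hn f (Finsupp.single i 1)
  rwa [Finsupp.smul_single, smul_eq_mul, mul_one, ← X_pow_eq_monomial,
    Finset.prod_eq_single i (fun j _ hj => by rw [Finsupp.single_eq_of_ne hj, pow_zero])
      (fun h => absurd (Finset.mem_univ i) h), Finsupp.single_eq_same, pow_one] at this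

/-- A monomial is reduced when all its exponents are less than `n`. -/
def IsReducedExp (n : ℕ) (m : σ →₀ ℕ) : Prop := ∀ i, m i < n

theorem quasiMonomial_of_isReducedExp {m : σ →₀ ℕ} (hm : IsReducedExp n m) :
    quasiMonomial n B m = monomial m 1 := by
  rw [monomial_eq, C_1, one_mul, Finsupp.prod_fintype _ _ fun i => pow_zero _, quasiMonomial]
  refine Finset.prod_congr rfl fun i _ => ?_
  rw [Nat.mod_eq_of_lt (hm i), Nat.div_eq_of_lt (hm i), pow_zero, mul_one]

theorem IsReducedExp.degree_le {m : σ →₀ ℕ} (hm : IsReducedExp n m) :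
    m.degree ≤ Fintype.card σ * (n - 1) := by
  rw [Finsupp.degree_eq_sum, ← smul_eq_mul, ← Finset.card_univ]
  exact Finset.sum_le_card_nsmul _ _ _ fun i _ => Nat.le_sub_one_of_lt (hm i)

/-- The quasi-monomials of degree at most `d` span the polynomials of degree at most `d`, for all
`d`, as soon as they are linearly independent up to the degree following that of the largest
reduced monomial: in higher degrees, multiplication by a variable can be carried out on the
reduced factor. -/
theorem restrictTotalDegree_le_map_expand (hn : 0 < n) (hB : ∀ i, (B i).totalDegree ≤ n)
    (hind : LinearIndepOn K (quasiMonomial n B)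
      {m | m.degree ≤ Fintype.card σ * (n - 1) + 1}) (d : ℕ) :
    restrictTotalDegree σ K d ≤ (restrictTotalDegree σ K d).map (expand n B) := by
  classical
  set D := Fintype.card σ * (n - 1) + 1 with hD
  have hsmall : ∀ e ≤ D,
      restrictTotalDegree σ K e ≤ (restrictTotalDegree σ K e).map (expand n B) := by
    intro e he
    rw [map_expand_restrictTotalDegree]
    refine (linearIndepOn_iff_le_span fun m hm => ?_).1 (hind.mono fun m hm => le_trans hm he)
    exact (mem_restrictTotalDegree _ _ _).2 ((totalDegree_quasiMonomial_le hB m).trans hm)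
  induction d with
  | zero => exact hsmall 0 (Nat.zero_le _)
  | succ d ih =>
    refine restrictTotalDegree_le_of_monomial_mem fun m hm => ?_
    rcases Nat.lt_or_ge d m.degree with hlt | hle
    swap
    · exact Submodule.map_mono (restrictTotalDegree_mono (Nat.le_succ d))
        (ih (monomial_mem_restrictTotalDegree hle 1))
    obtain ⟨i, hi⟩ : ∃ i, m i ≠ 0 := by
      by_contra! h
      have : m = 0 := Finsupp.ext h
      simp [this] at hlt
    have hm' : m = (m - Finsupp.single i 1) + Finsupp.single i 1 := by
      rw [tsub_add_cancel_of_le]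
      rw [Finsupp.single_le_iff]
      exact Nat.one_le_iff_ne_zero.2 hi
    set m' := m - Finsupp.single i 1
    have hdeg' : m'.degree ≤ d := by
      rw [hm', map_add, Finsupp.degree_single] at hm
      omega
    -- the products of `X i` with the quasi-monomials of degree at most `d`
    have hmul : (restrictTotalDegree σ K d).map (expand n B) ≤
        ((restrictTotalDegree σ K (d + 1)).map (expand n B)).comap
          (LinearMap.mulRight K (X i)) := by
      rw [Submodule.map_le_iff_le_comap]
      refine restrictTotalDegree_le_of_monomial_mem fun μ hμ => ?_
      rw [Submodule.mem_comap, Submodule.mem_comap, LinearMap.mulRight_apply, expand_monomial]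
      let r : σ →₀ ℕ := μ.mapRange (· % n) (Nat.zero_mod n)
      let β : σ →₀ ℕ := μ.mapRange (· / n) (Nat.zero_div n)
      have hμr : μ = r + n • β := by
        ext j
        simp [r, β, Nat.mod_add_div]
      have hr : IsReducedExp n r := fun j => by
        simpa [r] using Nat.mod_lt _ hn
      obtain ⟨g, hg, hgr⟩ := hsmall (r.degree + 1) (Nat.succ_le_succ hr.degree_le)
        (monomial_mem_restrictTotalDegree (m := r + Finsupp.single i 1) (by simp) 1)
      refine ⟨g * monomial (n • β) 1, ?_, ?_⟩
      · rw [SetLike.mem_coe, mem_restrictTotalDegree] at hg ⊢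
        refine (totalDegree_mul _ _).trans ?_
        have h1 := totalDegree_monomial_le (n • β) (1 : K)
        change _ ≤ (n • β).degree at h1
        have h2 : μ.degree = r.degree + (n • β).degree := by
          conv_lhs => rw [hμr]
          exact map_add _ _ _
        omega
      · rw [expand_mul_monomial_nsmul hn, hgr, hμr, quasiMonomial_add_nsmul hn,
          quasiMonomial_of_isReducedExp hr, monomial_add_single, pow_one]
        ring
    have := hmul (ih (monomial_mem_restrictTotalDegree hdeg' 1))
    rw [Submodule.mem_comap, LinearMap.mulRight_apply] at this
    rw [hm', monomial_add_single, pow_one]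
    exact this

/-- In each degree, a surjective endomorphism of a finite-dimensional space is injective. -/
theorem expand_bijective (hn : 0 < n) (hB : ∀ i, (B i).totalDegree ≤ n)
    (hind : LinearIndepOn K (quasiMonomial n B)
      {m | m.degree ≤ Fintype.card σ * (n - 1) + 1}) : Function.Bijective (expand n B) := by
  have hsurj := restrictTotalDegree_le_map_expand hn hB hind
  constructor
  · rw [injective_iff_map_eq_zero]
    intro f hf
    have hfd : f ∈ restrictTotalDegree σ K f.totalDegree := (mem_restrictTotalDegree _ _ _).2 le_rfl
    let T : restrictTotalDegree σ K f.totalDegree →ₗ[K] restrictTotalDegree σ K f.totalDegree :=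
      (expand n B).restrict fun g hg => expand_mem_restrictTotalDegree hB hg
    have hT : Function.Injective T := by
      rw [LinearMap.injective_iff_surjective]
      rintro ⟨g, hg⟩
      obtain ⟨h, hh, hhg⟩ := hsurj _ hg
      exact ⟨⟨h, hh⟩, Subtype.ext hhg⟩
    have : T ⟨f, hfd⟩ = 0 := Subtype.ext hf
    exact congrArg Subtype.val (hT (this.trans (map_zero T).symm))
  · intro g
    obtain ⟨h, -, hh⟩ := hsurj g.totalDegree ((mem_restrictTotalDegree _ _ _).2 le_rfl)
    exact ⟨h, hh⟩

theorem mem_restrictTotalDegree_of_expand_mem (hn : 0 < n) (hB : ∀ i, (B i).totalDegree ≤ n)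
    (hind : LinearIndepOn K (quasiMonomial n B)
      {m | m.degree ≤ Fintype.card σ * (n - 1) + 1}) {d : ℕ} {f : MvPolynomial σ K}
    (hf : expand n B f ∈ restrictTotalDegree σ K d) : f ∈ restrictTotalDegree σ K d := by
  obtain ⟨g, hg, hgf⟩ := restrictTotalDegree_le_map_expand hn hB hind d hf
  rwa [← (expand_bijective hn hB hind).1 hgf]

/-- The ideal generated by `B` is spanned by the quasi-monomials which are not reduced. -/
theorem expand_mem_span_iff (hn : 0 < n) (hB : ∀ i, (B i).totalDegree ≤ n)
    (hind : LinearIndepOn K (quasiMonomial n B)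
      {m | m.degree ≤ Fintype.card σ * (n - 1) + 1}) {f : MvPolynomial σ K} :
    expand n B f ∈ Ideal.span (Set.range B) ↔ f ∈ restrictSupport K {m | ¬ IsReducedExp n m} := by
  classical
  constructor
  · intro hf
    obtain ⟨c, hc⟩ := (Ideal.mem_span_range_iff_exists_fun).1 hf
    choose h hh using fun i => (expand_bijective hn hB hind).2 (c i)
    have : f = ∑ i, h i * X i ^ n := by
      apply (expand_bijective hn hB hind).1
      rw [map_sum, ← hc]
      exact Finset.sum_congr rfl fun i _ => by rw [expand_mul_X_pow hn, hh]
    rw [this]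
    refine Submodule.sum_mem _ fun i _ => ?_
    rw [mem_restrictSupport_iff]
    intro m hm hred
    rw [Finset.mem_coe, X_pow_eq_monomial] at hm
    have := (mem_support_iff.1 hm)
    rw [coeff_mul_monomial'] at this
    split_ifs at this with hle
    · have h1 := Finsupp.single_le_iff.1 hle
      exact absurd (hred i) (not_lt.2 h1)
    · exact this rfl
  · intro hf
    rw [restrictSupport_eq_span] at hf
    have : Submodule.span K ((fun m => monomial m (1 : K)) '' {m | ¬ IsReducedExp n m}) ≤
        ((Ideal.span (Set.range B)).restrictScalars K).comap (expand n B) := by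
      rw [Submodule.span_le]
      rintro _ ⟨m, hm, rfl⟩
      rw [SetLike.mem_coe, Submodule.mem_comap, Submodule.restrictScalars_mem, expand_monomial,
        quasiMonomial]
      obtain ⟨i, hi⟩ : ∃ i, n ≤ m i := by simpa [IsReducedExp] using hm
      rw [← Finset.mul_prod_erase _ _ (Finset.mem_univ i)]
      refine Ideal.mul_mem_right _ _ (Ideal.mul_mem_left _ _ ?_)
      exact Ideal.pow_mem_of_mem _ (Ideal.subset_span (Set.mem_range_self i)) _ (Nat.div_pos hi hn)
    exact this hf

/-- Every polynomial is congruent to a combination of reduced monomials, modulo the ideal generated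
by `B`. -/
theorem exists_reduced_sub_mem_span (hn : 0 < n) (hB : ∀ i, (B i).totalDegree ≤ n)
    (hind : LinearIndepOn K (quasiMonomial n B)
      {m | m.degree ≤ Fintype.card σ * (n - 1) + 1}) (f : MvPolynomial σ K) :
    ∃ r ∈ restrictSupport K {m : σ →₀ ℕ | IsReducedExp n m}, f - r ∈ Ideal.span (Set.range B) := by
  classical
  obtain ⟨g, rfl⟩ := (expand_bijective hn hB hind).2 f
  induction g using MvPolynomial.induction_on' with
  | monomial m c =>
    rw [monomial_eq_smul, map_smul, expand_monomial]
    by_cases hm : IsReducedExp n m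
    · refine ⟨c • monomial m 1, Submodule.smul_mem _ _ ?_, ?_⟩
      · exact (monomial_mem_restrictSupport K).2 (Or.inl hm)
      · rw [quasiMonomial_of_isReducedExp hm, sub_self]
        exact zero_mem _
    · refine ⟨0, zero_mem _, ?_⟩
      rw [sub_zero, ← expand_monomial, ← map_smul, expand_mem_span_iff hn hB hind]
      exact Submodule.smul_mem _ _ ((monomial_mem_restrictSupport K).2 (Or.inl hm))
  | add p q hp hq =>
    obtain ⟨r, hr, hpr⟩ := hp
    obtain ⟨s, hs, hqs⟩ := hq
    refine ⟨r + s, add_mem hr hs, ?_⟩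
    rw [map_add, add_sub_add_comm]
    exact add_mem hpr hqs

theorem expand_of_reduced {r : MvPolynomial σ K}
    (hr : r ∈ restrictSupport K {m : σ →₀ ℕ | IsReducedExp n m}) : expand n B r = r := by
  rw [restrictSupport_eq_span] at hr
  have : Submodule.span K ((fun m => monomial m (1 : K)) '' {m | IsReducedExp n m}) ≤
      LinearMap.eqLocus (expand n B) LinearMap.id := by
    rw [Submodule.span_le]
    rintro _ ⟨m, hm, rfl⟩
    change expand n B (monomial m 1) = monomial m 1
    rw [expand_monomial, quasiMonomial_of_isReducedExp hm]
  exact this hr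

/-- The reduced monomials are linearly independent modulo the ideal generated by `B`. -/
theorem eq_zero_of_reduced_of_mem_span (hn : 0 < n) (hB : ∀ i, (B i).totalDegree ≤ n)
    (hind : LinearIndepOn K (quasiMonomial n B)
      {m | m.degree ≤ Fintype.card σ * (n - 1) + 1}) {r : MvPolynomial σ K}
    (hr : r ∈ restrictSupport K {m : σ →₀ ℕ | IsReducedExp n m})
    (hr' : r ∈ Ideal.span (Set.range B)) : r = 0 := by
  rw [← expand_of_reduced (B := B) hr, expand_mem_span_iff hn hB hind] at hr'
  rw [← support_eq_empty, ← Finset.coe_eq_empty, Set.eq_empty_iff_forall_notMem]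
  exact fun m hm => (mem_restrictSupport_iff K).1 hr' hm ((mem_restrictSupport_iff K).1 hr hm)

end

/-! ### The zeros of a system with invertible Jacobian determinant -/

section

variable {σ K : Type*} [Field K] [Fintype σ] {n : ℕ} {B : σ → MvPolynomial σ K}

/-- Prescribed values at finitely many points are taken by some polynomial. -/
theorem exists_eval_eq {σ K : Type*} [Field K] (s : Finset (σ → K)) (c : (σ → K) → K) :
    ∃ P : MvPolynomial σ K, ∀ z ∈ s, eval z P = c z := by
  classical
  have hsep : ∀ z z' : σ → K, ∃ Q : MvPolynomial σ K, eval z' Q = 0 ∧ (z ≠ z' → eval z Q ≠ 0) := by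
    intro z z'
    by_cases h : z = z'
    · exact ⟨0, by simp, fun h' => absurd h h'⟩
    · obtain ⟨i, hi⟩ := Function.ne_iff.1 h
      exact ⟨X i - C (z' i), by simp, fun _ => by simpa [sub_eq_zero] using hi⟩
  choose Q hQ hQ' using hsep
  let L : (σ → K) → MvPolynomial σ K := fun z => ∏ z' ∈ s.erase z, Q z z'
  have hL : ∀ z, eval z (L z) ≠ 0 := fun z => by
    rw [map_prod]
    exact Finset.prod_ne_zero_iff.2 fun z' hz' => hQ' z z' (Finset.ne_of_mem_erase hz').symm
  refine ⟨∑ z ∈ s, C (c z / eval z (L z)) * L z, fun z hz => ?_⟩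
  rw [map_sum, Finset.sum_eq_single z]
  · rw [map_mul, eval_C, div_mul_cancel₀ _ (hL z)]
  · intro y _ hy
    have : eval z (L y) = 0 := by
      rw [map_prod]
      exact Finset.prod_eq_zero (Finset.mem_erase.2 ⟨hy.symm, hz⟩) (hQ y z)
    rw [map_mul, this, mul_zero]
  · exact fun h => absurd hz h

theorem natCard_isReducedExp (n : ℕ) :
    Nat.card {m : σ →₀ ℕ | IsReducedExp n m} = n ^ Fintype.card σ := by
  let e : {m : σ →₀ ℕ | IsReducedExp n m} ≃ (σ → Fin n) :=
    { toFun := fun m i => ⟨m.1 i, m.2 i⟩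
      invFun := fun f => ⟨Finsupp.equivFunOnFinite.symm fun i => f i, fun i => by simp⟩
      left_inv := fun m => by ext; simp
      right_inv := fun f => by ext; simp }
  rw [Nat.card_congr e, Nat.card_fun]
  simp

/-- The Jacobian determinant of a system of equations. -/
noncomputable def jacobian [DecidableEq σ] (B : σ → MvPolynomial σ K) : MvPolynomial σ K :=
  (Matrix.of fun i j => pderiv j (B i)).det

/-- An algebra generated by the solution `q ∘ X` of a system of equations whose Jacobian determinant
is invertible at this solution is unramified: the relations between the differentials of the
generators can be inverted. -/
theorem formallyUnramified_of_isUnit_jacobian [DecidableEq σ] {R : Type*} [CommRing R] [Algebra K R]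
    (q : MvPolynomial σ K →ₐ[K] R) (hq : Function.Surjective q) (hB : ∀ i, q (B i) = 0)
    (hJ : IsUnit (q (jacobian B))) :
    Algebra.FormallyUnramified K R := by
  let D := KaehlerDifferential.D K R
  have hchain : ∀ p, D (q p) = ∑ j, q (pderiv j p) • D (q (X j)) := by
    intro p
    induction p using MvPolynomial.induction_on with
    | C a =>
      have : q (C a) = algebraMap K R a := q.commutes a
      simp [this]
    | add p p' hp hp' => simp [hp, hp', add_smul, Finset.sum_add_distrib]
    | mul_X p i hp =>
      rw [map_mul, Derivation.leibniz, hp]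
      simp only [Derivation.leibniz, map_add, smul_eq_mul, map_mul, add_smul,
        Finset.sum_add_distrib, mul_smul, Finset.smul_sum, pderiv_X]
      congr 1
      rw [Finset.sum_eq_single i (fun j _ hj => by simp [hj.symm]) (by simp)]
      simp
  have hzero : ∀ k, D (q (X k)) = 0 := by
    intro k
    have hB' : ∀ i, ∑ j, q (pderiv j (B i)) • D (q (X j)) = 0 := fun i => by
      rw [← hchain, hB, map_zero]
    let M : Matrix σ σ (MvPolynomial σ K) := Matrix.of fun i j => pderiv j (B i)
    have hadj : ∀ j, ∑ i, q (M.adjugate k i) * q (M i j) =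
        if k = j then q M.det else 0 := fun j => by
      have := congrArg q (congrFun (congrFun (Matrix.adjugate_mul M) k) j)
      rw [Matrix.mul_apply, map_sum] at this
      simp only [map_mul] at this
      rw [this, Matrix.smul_apply, Matrix.one_apply]
      split_ifs <;> simp
    have : q M.det • D (q (X k)) = 0 := by
      calc q M.det • D (q (X k)) = ∑ j, (∑ i, q (M.adjugate k i) * q (M i j)) • D (q (X j)) := by
            simp only [hadj, ite_smul, zero_smul, Finset.sum_ite_eq, Finset.mem_univ, if_true]
        _ = ∑ i, q (M.adjugate k i) • ∑ j, q (M i j) • D (q (X j)) := by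
            simp only [Finset.sum_smul, Finset.smul_sum, mul_smul]
            exact Finset.sum_comm
        _ = 0 := Finset.sum_eq_zero fun i _ => by
            have := hB' i
            simp only [M, Matrix.of_apply]
            rw [this, smul_zero]
    exact (IsUnit.smul_eq_zero hJ).1 this
  refine ⟨?_⟩
  rw [← Submodule.subsingleton_iff R, ← subsingleton_iff_bot_eq_top,
    ← KaehlerDifferential.span_range_derivation, eq_comm, Submodule.span_eq_bot]
  rintro _ ⟨x, rfl⟩
  obtain ⟨p, rfl⟩ := hq x
  change D (q p) = 0
  rw [hchain]
  simp [hzero]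

/-- The Jacobian criterion: the quotient by the ideal generated by `B` is unramified over the field,
hence reduced. -/
theorem isRadical_span_of_isUnit_jacobian [DecidableEq σ]
    (hJ : IsUnit (Ideal.Quotient.mk (Ideal.span (Set.range B)) (jacobian B))) :
    (Ideal.span (Set.range B)).IsRadical := by
  have : Algebra.FormallyUnramified K (MvPolynomial σ K ⧸ Ideal.span (Set.range B)) :=
    formallyUnramified_of_isUnit_jacobian (Ideal.Quotient.mkₐ K _) Ideal.Quotient.mk_surjective
      (fun i => Ideal.Quotient.eq_zero_iff_mem.2 (Ideal.subset_span (Set.mem_range_self i))) hJ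
  rw [Ideal.isRadical_iff_quotient_reduced]
  exact Algebra.FormallyUnramified.isReduced_of_field K _

theorem eval_eq_zero_of_mem_span {σ : Type*} {B : σ → MvPolynomial σ K} {f : MvPolynomial σ K}
    (hf : f ∈ Ideal.span (Set.range B))
    {z : σ → K} (hz : ∀ i, eval z (B i) = 0) : eval z f = 0 := by
  have : Ideal.span (Set.range B) ≤ RingHom.ker (eval z) := by
    rw [Ideal.span_le]
    rintro _ ⟨i, rfl⟩
    exact hz i
  exact this hf

/-- The values of a polynomial at the zeros of the system depend only on its class in the quotient,
which is spanned by the reduced monomials. -/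
theorem card_le_of_zeros (hn : 0 < n) (hB : ∀ i, (B i).totalDegree ≤ n)
    (hind : LinearIndepOn K (quasiMonomial n B)
      {m | m.degree ≤ Fintype.card σ * (n - 1) + 1})
    (s : Finset (σ → K)) (hs : ∀ z ∈ s, ∀ i, eval z (B i) = 0) :
    s.card ≤ n ^ Fintype.card σ := by
  have hfin : Finite {m : σ →₀ ℕ | IsReducedExp n m} :=
    (Finsupp.finite_of_degree_le (Fintype.card σ * (n - 1))).subset fun m hm =>
      IsReducedExp.degree_le hm
  let Red := restrictSupport K {m : σ →₀ ℕ | IsReducedExp n m}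
  have hfd : Module.Finite K Red := Module.Finite.of_basis (basisRestrictSupport K _)
  let T : Red →ₗ[K] (s → K) := LinearMap.pi fun z => (aeval z.1).toLinearMap ∘ₗ Red.subtype
  have hT : Function.Surjective T := by
    intro c
    obtain ⟨P, hP⟩ := exists_eval_eq s (Function.extend Subtype.val c 0)
    obtain ⟨r, hr, hPr⟩ := exists_reduced_sub_mem_span hn hB hind P
    refine ⟨⟨r, hr⟩, ?_⟩
    ext z
    have h1 := eval_eq_zero_of_mem_span hPr (hs z.1 z.2)
    rw [map_sub, sub_eq_zero, hP z.1 z.2, Subtype.val_injective.extend_apply] at h1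
    simpa [T, aeval_eq_eval] using h1.symm
  have h := LinearMap.finrank_le_finrank_of_surjective hT
  rwa [Module.finrank_fintype_fun_eq_card, Fintype.card_coe,
    Module.finrank_eq_nat_card_basis (basisRestrictSupport K _), natCard_isReducedExp] at h

theorem finite_zeros (hn : 0 < n) (hB : ∀ i, (B i).totalDegree ≤ n)
    (hind : LinearIndepOn K (quasiMonomial n B)
      {m | m.degree ≤ Fintype.card σ * (n - 1) + 1}) :
    {z : σ → K | ∀ i, eval z (B i) = 0}.Finite := by
  by_contra h
  obtain ⟨s, hs, hcard⟩ := Set.Infinite.exists_subset_card_eq h (n ^ Fintype.card σ + 1)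
  have := card_le_of_zeros hn hB hind s fun z hz => hs hz
  omega

/-- Bézout's count: a system with reduced quotient has as many zeros as there are reduced
monomials. -/
theorem ncard_zeros [IsAlgClosed K] (hn : 0 < n) (hB : ∀ i, (B i).totalDegree ≤ n)
    (hind : LinearIndepOn K (quasiMonomial n B)
      {m | m.degree ≤ Fintype.card σ * (n - 1) + 1})
    (hrad : (Ideal.span (Set.range B)).IsRadical) :
    {z : σ → K | ∀ i, eval z (B i) = 0}.ncard = n ^ Fintype.card σ := by
  have hZ := finite_zeros hn hB hind
  apply le_antisymm
  · rw [Set.ncard_eq_toFinset_card _ hZ]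
    exact card_le_of_zeros hn hB hind _ fun z hz => by simpa using hz
  · have := hZ.fintype
    let Red := restrictSupport K {m : σ →₀ ℕ | IsReducedExp n m}
    let T : Red →ₗ[K] ({z : σ → K | ∀ i, eval z (B i) = 0} → K) :=
      LinearMap.pi fun z => (aeval z.1).toLinearMap ∘ₗ Red.subtype
    have hT : Function.Injective T := by
      rw [injective_iff_map_eq_zero]
      rintro ⟨r, hr⟩ hr0
      refine Subtype.ext (eq_zero_of_reduced_of_mem_span hn hB hind hr ?_)
      rw [← hrad.radical, ← vanishingIdeal_zeroLocus_eq_radical (K := K), mem_vanishingIdeal_iff]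
      intro z hz
      exact congrFun hr0 ⟨z, fun i => by
        simpa [aeval_eq_eval] using hz _ (Ideal.subset_span (Set.mem_range_self i))⟩
    have h := LinearMap.finrank_le_finrank_of_injective hT
    rw [Module.finrank_fintype_fun_eq_card,
      Module.finrank_eq_nat_card_basis (basisRestrictSupport K _), natCard_isReducedExp] at h
    rwa [← Nat.card_coe_set_eq, Nat.card_eq_fintype_card]

end

/-! ### Counting the solutions of a generic system of equations -/

section

variable {σ K : Type*} [Field K] [Fintype σ] {n : ℕ} {B : σ → MvPolynomial σ K}

theorem totalDegree_pderiv_le {σ : Type*} (f : MvPolynomial σ K) (i : σ) :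
    (pderiv i f).totalDegree ≤ f.totalDegree - 1 := by
  refine Finset.sup_le fun m hm => ?_
  rw [mem_support_iff, coeff_pderiv] at hm
  have h := le_totalDegree (mem_support_iff.2 (left_ne_zero_of_mul hm))
  change (m + Finsupp.single i 1).degree ≤ _ at h
  rw [map_add, Finsupp.degree_single] at h
  exact Nat.le_sub_one_of_lt h

theorem totalDegree_jacobian_le [DecidableEq σ] (hB : ∀ i, (B i).totalDegree ≤ n) :
    (jacobian B).totalDegree ≤ Fintype.card σ * (n - 1) := by
  rw [jacobian, Matrix.det_apply]
  refine totalDegree_finsetSum_le fun τ _ => ?_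
  have h : (∏ i, Matrix.of (fun i j => pderiv j (B i)) (τ i) i).totalDegree ≤
      Fintype.card σ * (n - 1) := by
    refine (totalDegree_finsetProd _ _).trans ?_
    rw [← smul_eq_mul, ← Finset.card_univ]
    refine Finset.sum_le_card_nsmul _ _ _ fun i _ => ?_
    exact (totalDegree_pderiv_le _ _).trans (Nat.sub_le_sub_right (hB _) 1)
  rcases Int.units_eq_one_or (Equiv.Perm.sign τ) with h1 | h1 <;> rw [h1]
  · simpa using h
  · simpa using h

open Classical in
/-- The multiples of the Jacobian determinant of `B` by the reduced monomials, together with the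
quasi-monomials which are not reduced. -/
noncomputable def jacobianFamily (n : ℕ) (B : σ → MvPolynomial σ K) (m : σ →₀ ℕ) :
    MvPolynomial σ K :=
  if IsReducedExp n m then monomial m 1 * jacobian B else quasiMonomial n B m

theorem jacobianFamily_mem (hB : ∀ i, (B i).totalDegree ≤ n) {m : σ →₀ ℕ}
    (hm : m.degree ≤ 2 * (Fintype.card σ * (n - 1))) :
    jacobianFamily n B m ∈ restrictTotalDegree σ K (2 * (Fintype.card σ * (n - 1))) := by
  classical
  rw [mem_restrictTotalDegree, jacobianFamily]
  split_ifs with h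
  · refine (totalDegree_mul _ _).trans ?_
    have h1 := totalDegree_monomial_le m (1 : K)
    change _ ≤ m.degree at h1
    have h2 := h.degree_le
    have h3 := totalDegree_jacobian_le hB
    have h4 : (jacobian B).totalDegree ≤ Fintype.card σ * (n - 1) := by convert h3
    omega
  · exact (totalDegree_quasiMonomial_le hB m).trans hm

theorem quasiMonomial_mem_span (hn : 0 < n) {m : σ →₀ ℕ} (hm : ¬ IsReducedExp n m) :
    quasiMonomial n B m ∈ Ideal.span (Set.range B) := by
  classical
  rw [quasiMonomial]
  obtain ⟨i, hi⟩ : ∃ i, n ≤ m i := by simpa [IsReducedExp] using hm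
  rw [← Finset.mul_prod_erase _ _ (Finset.mem_univ i)]
  refine Ideal.mul_mem_right _ _ (Ideal.mul_mem_left _ _ ?_)
  exact Ideal.pow_mem_of_mem _ (Ideal.subset_span (Set.mem_range_self i)) _ (Nat.div_pos hi hn)

/-- The linear independence of the Jacobian family expresses the invertibility of the Jacobian
determinant modulo the ideal generated by `B`, in a way which is open in `B`. -/
theorem isUnit_jacobian_of_linearIndepOn [DecidableEq σ] (hn : 0 < n)
    (hB : ∀ i, (B i).totalDegree ≤ n)
    (hind : LinearIndepOn K (jacobianFamily n B)
      {m | m.degree ≤ 2 * (Fintype.card σ * (n - 1))}) :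
    IsUnit (Ideal.Quotient.mk (Ideal.span (Set.range B)) (jacobian B)) := by
  have hspan := (linearIndepOn_iff_le_span fun m hm => jacobianFamily_mem hB hm).1 hind
  have h1 : (1 : MvPolynomial σ K) ∈ Ideal.span {jacobian B} ⊔ Ideal.span (Set.range B) := by
    have hle : Submodule.span K
        (jacobianFamily n B '' {m | m.degree ≤ 2 * (Fintype.card σ * (n - 1))}) ≤
          (Ideal.span {jacobian B} ⊔ Ideal.span (Set.range B)).restrictScalars K := by
      rw [Submodule.span_le]
      rintro _ ⟨m, -, rfl⟩
      rw [SetLike.mem_coe, Submodule.restrictScalars_mem, jacobianFamily]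
      split_ifs with h
      · refine Ideal.mul_mem_left _ _ (Ideal.mem_sup_left (Ideal.subset_span ?_))
        rw [Set.mem_singleton_iff]
        congr!
      · exact Ideal.mem_sup_right (quasiMonomial_mem_span hn h)
    exact hle (hspan ((mem_restrictTotalDegree _ _ _).2 (by simp)))
  obtain ⟨y, hy, z, hz, hyz⟩ := Submodule.mem_sup.1 h1
  obtain ⟨c, rfl⟩ := Ideal.mem_span_singleton'.1 hy
  refine IsUnit.of_mul_eq_one (Ideal.Quotient.mk _ c) ?_
  rw [← map_mul, ← map_one (Ideal.Quotient.mk _), Ideal.Quotient.eq, ← hyz]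
  have : jacobian B * c - (c * jacobian B + z) = -z := by ring
  rw [this]
  exact neg_mem hz

theorem linearIndepOn_jacobianFamily [DecidableEq σ] (hn : 0 < n) (hB : ∀ i, (B i).totalDegree ≤ n)
    (hind : LinearIndepOn K (quasiMonomial n B)
      {m | m.degree ≤ Fintype.card σ * (n - 1) + 1})
    (hJ : IsUnit (Ideal.Quotient.mk (Ideal.span (Set.range B)) (jacobian B))) :
    LinearIndepOn K (jacobianFamily n B) {m | m.degree ≤ 2 * (Fintype.card σ * (n - 1))} := by
  rw [linearIndepOn_iff_le_span fun m hm => jacobianFamily_mem hB hm]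
  intro f hf
  obtain ⟨u', hu'⟩ := hJ.exists_right_inv
  obtain ⟨u, rfl⟩ := Ideal.Quotient.mk_surjective u'
  rw [← map_mul, ← map_one (Ideal.Quotient.mk _), Ideal.Quotient.eq] at hu'
  obtain ⟨r, hr, hur⟩ := exists_reduced_sub_mem_span hn hB hind (u * f)
  have hmem : f - r * jacobian B ∈ Ideal.span (Set.range B) := by
    have : f - r * jacobian B =
        jacobian B * (u * f - r) - f * (jacobian B * u - 1) := by ring
    rw [this]
    exact sub_mem (Ideal.mul_mem_left _ _ hur) (Ideal.mul_mem_left _ _ hu')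
  have hrd : ∀ m ∈ r.support, IsReducedExp n m := fun m hm => (mem_restrictSupport_iff K).1 hr hm
  have hdeg : f - r * jacobian B ∈ restrictTotalDegree σ K (2 * (Fintype.card σ * (n - 1))) := by
    refine sub_mem hf ((mem_restrictTotalDegree _ _ _).2 ((totalDegree_mul _ _).trans ?_))
    have h1 : r.totalDegree ≤ Fintype.card σ * (n - 1) :=
      Finset.sup_le fun m hm => (hrd m hm).degree_le
    have h2 := totalDegree_jacobian_le hB
    omega
  obtain ⟨h, hh⟩ := (expand_bijective hn hB hind).2 (f - r * jacobian B)
  rw [← hh] at hmem hdeg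
  rw [expand_mem_span_iff hn hB hind] at hmem
  replace hdeg := mem_restrictTotalDegree_of_expand_mem hn hB hind hdeg
  rw [eq_add_of_sub_eq hh.symm]
  refine add_mem ?_ ?_
  · rw [h.as_sum, map_sum]
    refine Submodule.sum_mem _ fun m hm => ?_
    rw [monomial_eq_smul, map_smul, expand_monomial]
    refine Submodule.smul_mem _ _ (Submodule.subset_span ⟨m, ?_, ?_⟩)
    · exact (le_totalDegree hm).trans ((mem_restrictTotalDegree _ _ _).1 hdeg)
    · beta_reduce
      rw [jacobianFamily, if_neg ((mem_restrictSupport_iff K).1 hmem hm)]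
  · rw [r.as_sum, Finset.sum_mul]
    refine Submodule.sum_mem _ fun m hm => ?_
    rw [monomial_eq_smul, smul_mul_assoc]
    refine Submodule.smul_mem _ _ (Submodule.subset_span ⟨m, ?_, ?_⟩)
    · have := (hrd m hm).degree_le
      rw [Set.mem_ofPred_eq]
      omega
    · beta_reduce
      rw [jacobianFamily, if_pos (hrd m hm)]
      congr!

end

section

variable {σ K : Type*} [Field K]

/-- The polynomials `x` and `y` have degree at most `k` and the same part of degree `k`. -/
def SameTop (k : ℕ) (x y : MvPolynomial σ K) : Prop :=
  x.totalDegree ≤ k ∧ y.totalDegree ≤ k ∧ (x - y = 0 ∨ (x - y).totalDegree < k)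

theorem SameTop.mul {k l : ℕ} {x y x' y' : MvPolynomial σ K} (h : SameTop k x y)
    (h' : SameTop l x' y') : SameTop (k + l) (x * x') (y * y') := by
  refine ⟨(totalDegree_mul _ _).trans (add_le_add h.1 h'.1),
    (totalDegree_mul _ _).trans (add_le_add h.2.1 h'.2.1), ?_⟩
  have heq : x * x' - y * y' = (x - y) * x' + y * (x' - y') := by ring
  have h1 : (x - y) * x' = 0 ∨ ((x - y) * x').totalDegree < k + l := by
    rcases h.2.2 with h0 | h0
    · exact Or.inl (by rw [h0, zero_mul])
    · exact Or.inr ((totalDegree_mul _ _).trans_lt (add_lt_add_of_lt_of_le h0 h'.1))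
  have h2 : y * (x' - y') = 0 ∨ (y * (x' - y')).totalDegree < k + l := by
    rcases h'.2.2 with h0 | h0
    · exact Or.inl (by rw [h0, mul_zero])
    · exact Or.inr ((totalDegree_mul _ _).trans_lt (add_lt_add_of_le_of_lt h.2.1 h0))
  rw [heq]
  rcases h1 with h1 | h1
  · rwa [h1, zero_add]
  · rcases h2 with h2 | h2
    · rw [h2, add_zero]
      exact Or.inr h1
    · exact Or.inr ((totalDegree_add _ _).trans_lt (max_lt h1 h2))

theorem SameTop.one : SameTop 0 (1 : MvPolynomial σ K) 1 := by simp [SameTop]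

theorem SameTop.pow {k : ℕ} {x y : MvPolynomial σ K} (h : SameTop k x y) (l : ℕ) :
    SameTop (l * k) (x ^ l) (y ^ l) := by
  induction l with
  | zero => simpa using SameTop.one
  | succ l ih =>
    rw [pow_succ, pow_succ, Nat.succ_mul]
    exact ih.mul h

theorem SameTop.prod {ι : Type*} (s : Finset ι) {k : ι → ℕ} {x y : ι → MvPolynomial σ K}
    (h : ∀ i ∈ s, SameTop (k i) (x i) (y i)) :
    SameTop (∑ i ∈ s, k i) (∏ i ∈ s, x i) (∏ i ∈ s, y i) := by
  classical
  induction s using Finset.induction_on with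
  | empty => simpa using SameTop.one
  | insert i s hi ih =>
    rw [Finset.sum_insert hi, Finset.prod_insert hi, Finset.prod_insert hi]
    exact (h i (Finset.mem_insert_self i s)).mul
      (ih fun j hj => h j (Finset.mem_insert_of_mem hj))

variable [Fintype σ] {n : ℕ} {B : σ → MvPolynomial σ K}

theorem sameTop_quasiMonomial (hB : ∀ i, SameTop n (B i) (X i ^ n)) (m : σ →₀ ℕ) :
    SameTop m.degree (quasiMonomial n B m) (monomial m 1) := by
  have hm : monomial m (1 : K) = ∏ i, (X i ^ (m i % n) * (X i ^ n) ^ (m i / n)) := by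
    rw [monomial_eq, C_1, one_mul, Finsupp.prod_fintype _ _ fun i => pow_zero _]
    refine Finset.prod_congr rfl fun i _ => ?_
    rw [← pow_mul, ← pow_add, Nat.mod_add_div]
  have hdeg : m.degree = ∑ i, (m i % n + m i / n * n) := by
    rw [Finsupp.degree_eq_sum]
    refine Finset.sum_congr rfl fun i _ => ?_
    rw [mul_comm, Nat.mod_add_div]
  rw [hm, hdeg, quasiMonomial]
  refine SameTop.prod _ fun i _ => SameTop.mul ?_ ((hB i).pow _)
  simp [SameTop]

/-- A system whose leading forms are powers of the variables has linearly independent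
quasi-monomials. -/
theorem linearIndepOn_quasiMonomial (hB : ∀ i, SameTop n (B i) (X i ^ n)) (d : ℕ) :
    LinearIndepOn K (quasiMonomial n B) {m | m.degree ≤ d} := by
  have hmem : ∀ (d : ℕ) (m : σ →₀ ℕ), m.degree ≤ d →
      quasiMonomial n B m ∈ restrictTotalDegree σ K d := fun d m hm =>
    (mem_restrictTotalDegree _ _ _).2 ((sameTop_quasiMonomial hB m).1.trans hm)
  rw [linearIndepOn_iff_le_span (hmem d)]
  induction d with
  | zero =>
    refine restrictTotalDegree_le_of_monomial_mem fun m hm => ?_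
    rcases (sameTop_quasiMonomial hB m).2.2 with h | h
    · rw [← sub_eq_zero.1 h]
      exact Submodule.subset_span ⟨m, hm, rfl⟩
    · omega
  | succ d ih =>
    refine restrictTotalDegree_le_of_monomial_mem fun m hm => ?_
    rw [← sub_sub_cancel (quasiMonomial n B m) (monomial m 1)]
    refine sub_mem (Submodule.subset_span ⟨m, hm, rfl⟩) ?_
    rcases (sameTop_quasiMonomial hB m).2.2 with h | h
    · rw [h]
      exact zero_mem _
    · refine Submodule.span_mono (Set.image_mono fun m hm => ?_)
        (ih ((mem_restrictTotalDegree _ _ _).2 ?_))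
      · exact le_trans hm (Nat.le_succ d)
      · omega

end

section

variable {n : ℕ}

/-- The Jacobian determinant of the cyclic system `x i ^ n = x (i - 1)` does not vanish at its
solutions: in the quotient algebra it is `n ^ 3 * e - 1`, where `e = (x 0 * x 1 * x 2) ^ (n - 1)` is
idempotent. -/
theorem isUnit_jacobian_cyclic (hn : 2 ≤ n) :
    IsUnit (Ideal.Quotient.mk (Ideal.span (Set.range
      fun i : Fin 3 => (X i ^ n - X (i - 1) : MvPolynomial (Fin 3) ℂ)))
        (jacobian fun i : Fin 3 => (X i ^ n - X (i - 1) : MvPolynomial (Fin 3) ℂ))) := by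
  set B : Fin 3 → MvPolynomial (Fin 3) ℂ := fun i => X i ^ n - X (i - 1) with hB
  let q := Ideal.Quotient.mkₐ ℂ (Ideal.span (Set.range B))
  have hdet : jacobian B = C ((n : ℂ) ^ 3) * (X 0 * X 1 * X 2) ^ (n - 1) - 1 := by
    have h : (-1 : Fin 3) = 2 := by decide
    simp [jacobian, Matrix.det_fin_three, hB, pderiv_X, Pi.single_apply, h]
    ring
  have hq : ∀ i : Fin 3, q (X i) ^ n = q (X (i - 1)) := fun i => by
    have : q (B i) = 0 :=
      Ideal.Quotient.eq_zero_iff_mem.2 (Ideal.subset_span (Set.mem_range_self i))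
    simpa [hB, sub_eq_zero] using this
  obtain ⟨k, rfl⟩ := Nat.exists_eq_add_of_le' hn
  set p := q (X 0) * q (X 1) * q (X 2) with hp
  have hpn : p ^ (k + 2) = p := by
    rw [hp, mul_pow, mul_pow, hq, hq, hq]
    change q (X 2) * q (X 0) * q (X 1) = _
    ring
  have he : p ^ (k + 1) * p ^ (k + 1) = p ^ (k + 1) := by
    calc p ^ (k + 1) * p ^ (k + 1) = p ^ (k + 2) * p ^ k := by ring
      _ = p ^ (k + 1) := by rw [hpn]; ring
  have hN : ((k + 2 : ℕ) : ℂ) ^ 3 - 1 ≠ 0 := by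
    rw [sub_ne_zero]
    have : (k + 2) ^ 3 ≠ 1 := by
      intro h
      have := Nat.pow_eq_one.1 h
      omega
    exact_mod_cast this
  set N : ℂ := ((k + 2 : ℕ) : ℂ) ^ 3 with hNdef
  have hJ : q (jacobian B) = algebraMap ℂ _ N * p ^ (k + 1) - 1 := by
    rw [hdet, hp]
    simp only [map_sub, map_mul, map_pow, map_one, Nat.add_succ_sub_one]
    congr 2

  change IsUnit (q (jacobian B))
  refine IsUnit.of_mul_eq_one (algebraMap ℂ _ (N / (N - 1)) * p ^ (k + 1) - 1) ?_
  rw [hJ]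
  have hc : algebraMap ℂ (MvPolynomial (Fin 3) ℂ ⧸ Ideal.span (Set.range B)) N *
      algebraMap ℂ _ (N / (N - 1)) = algebraMap ℂ _ N + algebraMap ℂ _ (N / (N - 1)) := by
    rw [← map_mul, ← map_add]
    congr 1
    field_simp
    ring
  linear_combination (algebraMap ℂ _ N * algebraMap ℂ _ (N / (N - 1))) * he + p ^ (k + 1) * hc

variable {V : Type} [AddCommGroup V] [Module ℂ V]

theorem quasiMonomial_mem_polyFam {σ : Type} [Fintype σ] {B : σ → V → MvPolynomial σ ℂ}
    (hB : ∀ i, B i ∈ polyFam V σ) (m : σ →₀ ℕ) :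
    (fun v => quasiMonomial n (fun i => B i v) m) ∈ polyFam V σ := by
  have : (fun v => quasiMonomial n (fun i => B i v) m) =
      ∏ i, ((fun _ => X i) ^ (m i % n) * B i ^ (m i / n)) := by
    ext1 v
    simp [quasiMonomial]
  rw [this]
  exact Subalgebra.prod_mem _ fun i _ => Subalgebra.mul_mem _
    (Subalgebra.pow_mem _ (const_mem_polyFam _) _) (Subalgebra.pow_mem _ (hB i) _)

theorem pderiv_mem_polyFam {σ : Type} {w : V → MvPolynomial σ ℂ} (hw : w ∈ polyFam V σ) (j : σ) :
    (fun v => pderiv j (w v)) ∈ polyFam V σ := by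
  intro m
  simp only [coeff_pderiv]
  exact Subalgebra.mul_mem _ (hw _)
    (Subalgebra.algebraMap_mem (polyFun V) ((m j : ℂ) + 1))

theorem jacobianFamily_mem_polyFam {σ : Type} [Fintype σ] {B : σ → V → MvPolynomial σ ℂ}
    (hB : ∀ i, B i ∈ polyFam V σ) (m : σ →₀ ℕ) :
    (fun v => jacobianFamily n (fun i => B i v) m) ∈ polyFam V σ := by
  classical
  simp only [jacobianFamily]
  split_ifs with h
  · exact Subalgebra.mul_mem _ (const_mem_polyFam (monomial m 1))
      (det_mem _ fun i j => pderiv_mem_polyFam (hB i) j)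
  · exact quasiMonomial_mem_polyFam hB m

theorem exists_polyFun_linearIndepOn {σ : Type} [Fintype σ] {w : (σ →₀ ℕ) → V → MvPolynomial σ ℂ}
    (hw : ∀ m, w m ∈ polyFam V σ) {v₀ : V} {d : ℕ}
    (h₀ : LinearIndepOn ℂ (fun m => w m v₀) {m | m.degree ≤ d}) :
    ∃ f ∈ polyFun V, f v₀ ≠ 0 ∧
      ∀ v, f v ≠ 0 → LinearIndepOn ℂ (fun m => w m v) {m | m.degree ≤ d} := by
  have : Finite {m : σ →₀ ℕ | m.degree ≤ d} := Finsupp.finite_of_degree_le d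
  exact exists_polyFun_linearIndependent (fun m : {m : σ →₀ ℕ | m.degree ≤ d} => hw m) h₀

/-- In a linear family of polynomial maps `A : ℂ³ → ℂ³` of degree at most `n` which contains the
map `x ↦ (x 1 ^ n, x 2 ^ n, x 0 ^ n)`, the generic one has `n ^ 3` fixed points and finitely many
zeros. -/
theorem exists_polyFun_ncard_fixedPoints (hn : 2 ≤ n) (A : Fin 3 → V →ₗ[ℂ] MvPolynomial (Fin 3) ℂ)
    (hA : ∀ i v, (A i v).totalDegree ≤ n) {v₀ : V} (hv₀ : ∀ i, A i v₀ = X (i + 1) ^ n) :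
    ∃ f ∈ polyFun V, f v₀ ≠ 0 ∧ ∀ v, f v ≠ 0 →
      {z : Fin 3 → ℂ | ∀ i, eval z (A i v) = z i}.ncard = n ^ 3 ∧
        {z : Fin 3 → ℂ | ∀ i, eval z (A i v) = 0}.Finite := by
  -- the equations are shifted so that the leading form of the one with index `i` is `X i ^ n`
  let B : Fin 3 → V → MvPolynomial (Fin 3) ℂ := fun i v => A (i - 1) v - X (i - 1)
  let T : Fin 3 → V → MvPolynomial (Fin 3) ℂ := fun i v => A (i - 1) v
  have hTf : ∀ i, T i ∈ polyFam V (Fin 3) := fun i => linearMap_mem_polyFam (A (i - 1))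
  have hBf : ∀ i, B i ∈ polyFam V (Fin 3) := fun i =>
    Subalgebra.sub_mem _ (linearMap_mem_polyFam (A (i - 1))) (const_mem_polyFam (X (i - 1)))
  have hTd : ∀ v i, (T i v).totalDegree ≤ n := fun v i => hA _ _
  have hBd : ∀ v i, (B i v).totalDegree ≤ n := fun v i => by
    refine (totalDegree_sub _ _).trans (max_le (hA _ _) ?_)
    rw [totalDegree_X]
    omega
  have hT₀ : ∀ i, T i v₀ = X i ^ n := fun i => by simp [T, hv₀]
  have hB₀ : ∀ i, B i v₀ = X i ^ n - X (i - 1) := fun i => by simp [B, hv₀]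
  have hTtop : ∀ i, SameTop n (T i v₀) (X i ^ n) := fun i => by
    simp [SameTop, hT₀]
  have hBtop : ∀ i, SameTop n (B i v₀) (X i ^ n) := fun i => by
    refine ⟨hBd _ _, by simp, Or.inr ?_⟩
    rw [hB₀, sub_sub_cancel_left, totalDegree_neg, totalDegree_X]
    omega
  have hn0 : 0 < n := by omega
  obtain ⟨f₁, hf₁, hf₁0, h₁⟩ := exists_polyFun_linearIndepOn
    (fun m => quasiMonomial_mem_polyFam hTf m)
    (linearIndepOn_quasiMonomial hTtop (Fintype.card (Fin 3) * (n - 1) + 1))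
  obtain ⟨f₂, hf₂, hf₂0, h₂⟩ := exists_polyFun_linearIndepOn
    (fun m => quasiMonomial_mem_polyFam hBf m)
    (linearIndepOn_quasiMonomial hBtop (Fintype.card (Fin 3) * (n - 1) + 1))
  have hJ : LinearIndepOn ℂ (jacobianFamily n fun i => B i v₀)
      {m | m.degree ≤ 2 * (Fintype.card (Fin 3) * (n - 1))} := by
    refine linearIndepOn_jacobianFamily hn0 (hBd v₀) (linearIndepOn_quasiMonomial hBtop _) ?_
    rw [show (fun i => B i v₀) = fun i => X i ^ n - X (i - 1) from funext hB₀]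
    exact isUnit_jacobian_cyclic hn
  obtain ⟨f₃, hf₃, hf₃0, h₃⟩ := exists_polyFun_linearIndepOn
    (fun m => jacobianFamily_mem_polyFam hBf m) hJ
  refine ⟨f₁ * f₂ * f₃, mul_mem (mul_mem hf₁ hf₂) hf₃, mul_ne_zero (mul_ne_zero hf₁0 hf₂0) hf₃0,
    fun v hv => ?_⟩
  have hv₁ : f₁ v ≠ 0 := left_ne_zero_of_mul (left_ne_zero_of_mul hv)
  have hv₂ : f₂ v ≠ 0 := right_ne_zero_of_mul (left_ne_zero_of_mul hv)
  have hv₃ : f₃ v ≠ 0 := right_ne_zero_of_mul hv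
  have hshift : ∀ p : Fin 3 → Prop, (∀ i, p (i - 1)) ↔ ∀ i, p i := fun p =>
    ⟨fun h i => by simpa using h (i + 1), fun h i => h _⟩
  constructor
  · have hu := isUnit_jacobian_of_linearIndepOn (B := fun i => B i v) hn0 (hBd v) (h₃ v hv₃)
    have h := ncard_zeros (B := fun i => B i v) hn0 (hBd v) (h₂ v hv₂)
      (isRadical_span_of_isUnit_jacobian hu)
    rw [Fintype.card_fin] at h
    rw [← h]
    congr 1
    ext z
    simp only [B, Set.mem_ofPred_eq, map_sub, eval_X, sub_eq_zero]
    exact (hshift fun i => eval z (A i v) = z i).symm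
  · refine (finite_zeros (B := fun i => T i v) hn0 (hTd v) (h₁ v hv₁)).subset fun z hz i =>
      hz (i - 1)

end

/-! ### Fixed lines of a homogeneous polynomial map -/

/-- A homogeneous polynomial map of degree `n`, with finitely many zeros and `n ^ 3` fixed points,
has `n ^ 2 + n + 1` fixed lines: the nonzero fixed points on each fixed line are permuted simply
transitively by the roots of unity of order `n - 1`. -/
theorem ncard_fixedLines {n : ℕ} (hn : 2 ≤ n) {A : Fin 3 → MvPolynomial (Fin 3) ℂ}
    (hA : ∀ i, (A i).IsHomogeneous n)
    (hfix : {z : Fin 3 → ℂ | ∀ i, eval z (A i) = z i}.ncard = n ^ 3)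
    (hzero : {z : Fin 3 → ℂ | ∀ i, eval z (A i) = 0}.Finite) :
    {l : Projectivization ℂ Vec3 | ∃ c : ℂ, ∀ i, eval l.rep (A i) = c * l.rep i}.ncard =
      n ^ 2 + n + 1 := by
  obtain ⟨k, rfl⟩ := Nat.exists_eq_add_of_le' hn
  set S := {l : Projectivization ℂ Vec3 | ∃ c : ℂ, ∀ i, eval l.rep (A i) = c * l.rep i} with hS
  set Z := {z : Fin 3 → ℂ | ∀ i, eval z (A i) = z i} with hZ
  have hAs : ∀ (c : ℂ) (z : Fin 3 → ℂ) i, eval (c • z) (A i) = c ^ (k + 2) * eval z (A i) :=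
    fun c z i => eval_smul_of_isHomogeneous (hA i) c z
  -- each fixed line carries a nonzero fixed point
  have hpt : ∀ l : S, ∃ s : ℂ, s ≠ 0 ∧ s • l.1.rep ∈ Z := by
    rintro ⟨l, c, hc⟩
    have hc0 : c ≠ 0 := by
      rintro rfl
      have hmem : ∀ t : ℂ, t • l.rep ∈ {z : Fin 3 → ℂ | ∀ i, eval z (A i) = 0} := fun t i => by
        rw [hAs, hc, zero_mul, mul_zero]
      exact Set.infinite_of_injective_forall_mem (smul_left_injective ℂ l.rep_nonzero) hmem hzero
    obtain ⟨s, hs⟩ := IsAlgClosed.exists_pow_nat_eq c⁻¹ (Nat.succ_pos k)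
    have hs' : s ^ (k + 1) * c = 1 := by rw [hs, inv_mul_cancel₀ hc0]
    refine ⟨s, ?_, fun i => ?_⟩
    · rintro rfl
      simp at hs'
    · rw [hAs, hc, Pi.smul_apply, smul_eq_mul]
      linear_combination (s * l.rep i) * hs'
  choose s hs0 hs using hpt
  have hroot : ∀ c : rootsOfUnity (k + 1) ℂ, (((c : ℂˣ) : ℂ)) ^ (k + 1) = 1 := fun c => by
    have := (mem_rootsOfUnity' _ _).1 c.2
    exact this
  let F : S × rootsOfUnity (k + 1) ℂ → (Z \ {0} : Set (Fin 3 → ℂ)) := fun p =>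
    ⟨((p.2 : ℂˣ) : ℂ) • s p.1 • p.1.1.rep, by
      refine ⟨fun i => ?_, ?_⟩
      · rw [hAs, hs p.1 i, Pi.smul_apply, smul_eq_mul, pow_succ, hroot, one_mul, Pi.smul_apply,
          Pi.smul_apply, smul_eq_mul, smul_eq_mul]
      · exact smul_ne_zero (Units.ne_zero _) (smul_ne_zero (hs0 _) p.1.1.rep_nonzero)⟩
  have hF : Function.Bijective F := by
    constructor
    · rintro ⟨l, c⟩ ⟨l', c'⟩ h
      have h' : ((c : ℂˣ) : ℂ) • s l • l.1.rep = ((c' : ℂˣ) : ℂ) • s l' • l'.1.rep :=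
        congrArg Subtype.val h
      have hl : l = l' := by
        apply Subtype.ext
        rw [← l.1.mk_rep, ← l'.1.mk_rep, Projectivization.mk_eq_mk_iff']
        refine ⟨(((c : ℂˣ) : ℂ) * s l)⁻¹ * (((c' : ℂˣ) : ℂ) * s l'), ?_⟩
        rw [mul_smul, mul_smul (((c' : ℂˣ) : ℂ)), ← h', ← mul_smul ((c : ℂˣ) : ℂ),
          inv_smul_smul₀ (mul_ne_zero (Units.ne_zero _) (hs0 l))]
      subst hl
      have hc := smul_left_injective ℂ (smul_ne_zero (hs0 l) l.1.rep_nonzero) h'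
      exact Prod.ext rfl (Subtype.ext (Units.ext hc))
    · rintro ⟨z, hz, hz0⟩
      have hz0 : z ≠ 0 := hz0
      obtain ⟨a, ha⟩ := Projectivization.exists_smul_eq_mk_rep ℂ z hz0
      have ha' : (Projectivization.mk ℂ z hz0).rep = (a : ℂ) • z := ha.symm
      have hl : Projectivization.mk ℂ z hz0 ∈ S := by
        refine ⟨(a : ℂ) ^ (k + 1), fun i => ?_⟩
        rw [ha', hAs, hz i, Pi.smul_apply, smul_eq_mul]
        ring
      set l : S := ⟨_, hl⟩
      have hb : s l * a ≠ 0 := mul_ne_zero (hs0 l) a.ne_zero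
      set b := s l * a with hbdef
      have hbz : s l • l.1.rep = b • z := by rw [ha', smul_smul]
      have hbk : b ^ (k + 1) = 1 := by
        obtain ⟨i, hi⟩ := Function.ne_iff.1 hz0
        have h1 := hs l i
        rw [hbz, hAs, hz i, Pi.smul_apply, smul_eq_mul] at h1
        have h2 : (b * z i) * (b ^ (k + 1) - 1) = 0 := by linear_combination h1
        exact sub_eq_zero.1 ((mul_eq_zero.1 h2).resolve_left (mul_ne_zero hb hi))
      refine ⟨⟨l, ⟨(Units.mk0 b hb)⁻¹, ?_⟩⟩, Subtype.ext ?_⟩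
      · refine inv_mem ((mem_rootsOfUnity' _ _).2 hbk)
      · change (((Units.mk0 b hb)⁻¹ : ℂˣ) : ℂ) • s l • l.1.rep = z
        rw [hbz, Units.val_inv_eq_inv_val, Units.val_mk0, inv_smul_smul₀ hb]
  have h0 : (0 : Fin 3 → ℂ) ∈ Z := fun i => by
    have := hAs 0 0 i
    rw [smul_zero, zero_pow (by omega), zero_mul] at this
    exact this
  have hcard := Nat.card_congr (Equiv.ofBijective F hF)
  have hroots : Nat.card (rootsOfUnity (k + 1) ℂ) = k + 1 :=
    Complex.card_rootsOfUnity (k + 1)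
  rw [Nat.card_prod, hroots, Nat.card_coe_set_eq, Nat.card_coe_set_eq] at hcard
  have h1 := Set.ncard_sdiff_singleton_add_one h0
    (Set.finite_of_ncard_pos (by rw [hfix]; positivity))
  rw [hfix, ← hcard] at h1
  have h2 : S.ncard * (k + 1) = ((k + 2) ^ 2 + (k + 2) + 1) * (k + 1) := by
    have : (k + 2) ^ 3 = ((k + 2) ^ 2 + (k + 2) + 1) * (k + 1) + 1 := by ring
    omega
  exact Nat.eq_of_mul_eq_mul_right (Nat.succ_pos k) h2

/-! ### Homogeneous holomorphic functions are polynomials -/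

/-- An entire function of polynomial growth is a polynomial. -/
theorem exists_polynomial_of_growth (m : ℕ) {f : ℂ → ℂ} (hf : Differentiable ℂ f) {C : ℝ}
    (hC : ∀ z, ‖f z‖ ≤ C * (1 + ‖z‖) ^ m) :
    ∃ p : Polynomial ℂ, p.natDegree ≤ m ∧ ∀ z, f z = p.eval z := by
  induction m generalizing f C with
  | zero =>
    obtain ⟨c, hc⟩ := hf.exists_const_forall_eq_of_bounded
      (isBounded_iff_forall_norm_le.2 ⟨C, by rintro _ ⟨z, rfl⟩; simpa using hC z⟩)
    exact ⟨Polynomial.C c, by simp, fun z => by simp [hc]⟩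
  | succ m ih =>
    have hg : Differentiable ℂ (dslope f 0) := by
      rw [← differentiableOn_univ]
      exact (Complex.differentiableOn_dslope Filter.univ_mem).2 hf.differentiableOn
    have hC0 : 0 ≤ C := by
      have := (norm_nonneg _).trans (hC 0)
      simpa using this
    obtain ⟨C', hC'⟩ := (isCompact_closedBall (0 : ℂ) 1).exists_bound_of_continuousOn
      hg.continuous.continuousOn
    have hbound : ∀ z, ‖dslope f 0 z‖ ≤ (4 * C + |C'|) * (1 + ‖z‖) ^ m := by
      intro z
      have h1 : 1 ≤ (1 + ‖z‖) ^ m := one_le_pow₀ (by linarith [norm_nonneg z])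
      rcases le_or_gt ‖z‖ 1 with hz | hz
      · have h2 := hC' z (by simpa using hz)
        calc ‖dslope f 0 z‖ ≤ |C'| := h2.trans (le_abs_self C')
          _ ≤ (4 * C + |C'|) * 1 := by linarith
          _ ≤ _ := by gcongr
      · have hz0 : z ≠ 0 := by
          rintro rfl
          simp at hz
          linarith
        have h2 := sub_smul_dslope f 0 z
        rw [sub_zero, smul_eq_mul] at h2
        have h3 : ‖z‖ * ‖dslope f 0 z‖ ≤ ‖z‖ * (4 * C * (1 + ‖z‖) ^ m) := by
          rw [← norm_mul, h2]
          have h4 : ‖f 0‖ ≤ C * (1 + ‖z‖) ^ (m + 1) := by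
            refine (hC 0).trans ?_
            gcongr
            simp
          calc ‖f z - f 0‖ ≤ ‖f z‖ + ‖f 0‖ := norm_sub_le _ _
            _ ≤ C * (1 + ‖z‖) ^ (m + 1) + C * (1 + ‖z‖) ^ (m + 1) := add_le_add (hC z) h4
            _ = (1 + ‖z‖) * (2 * C * (1 + ‖z‖) ^ m) := by ring
            _ ≤ (2 * ‖z‖) * (2 * C * (1 + ‖z‖) ^ m) := by
              gcongr
              linarith
            _ = _ := by ring
        refine (le_of_mul_le_mul_left h3 (by linarith)).trans ?_
        gcongr
        linarith [abs_nonneg C']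
    obtain ⟨p, hp, hpf⟩ := ih hg hbound
    refine ⟨Polynomial.C (f 0) + Polynomial.X * p, ?_, fun z => ?_⟩
    · refine (Polynomial.natDegree_add_le _ _).trans (max_le (by simp) ?_)
      refine Polynomial.natDegree_mul_le.trans ?_
      rw [Polynomial.natDegree_X]
      omega
    · have h2 := sub_smul_dslope f 0 z
      rw [sub_zero, smul_eq_mul, hpf] at h2
      simp only [Polynomial.eval_add, Polynomial.eval_C, Polynomial.eval_mul, Polynomial.eval_X]
      linear_combination -h2

/-- A holomorphic function on `ℂ³ ∖ {0}` which is homogeneous of degree `m`. -/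
structure IsHomogeneousHolomorphic (m : ℕ) (D : Vec3 → ℂ) : Prop where
  smul : ∀ (t : ℂ) (ξ : Vec3), t ≠ 0 → ξ ≠ 0 → D (t • ξ) = t ^ m * D ξ
  differentiableAt : ∀ ξ : Vec3, ξ ≠ 0 → DifferentiableAt ℂ D ξ

/-- The interpolation nodes are positive integers, so as to stay away from the origin. -/
noncomputable def node (i : ℕ) : ℂ := (i : ℂ) + 1

theorem node_ne_zero (i : ℕ) : node i ≠ 0 := Nat.cast_add_one_ne_zero i

theorem node_injective : Function.Injective node := fun i j h => by
  simpa [node] using h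

/-- The fundamental Lagrange polynomials of degree `m`. -/
noncomputable def lagrangeBasis (m i : ℕ) : Polynomial ℂ :=
  Lagrange.basis (Finset.range (m + 1)) node i

theorem eval_eq_sum_lagrangeBasis {m : ℕ} {p : Polynomial ℂ} (hp : p.natDegree ≤ m) (t : ℂ) :
    p.eval t = ∑ i ∈ Finset.range (m + 1), p.eval (node i) * (lagrangeBasis m i).eval t := by
  have h := Lagrange.eq_interpolate (s := Finset.range (m + 1)) (v := node) (f := p)
    node_injective.injOn (by
      rw [Finset.card_range]
      exact lt_of_le_of_lt Polynomial.degree_le_natDegree (by exact_mod_cast Nat.lt_succ_of_le hp))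
  conv_lhs => rw [h]
  simp [Lagrange.interpolate_apply, Polynomial.eval_finsetSum, lagrangeBasis]

/-- The homogeneous polynomial of degree `m` which interpolates a function on `ℂ³` at the points of
a cubic grid. -/
noncomputable def homogInterp (m : ℕ) : (Vec3 → ℂ) →ₗ[ℂ] MvPolynomial (Fin 3) ℂ :=
  homogeneousComponent m ∘ₗ ∑ i ∈ Finset.range (m + 1), ∑ j ∈ Finset.range (m + 1),
    ∑ k ∈ Finset.range (m + 1), (LinearMap.proj ![node i, node j, node k]).smulRight
      (Polynomial.aeval (X 0 : MvPolynomial (Fin 3) ℂ) (lagrangeBasis m i) *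
        Polynomial.aeval (X 1 : MvPolynomial (Fin 3) ℂ) (lagrangeBasis m j) *
        Polynomial.aeval (X 2 : MvPolynomial (Fin 3) ℂ) (lagrangeBasis m k))

theorem homogInterp_isHomogeneous (m : ℕ) (D : Vec3 → ℂ) : (homogInterp m D).IsHomogeneous m :=
  homogeneousComponent_isHomogeneous m _

theorem eval_aeval_X (p : Polynomial ℂ) (i : Fin 3) (ξ : Vec3) :
    eval ξ (Polynomial.aeval (X i : MvPolynomial (Fin 3) ℂ) p) = p.eval (ξ i) := by
  rw [Polynomial.aeval_def, Polynomial.hom_eval₂, eval_X, algebraMap_eq]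
  have : (eval ξ).comp C = RingHom.id ℂ := RingHom.ext fun r => by simp
  rw [this, Polynomial.eval₂_id]

namespace IsHomogeneousHolomorphic

variable {m : ℕ} {D : Vec3 → ℂ}

theorem exists_bound (hD : IsHomogeneousHolomorphic m D) :
    ∃ C : ℝ, 0 ≤ C ∧ ∀ ξ : Vec3, ξ ≠ 0 → ‖D ξ‖ ≤ C * ‖ξ‖ ^ m := by
  obtain ⟨C, hC⟩ := (isCompact_sphere (0 : Vec3) 1).exists_bound_of_continuousOn (f := D)
    fun ξ hξ => (hD.differentiableAt ξ (by
      rintro rfl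
      simp at hξ)).continuousAt.continuousWithinAt
  refine ⟨|C|, abs_nonneg C, fun ξ hξ => ?_⟩
  have hn : (‖ξ‖ : ℂ) ≠ 0 := by simpa using hξ
  have h1 := hD.smul (‖ξ‖ : ℂ)⁻¹ ξ (inv_ne_zero hn) hξ
  have h2 := hC ((‖ξ‖ : ℂ)⁻¹ • ξ) (by
    simp [norm_smul, hξ])
  rw [h1, norm_mul, norm_pow, norm_inv, Complex.norm_real, norm_norm, inv_pow] at h2
  have h3 : 0 < ‖ξ‖ ^ m := pow_pos (norm_pos_iff.2 hξ) m
  rw [inv_mul_le_iff₀ h3] at h2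
  calc ‖D ξ‖ ≤ ‖ξ‖ ^ m * C := h2
    _ ≤ |C| * ‖ξ‖ ^ m := by
      rw [mul_comm]
      gcongr
      exact le_abs_self C

theorem eq_sum_on_line (hD : IsHomogeneousHolomorphic m D) {u v : Vec3}
    (h : ∀ t : ℂ, u + t • v ≠ 0) (t : ℂ) :
    D (u + t • v) =
      ∑ i ∈ Finset.range (m + 1), D (u + node i • v) * (lagrangeBasis m i).eval t := by
  obtain ⟨C, hC0, hC⟩ := hD.exists_bound
  obtain ⟨p, hp, hpD⟩ := exists_polynomial_of_growth m (f := fun t : ℂ => D (u + t • v))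
    (fun t => (hD.differentiableAt _ (h t)).comp t (by fun_prop))
    (C := C * (‖u‖ + ‖v‖) ^ m) (fun t => by
      refine (hC _ (h t)).trans ?_
      rw [mul_assoc, ← mul_pow]
      gcongr
      calc ‖u + t • v‖ ≤ ‖u‖ + ‖t‖ * ‖v‖ := (norm_add_le _ _).trans (by rw [norm_smul])
        _ ≤ (‖u‖ + ‖v‖) * (1 + ‖t‖) := by
          nlinarith [norm_nonneg u, norm_nonneg v, norm_nonneg t,
            mul_nonneg (norm_nonneg u) (norm_nonneg t)])
  have := eval_eq_sum_lagrangeBasis hp t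
  simp only [← hpD] at this
  exact this

theorem eq_sum_of_ne_zero (hD : IsHomogeneousHolomorphic m D) {ξ : Vec3}
    (hξ : ξ 0 ≠ 0 ∨ ξ 1 ≠ 0) :
    D ξ = ∑ i ∈ Finset.range (m + 1), ∑ j ∈ Finset.range (m + 1), ∑ k ∈ Finset.range (m + 1),
      D ![node i, node j, node k] * ((lagrangeBasis m i).eval (ξ 0) *
        (lagrangeBasis m j).eval (ξ 1) * (lagrangeBasis m k).eval (ξ 2)) := by
  have e2 : ∀ a b c : ℂ, ![a, b, 0] + c • ![0, 0, 1] = ![a, b, c] := fun a b c => by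
    ext i; fin_cases i <;> simp
  have e1 : ∀ a b c : ℂ, ![a, 0, c] + b • ![0, 1, 0] = ![a, b, c] := fun a b c => by
    ext i; fin_cases i <;> simp
  have e0 : ∀ a b c : ℂ, ![0, b, c] + a • ![1, 0, 0] = ![a, b, c] := fun a b c => by
    ext i; fin_cases i <;> simp
  have h2 : ∀ a b c : ℂ, a ≠ 0 ∨ b ≠ 0 → D ![a, b, c] =
      ∑ k ∈ Finset.range (m + 1), D ![a, b, node k] * (lagrangeBasis m k).eval c := by
    intro a b c hab
    have := hD.eq_sum_on_line (u := ![a, b, 0]) (v := ![0, 0, 1]) (fun t ht => by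
      rw [e2] at ht
      have ha := congrFun ht 0
      have hb := congrFun ht 1
      simp at ha hb
      tauto) c
    simpa only [e2] using this
  have h1 : ∀ a b c : ℂ, c ≠ 0 → D ![a, b, c] =
      ∑ j ∈ Finset.range (m + 1), D ![a, node j, c] * (lagrangeBasis m j).eval b := by
    intro a b c hc
    have := hD.eq_sum_on_line (u := ![a, 0, c]) (v := ![0, 1, 0]) (fun t ht => by
      rw [e1] at ht
      exact hc (by simpa using congrFun ht 2)) b
    simpa only [e1] using this
  have h0 : ∀ a b c : ℂ, c ≠ 0 → D ![a, b, c] =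
      ∑ i ∈ Finset.range (m + 1), D ![node i, b, c] * (lagrangeBasis m i).eval a := by
    intro a b c hc
    have := hD.eq_sum_on_line (u := ![0, b, c]) (v := ![1, 0, 0]) (fun t ht => by
      rw [e0] at ht
      exact hc (by simpa using congrFun ht 2)) a
    simpa only [e0] using this
  have hvec : ξ = ![ξ 0, ξ 1, ξ 2] := by ext i; fin_cases i <;> rfl
  conv_lhs => rw [hvec, h2 _ _ _ hξ]
  have h3 : ∀ k, D ![ξ 0, ξ 1, node k] = ∑ i ∈ Finset.range (m + 1), ∑ j ∈ Finset.range (m + 1),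
      D ![node i, node j, node k] * ((lagrangeBasis m i).eval (ξ 0) *
        (lagrangeBasis m j).eval (ξ 1)) := by
    intro k
    rw [h0 _ _ _ (node_ne_zero k)]
    refine Finset.sum_congr rfl fun i _ => ?_
    rw [h1 _ _ _ (node_ne_zero k), Finset.sum_mul]
    refine Finset.sum_congr rfl fun j _ => by ring
  simp_rw [h3, Finset.sum_mul]
  rw [Finset.sum_comm]
  refine Finset.sum_congr rfl fun i _ => ?_
  rw [Finset.sum_comm]
  refine Finset.sum_congr rfl fun j _ => Finset.sum_congr rfl fun k _ => by ring

/-- A homogeneous holomorphic function on `ℂ³ ∖ {0}` coincides with its interpolation polynomial. -/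
theorem eval_homogInterp (hD : IsHomogeneousHolomorphic m D) {ξ : Vec3} (hξ : ξ ≠ 0) :
    eval ξ (homogInterp m D) = D ξ := by
  set P : MvPolynomial (Fin 3) ℂ := (∑ i ∈ Finset.range (m + 1), ∑ j ∈ Finset.range (m + 1),
    ∑ k ∈ Finset.range (m + 1), (LinearMap.proj (R := ℂ) (φ := fun _ : Vec3 => ℂ)
      ![node i, node j, node k]).smulRight
      (Polynomial.aeval (X 0 : MvPolynomial (Fin 3) ℂ) (lagrangeBasis m i) *
        Polynomial.aeval (X 1 : MvPolynomial (Fin 3) ℂ) (lagrangeBasis m j) *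
        Polynomial.aeval (X 2 : MvPolynomial (Fin 3) ℂ) (lagrangeBasis m k))) D with hP
  have hPD : ∀ η : Vec3, η 0 ≠ 0 ∨ η 1 ≠ 0 → eval η P = D η := by
    intro η hη
    rw [hD.eq_sum_of_ne_zero hη, hP]
    simp [LinearMap.sum_apply, eval_aeval_X]
  have hPD' : ∀ η : Vec3, η ≠ 0 → eval η P = D η := by
    intro η hη
    by_cases h : η 0 ≠ 0 ∨ η 1 ≠ 0
    · exact hPD η h
    -- at the remaining points both sides are continuous
    push Not at h
    have hcurve : Filter.Tendsto (fun t : ℂ => η + t • (![1, 0, 0] : Vec3)) (𝓝[≠] 0) (𝓝 η) := by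
      have : Continuous fun t : ℂ => η + t • (![1, 0, 0] : Vec3) := by fun_prop
      have h0 := this.tendsto 0
      rw [zero_smul, add_zero] at h0
      exact h0.mono_left nhdsWithin_le_nhds
    have h1 : Filter.Tendsto (fun t : ℂ => eval (η + t • (![1, 0, 0] : Vec3)) P) (𝓝[≠] 0)
        (𝓝 (eval η P)) := ((MvPolynomial.continuous_eval P).tendsto η).comp hcurve
    have h2 : Filter.Tendsto (fun t : ℂ => D (η + t • (![1, 0, 0] : Vec3))) (𝓝[≠] 0)
        (𝓝 (D η)) := ((hD.differentiableAt η hη).continuousAt.tendsto).comp hcurve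
    refine tendsto_nhds_unique (h1.congr' ?_) h2
    filter_upwards [self_mem_nhdsWithin] with t ht
    refine hPD _ (Or.inl ?_)
    simpa [h.1] using ht
  change eval ξ (homogeneousComponent m P) = D ξ
  have key : (∑ k ∈ Finset.range (P.totalDegree + 1),
      Polynomial.C (eval ξ (homogeneousComponent k P)) * Polynomial.X ^ k) =
        Polynomial.C (D ξ) * Polynomial.X ^ m := by
    refine Polynomial.eq_of_infinite_eval_eq _ _
      ((Set.finite_singleton (0 : ℂ)).infinite_compl.mono fun t ht => ?_)
    have ht : t ≠ 0 := ht
    have h1 := hPD' (t • ξ) (smul_ne_zero ht hξ)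
    rw [hD.smul t ξ ht hξ, ← sum_homogeneousComponent P, map_sum] at h1
    simp only [Set.mem_ofPred_eq, Polynomial.eval_finsetSum, Polynomial.eval_mul, Polynomial.eval_C,
      Polynomial.eval_pow, Polynomial.eval_X]
    rw [mul_comm (D ξ), ← h1]
    refine Finset.sum_congr rfl fun k _ => ?_
    rw [mul_comm]
    exact (eval_smul_of_isHomogeneous (homogeneousComponent_isHomogeneous k P) t ξ).symm
  have := congrArg (fun q => Polynomial.coeff q m) key
  simp only [Polynomial.finsetSum_coeff, Polynomial.coeff_C_mul, Polynomial.coeff_X_pow, mul_ite,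
    mul_one, mul_zero, Finset.sum_ite_eq, Finset.mem_range, if_true] at this
  rw [← this]
  split_ifs with h
  · rfl
  · rw [homogeneousComponent_eq_zero _ _ (by omega), map_zero]

end IsHomogeneousHolomorphic

/-- Polynomials in three variables are determined by their values outside the origin. -/
theorem eq_of_eval_eq {P Q : MvPolynomial (Fin 3) ℂ}
    (h : ∀ ξ : Vec3, ξ ≠ 0 → eval ξ P = eval ξ Q) : P = Q := by
  have h0 : X 0 * (P - Q) = 0 := MvPolynomial.funext fun ξ => by
    by_cases hξ : ξ = 0
    · simp [hξ]
    · simp [h ξ hξ]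
  exact sub_eq_zero.1 ((mul_eq_zero.1 h0).resolve_left (X_ne_zero 0))

/-! ### Bihomogeneous holomorphic functions on the cone over the incidence variety -/

/-- A function which is holomorphic on the cone over the incidence variety and homogeneous of degree
`p` in `x` and `q` in `ξ` there. Its values outside the cone play no role, except that it has to
vanish for `x = 0`. -/
structure IsBihomogeneous (p q : ℕ) (f : Vec3 → Vec3 → ℂ) : Prop where
  zero : ∀ ξ, f 0 ξ = 0
  smul : ∀ (s t : ℂ) (x ξ : Vec3), s ≠ 0 → t ≠ 0 → x ≠ 0 → ξ ≠ 0 → x ⬝ᵥ ξ = 0 →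
    f (s • x) (t • ξ) = s ^ p * t ^ q * f x ξ
  holo : ∀ x ξ : Vec3, x ≠ 0 → ξ ≠ 0 → x ⬝ᵥ ξ = 0 →
    ∃ (N : Set (Vec3 × Vec3)) (g : Vec3 × Vec3 → ℂ), IsOpen N ∧ (x, ξ) ∈ N ∧
      DifferentiableOn ℂ g N ∧
        ∀ y η : Vec3, y ≠ 0 → η ≠ 0 → y ⬝ᵥ η = 0 → (y, η) ∈ N → f y η = g (y, η)

theorem exists_cross_ne_zero {ξ : Vec3} (hξ : ξ ≠ 0) : ∃ η : Vec3, η ⨯₃ ξ ≠ 0 := by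
  by_contra! h
  apply hξ
  have h0 := h ![1, 0, 0]
  have h1 := h ![0, 1, 0]
  rw [cross_apply] at h0 h1
  have a := congrFun h0 1
  have b := congrFun h0 2
  have c := congrFun h1 2
  simp at a b c
  ext i
  fin_cases i
  · exact c
  · exact b
  · exact a

theorem cross_dot_right (η ξ : Vec3) : (η ⨯₃ ξ) ⬝ᵥ ξ = 0 := by
  rw [dotProduct_comm, dot_cross_self]

theorem exists_dot_eq_one {ξ : Vec3} (hξ : ξ ≠ 0) : ∃ u : Vec3, u ⬝ᵥ ξ = 1 := by
  obtain ⟨i, hi⟩ := Function.ne_iff.1 hξ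
  exact ⟨Pi.single i (ξ i)⁻¹, by rw [single_dotProduct, inv_mul_cancel₀ hi]⟩

theorem exists_cross_eq {x ξ : Vec3} (hξ : ξ ≠ 0) (h : x ⬝ᵥ ξ = 0) : ∃ η : Vec3, η ⨯₃ ξ = x := by
  obtain ⟨u, hu⟩ := exists_dot_eq_one hξ
  refine ⟨u ⨯₃ x, ?_⟩
  rw [cross_cross_eq_smul_sub_smul, hu, h]
  simp

theorem differentiable_cross {E : Type*} [NormedAddCommGroup E] [NormedSpace ℂ E] {f g : E → Vec3}
    (hf : Differentiable ℂ f) (hg : Differentiable ℂ g) :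
    Differentiable ℂ fun e => f e ⨯₃ g e := by
  have hf' : ∀ i, Differentiable ℂ fun e => f e i := differentiable_pi.1 hf
  have hg' : ∀ i, Differentiable ℂ fun e => g e i := differentiable_pi.1 hg
  rw [differentiable_pi]
  intro i
  simp only [cross_apply]
  fin_cases i
  · exact ((hf' 1).mul (hg' 2)).sub ((hf' 2).mul (hg' 1))
  · exact ((hf' 2).mul (hg' 0)).sub ((hf' 0).mul (hg' 2))
  · exact ((hf' 0).mul (hg' 1)).sub ((hf' 1).mul (hg' 0))

namespace IsBihomogeneous

variable {p q : ℕ} {f : Vec3 → Vec3 → ℂ}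

theorem differentiableAt_comp (hf : IsBihomogeneous p q f) {E : Type*} [NormedAddCommGroup E]
    [NormedSpace ℂ E] {x ξ : E → Vec3} (hx : Differentiable ℂ x) (hξ : Differentiable ℂ ξ)
    (h : ∀ e, x e ⬝ᵥ ξ e = 0) {e₀ : E} (hx₀ : x e₀ ≠ 0) (hξ₀ : ξ e₀ ≠ 0) :
    DifferentiableAt ℂ (fun e => f (x e) (ξ e)) e₀ := by
  obtain ⟨N, g, hN, hmem, hg, hfg⟩ := hf.holo _ _ hx₀ hξ₀ (h e₀)
  have hγ : Differentiable ℂ fun e => (x e, ξ e) := hx.prodMk hξ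
  have h1 : DifferentiableAt ℂ (fun e => g (x e, ξ e)) e₀ :=
    (hg.differentiableAt (hN.mem_nhds hmem)).comp e₀ (hγ e₀)
  refine h1.congr_of_eventuallyEq ?_
  filter_upwards [hx.continuous.continuousAt.eventually_ne hx₀,
    hξ.continuous.continuousAt.eventually_ne hξ₀,
    hγ.continuous.continuousAt.preimage_mem_nhds (hN.mem_nhds hmem)] with e h1 h2 h3
  exact hfg _ _ h1 h2 (h e) h3

theorem exists_bound (hf : IsBihomogeneous p q f) {ξ : Vec3} (hξ : ξ ≠ 0) :
    ∃ C : ℝ, 0 ≤ C ∧ ∀ x : Vec3, x ≠ 0 → x ⬝ᵥ ξ = 0 → ‖f x ξ‖ ≤ C * ‖x‖ ^ p := by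
  have hclosed : IsClosed {x : Vec3 | x ⬝ᵥ ξ = 0} :=
    isClosed_eq (by fun_prop) continuous_const
  obtain ⟨C, hC⟩ :=
    ((isCompact_sphere (0 : Vec3) 1).inter_right hclosed).exists_bound_of_continuousOn
    (f := fun x => f x ξ) (fun x hx => by
      have hx0 : x ≠ 0 := by
        rintro rfl
        simpa using hx.1
      obtain ⟨N, g, hN, hmem, hg, hfg⟩ := hf.holo x ξ hx0 hξ hx.2
      have hγ : Continuous fun y : Vec3 => (y, ξ) := by fun_prop
      have h1 : ContinuousAt (fun y : Vec3 => g (y, ξ)) x :=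
        ContinuousAt.comp (f := fun y : Vec3 => (y, ξ))
          (hg.differentiableAt (hN.mem_nhds hmem)).continuousAt hγ.continuousAt
      refine h1.continuousWithinAt.congr_of_eventuallyEq ?_ (hfg _ _ hx0 hξ hx.2 hmem)
      filter_upwards [self_mem_nhdsWithin, nhdsWithin_le_nhds (hγ.continuousAt.preimage_mem_nhds
        (hN.mem_nhds hmem))] with y hy hyN
      refine hfg y ξ ?_ hξ hy.2 hyN
      rintro rfl
      simpa using hy.1)
  refine ⟨|C|, abs_nonneg C, fun x hx hxξ => ?_⟩
  have hn : (‖x‖ : ℂ) ≠ 0 := by simpa using hx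
  have h1 := hf.smul (‖x‖ : ℂ)⁻¹ 1 x ξ (inv_ne_zero hn) one_ne_zero hx hξ hxξ
  have h2 := hC ((‖x‖ : ℂ)⁻¹ • x) ⟨by simp [norm_smul, hx], by
    change ((‖x‖ : ℂ)⁻¹ • x) ⬝ᵥ ξ = 0
    rw [smul_dotProduct, hxξ, smul_zero]⟩
  rw [one_smul, one_pow, mul_one] at h1
  rw [h1, norm_mul, norm_pow, norm_inv, Complex.norm_real, norm_norm, inv_pow] at h2
  have h3 : 0 < ‖x‖ ^ p := pow_pos (norm_pos_iff.2 hx) p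
  rw [inv_mul_le_iff₀ h3] at h2
  calc ‖f x ξ‖ ≤ ‖x‖ ^ p * C := h2
    _ ≤ |C| * ‖x‖ ^ p := by
      rw [mul_comm]
      gcongr
      exact le_abs_self C

/-- On each line of `ℙ²`, a function homogeneous of degree `p` is a polynomial of degree `p`. -/
theorem exists_polynomial_on_line (hf : IsBihomogeneous p q f) {x x' ξ : Vec3} (hξ : ξ ≠ 0)
    (hx : x ⬝ᵥ ξ = 0) (hx' : x' ⬝ᵥ ξ = 0) (h : ∀ t : ℂ, x + t • x' ≠ 0) :
    ∃ P : Polynomial ℂ, P.natDegree ≤ p ∧ ∀ t, f (x + t • x') ξ = P.eval t := by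
  obtain ⟨C, hC0, hC⟩ := hf.exists_bound hξ
  have hperp : ∀ t : ℂ, (x + t • x') ⬝ᵥ ξ = 0 := fun t => by
    rw [add_dotProduct, smul_dotProduct, hx, hx', smul_zero, add_zero]
  refine exists_polynomial_of_growth p (f := fun t : ℂ => f (x + t • x') ξ) (fun t =>
    hf.differentiableAt_comp (x := fun t : ℂ => x + t • x') (ξ := fun _ => ξ) (by fun_prop)
      (by fun_prop) hperp (h t) hξ) (C := C * (‖x‖ + ‖x'‖) ^ p) (fun t => ?_)
  refine (hC _ (h t) (hperp t)).trans ?_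
  rw [mul_assoc, ← mul_pow]
  gcongr
  calc ‖x + t • x'‖ ≤ ‖x‖ + ‖t‖ * ‖x'‖ := (norm_add_le _ _).trans (by rw [norm_smul])
    _ ≤ (‖x‖ + ‖x'‖) * (1 + ‖t‖) := by
      nlinarith [norm_nonneg x, norm_nonneg x', norm_nonneg t,
        mul_nonneg (norm_nonneg x) (norm_nonneg t)]

theorem _root_.SecondOrderODE.add_smul_ne_zero {x x' : Vec3} (hx : x ≠ 0)
    (h : ∀ s : ℂ, x' ≠ s • x) (t : ℂ) : x + t • x' ≠ 0 ∧ x' + t • x ≠ 0 := by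
  constructor
  · intro h0
    rcases eq_or_ne t 0 with rfl | ht
    · exact hx (by simpa using h0)
    · refine h (-t⁻¹) ?_
      rw [eq_neg_of_add_eq_zero_left h0, smul_neg, neg_smul, neg_neg, inv_smul_smul₀ ht]
  · intro h0
    exact h (-t) (by rw [neg_smul]; exact eq_neg_of_add_eq_zero_left h0)

/-- A function homogeneous of degree `0` in `x` depends on `ξ` only. -/
theorem eq_of_degree_zero (hf : IsBihomogeneous 0 q f) {x x' ξ : Vec3} (hξ : ξ ≠ 0) (hx0 : x ≠ 0)
    (hx'0 : x' ≠ 0) (hx : x ⬝ᵥ ξ = 0) (hx' : x' ⬝ᵥ ξ = 0) : f x ξ = f x' ξ := by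
  by_cases h : ∃ s : ℂ, x' = s • x
  · obtain ⟨s, rfl⟩ := h
    have hs : s ≠ 0 := by
      rintro rfl
      simp at hx'0
    have := hf.smul s 1 x ξ hs one_ne_zero hx0 hξ hx
    rw [one_smul, pow_zero, one_pow, one_mul, one_mul] at this
    exact this.symm
  · push Not at h
    obtain ⟨P, hP, hPf⟩ := hf.exists_polynomial_on_line hξ hx hx' fun t =>
      (add_smul_ne_zero hx0 h t).1
    obtain ⟨Q, hQ, hQf⟩ := hf.exists_polynomial_on_line hξ hx' hx fun t =>
      (add_smul_ne_zero hx0 h t).2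
    rw [Polynomial.eq_C_of_natDegree_le_zero hP] at hPf
    rw [Polynomial.eq_C_of_natDegree_le_zero hQ] at hQf
    simp only [Polynomial.eval_C] at hPf hQf
    have e1 := hPf 0
    have e2 := hPf 1
    have e3 := hQf 0
    have e4 := hQf 1
    rw [zero_smul, add_zero] at e1 e3
    rw [one_smul] at e2 e4
    rw [add_comm] at e4
    rw [e1, ← e2, e4, e3]

theorem smul_left (hf : IsBihomogeneous 1 q f) (s : ℂ) {x ξ : Vec3} (hξ : ξ ≠ 0)
    (hx : x ⬝ᵥ ξ = 0) : f (s • x) ξ = s * f x ξ := by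
  rcases eq_or_ne x 0 with rfl | hx0
  · rw [smul_zero, hf.zero, mul_zero]
  rcases eq_or_ne s 0 with rfl | hs
  · rw [zero_smul, hf.zero, zero_mul]
  have := hf.smul s 1 x ξ hs one_ne_zero hx0 hξ hx
  rwa [one_smul, pow_one, one_pow, mul_one] at this

/-- A function homogeneous of degree `1` in `x` is linear in `x`. -/
theorem add_left (hf : IsBihomogeneous 1 q f) {x x' ξ : Vec3} (hξ : ξ ≠ 0)
    (hx : x ⬝ᵥ ξ = 0) (hx' : x' ⬝ᵥ ξ = 0) : f (x + x') ξ = f x ξ + f x' ξ := by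
  rcases eq_or_ne x 0 with rfl | hx0
  · rw [zero_add, hf.zero, zero_add]
  by_cases h : ∃ s : ℂ, x' = s • x
  · obtain ⟨s, rfl⟩ := h
    have : x + s • x = (1 + s) • x := by rw [add_smul, one_smul]
    rw [this, hf.smul_left _ hξ hx, hf.smul_left _ hξ hx]
    ring
  · push Not at h
    obtain ⟨P, hP, hPf⟩ := hf.exists_polynomial_on_line hξ hx hx' fun t =>
      (add_smul_ne_zero hx0 h t).1
    obtain ⟨Q, hQ, hQf⟩ := hf.exists_polynomial_on_line hξ hx' hx fun t =>
      (add_smul_ne_zero hx0 h t).2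
    rw [Polynomial.eq_X_add_C_of_natDegree_le_one hP] at hPf
    rw [Polynomial.eq_X_add_C_of_natDegree_le_one hQ] at hQf
    simp only [Polynomial.eval_C, Polynomial.eval_add, Polynomial.eval_mul,
      Polynomial.eval_X] at hPf hQf
    have e0 := hPf 0
    have e1 := hPf 1
    have e2 := hPf 2
    have e3 := hQf 0
    have e4 := hQf 1
    have e5 := hQf 2⁻¹
    -- the values on the two affine lines are related by homogeneity
    have e6 : f (x + (2 : ℂ) • x') ξ = 2 * f (x' + (2⁻¹ : ℂ) • x) ξ := by
      rw [← hf.smul_left 2 hξ (by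
        rw [add_dotProduct, smul_dotProduct, hx, hx', smul_zero, add_zero])]
      rw [smul_add, smul_smul, mul_inv_cancel₀ two_ne_zero, one_smul, add_comm]
    rw [zero_smul, add_zero] at e0 e3
    rw [one_smul] at e1 e4
    rw [add_comm x' x] at e4
    rw [e2, e5] at e6
    rw [e1] at e4
    rw [e1, e0, e3]
    linear_combination e6 - e4

/-- The function `ξ ↦ f (η × ξ, ξ)` is holomorphic also where `η × ξ` vanishes, because it is there
the difference of two such functions for which the vector product does not vanish. -/
theorem isHomogeneousHolomorphic_cross (hf : IsBihomogeneous 1 q f) (η : Vec3) :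
    IsHomogeneousHolomorphic (q + 1) fun ξ => f (η ⨯₃ ξ) ξ := by
  refine ⟨fun t ξ ht hξ => ?_, fun ξ hξ => ?_⟩
  · rw [map_smul]
    by_cases h : η ⨯₃ ξ = 0
    · rw [h, smul_zero, hf.zero, hf.zero, mul_zero]
    · rw [hf.smul t t _ _ ht ht h hξ (cross_dot_right η ξ)]
      ring
  · have hne : ∀ η : Vec3, η ⨯₃ ξ ≠ 0 → DifferentiableAt ℂ (fun ξ => f (η ⨯₃ ξ) ξ) ξ := fun η h =>
      hf.differentiableAt_comp (x := fun ξ => η ⨯₃ ξ) (ξ := fun ξ => ξ)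
        (differentiable_cross (by fun_prop) (by fun_prop)) (by fun_prop)
        (fun ξ => cross_dot_right η ξ) h hξ
    by_cases h : η ⨯₃ ξ = 0
    · obtain ⟨η', hη'⟩ := exists_cross_ne_zero hξ
      have hsum : (η + η') ⨯₃ ξ ≠ 0 := by
        rw [map_add, LinearMap.add_apply, h, zero_add]
        exact hη'
      refine ((hne _ hsum).sub (hne _ hη')).congr_of_eventuallyEq ?_
      filter_upwards [isOpen_ne.mem_nhds hξ] with ζ hζ
      rw [Pi.sub_apply, map_add, LinearMap.add_apply,
        hf.add_left hζ (cross_dot_right η ζ) (cross_dot_right η' ζ)]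
      ring
    · exact hne η h

/-- A function of bidegree `(0, q)` on the cone is given by a homogeneous polynomial in `ξ`. -/
theorem exists_polynomial_of_degree_zero (hf : IsBihomogeneous 0 q f) :
    ∃ P : MvPolynomial (Fin 3) ℂ, P.IsHomogeneous q ∧
      ∀ x ξ : Vec3, x ≠ 0 → ξ ≠ 0 → x ⬝ᵥ ξ = 0 → f x ξ = eval ξ P := by
  have hex : ∀ ξ : Vec3, ∃ η : Vec3, ξ ≠ 0 → η ⨯₃ ξ ≠ 0 := fun ξ => by
    by_cases h : ξ = 0
    · exact ⟨0, fun h' => absurd h h'⟩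
    · obtain ⟨η, hη⟩ := exists_cross_ne_zero h
      exact ⟨η, fun _ => hη⟩
  choose η hη using hex
  have hD : IsHomogeneousHolomorphic q fun ξ => f (η ξ ⨯₃ ξ) ξ := by
    refine ⟨fun t ξ ht hξ => ?_, fun ξ hξ => ?_⟩
    · have htξ : t • ξ ≠ 0 := smul_ne_zero ht hξ
      have h1 := hf.smul 1 t _ ξ one_ne_zero ht (hη ξ hξ) hξ (cross_dot_right _ _)
      rw [one_smul, pow_zero, one_mul] at h1
      rw [← h1]
      refine hf.eq_of_degree_zero htξ (hη _ htξ) (hη ξ hξ) (cross_dot_right _ _) ?_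
      rw [dotProduct_smul, cross_dot_right, smul_zero]
    · have h1 := hf.differentiableAt_comp (x := fun ζ => η ξ ⨯₃ ζ) (ξ := fun ζ => ζ)
        (differentiable_cross (by fun_prop) (by fun_prop)) (by fun_prop)
        (fun ζ => cross_dot_right (η ξ) ζ) (hη ξ hξ) hξ
      refine h1.congr_of_eventuallyEq ?_
      have hcont : Continuous fun ζ => η ξ ⨯₃ ζ :=
        (differentiable_cross (f := fun _ : Vec3 => η ξ) (by fun_prop) (by fun_prop)).continuous
      filter_upwards [isOpen_ne.mem_nhds hξ, hcont.continuousAt.eventually_ne (hη ξ hξ)]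
        with ζ hζ hζ'
      exact hf.eq_of_degree_zero hζ (hη ζ hζ) hζ' (cross_dot_right _ _) (cross_dot_right _ _)
  refine ⟨homogInterp q fun ξ => f (η ξ ⨯₃ ξ) ξ, homogInterp_isHomogeneous _ _,
    fun x ξ hx hξ hxξ => ?_⟩
  rw [hD.eval_homogInterp hξ]
  exact hf.eq_of_degree_zero hξ hx (hη ξ hξ) hxξ (cross_dot_right _ _)

end IsBihomogeneous

theorem sum_fin_three_cyclic {M : Type*} [AddCommMonoid M] (F : Fin 3 → M) (i : Fin 3) :
    ∑ k, F k = F i + F (i + 1) + F (i + 2) := by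
  rw [Fin.sum_univ_three]
  fin_cases i
  · rfl
  · exact (add_assoc _ _ _).trans (add_comm _ _)
  · exact add_rotate _ _ _ |>.trans (add_rotate _ _ _)

theorem single_cross (k : Fin 3) (ξ : Vec3) :
    (Pi.single k 1 ⨯₃ ξ) k = 0 ∧ (Pi.single k 1 ⨯₃ ξ) (k + 1) = -ξ (k + 2) ∧
      (Pi.single k 1 ⨯₃ ξ) (k + 2) = ξ (k + 1) := by
  rw [cross_apply]
  fin_cases k <;> simp

theorem fin_three_add (i : Fin 3) : i + 1 + 1 = i + 2 ∧ i + 1 + 2 = i ∧ i + 2 + 1 = i ∧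
    i + 2 + 2 = i + 1 := by
  revert i
  decide

theorem fin_three_ne (i : Fin 3) : i ≠ i + 1 ∧ i ≠ i + 2 ∧ i + 1 ≠ i + 2 := by
  revert i
  decide

theorem C_inv_mul_cast_add_two {σ : Type*} (q : ℕ) :
    C ((q : ℂ) + 2)⁻¹ * ((q : MvPolynomial σ ℂ) + 2) = 1 := by
  have hq : ((q : ℂ) + 2) ≠ 0 := by
    have : ((q + 2 : ℕ) : ℂ) ≠ 0 := Nat.cast_ne_zero.2 (by omega)
    simpa using this
  have : ((q : MvPolynomial σ ℂ) + 2) = C ((q : ℂ) + 2) := by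
    rw [C_add, map_natCast, map_ofNat]
  rw [this, ← C_mul, inv_mul_cancel₀ hq, C_1]

/-- The polynomial `E k` with values `f (e k × ξ, ξ)`, where `e` is the standard basis. -/
noncomputable def crossInterp (q : ℕ) (k : Fin 3) :
    (Vec3 → Vec3 → ℂ) →ₗ[ℂ] MvPolynomial (Fin 3) ℂ :=
  homogInterp (q + 1) ∘ₗ LinearMap.pi fun ξ =>
    (LinearMap.proj ξ : (Vec3 → ℂ) →ₗ[ℂ] ℂ) ∘ₗ
      (LinearMap.proj (Pi.single k 1 ⨯₃ ξ) : (Vec3 → Vec3 → ℂ) →ₗ[ℂ] Vec3 → ℂ)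

/-- The polynomial vector field `A = - curl E / (q + 2)`, which represents a function `f` of
bidegree `(1, q)` on the cone as `f x ξ = A ξ ⬝ x`. -/
noncomputable def potential (q : ℕ) (i : Fin 3) :
    (Vec3 → Vec3 → ℂ) →ₗ[ℂ] MvPolynomial (Fin 3) ℂ :=
  (-((q : ℂ) + 2)⁻¹) •
    ((pderiv (i + 1)).toLinearMap ∘ₗ crossInterp q (i + 2) -
      (pderiv (i + 2)).toLinearMap ∘ₗ crossInterp q (i + 1))

theorem potential_apply (q : ℕ) (i : Fin 3) (f : Vec3 → Vec3 → ℂ) :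
    potential q i f = (-((q : ℂ) + 2)⁻¹) •
      (pderiv (i + 1) (crossInterp q (i + 2) f) - pderiv (i + 2) (crossInterp q (i + 1) f)) := rfl

theorem crossInterp_isHomogeneous (q : ℕ) (k : Fin 3) (f : Vec3 → Vec3 → ℂ) :
    (crossInterp q k f).IsHomogeneous (q + 1) :=
  homogInterp_isHomogeneous _ _

theorem potential_isHomogeneous (q : ℕ) (i : Fin 3) (f : Vec3 → Vec3 → ℂ) :
    (potential q i f).IsHomogeneous q := by
  have h : ∀ j k, (pderiv j (crossInterp q k f)).IsHomogeneous q := fun j k =>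
    (crossInterp_isHomogeneous q k f).pderiv
  rw [potential_apply, smul_eq_C_mul]
  have := (isHomogeneous_C (Fin 3) (-((q : ℂ) + 2)⁻¹)).mul
    ((h (i + 1) (i + 2)).sub (h (i + 2) (i + 1)))
  rwa [zero_add] at this

namespace IsBihomogeneous

variable {q : ℕ} {f : Vec3 → Vec3 → ℂ}

theorem eval_crossInterp (hf : IsBihomogeneous 1 q f) (k : Fin 3) {ξ : Vec3} (hξ : ξ ≠ 0) :
    eval ξ (crossInterp q k f) = f (Pi.single k 1 ⨯₃ ξ) ξ :=
  (hf.isHomogeneousHolomorphic_cross (Pi.single k 1)).eval_homogInterp hξ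

theorem apply_cross (hf : IsBihomogeneous 1 q f) (η : Vec3) {ξ : Vec3} (hξ : ξ ≠ 0) :
    f (η ⨯₃ ξ) ξ = ∑ k, η k * eval ξ (crossInterp q k f) := by
  have hη : η ⨯₃ ξ = η 0 • (Pi.single 0 1 ⨯₃ ξ) + η 1 • (Pi.single 1 1 ⨯₃ ξ) +
      η 2 • (Pi.single 2 1 ⨯₃ ξ) := by
    have : η = η 0 • Pi.single 0 1 + η 1 • Pi.single 1 1 + η 2 • (Pi.single 2 1 : Vec3) := by
      ext i; fin_cases i <;> simp
    conv_lhs => rw [this]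
    simp only [map_add, map_smul, LinearMap.add_apply, LinearMap.smul_apply]
  have hp : ∀ (k : Fin 3) (c : ℂ), (c • (Pi.single k 1 ⨯₃ ξ)) ⬝ᵥ ξ = 0 := fun k c => by
    rw [smul_dotProduct, cross_dot_right, smul_zero]
  rw [hη, hf.add_left hξ (by rw [add_dotProduct, hp, hp, add_zero]) (hp _ _),
    hf.add_left hξ (hp _ _) (hp _ _), hf.smul_left _ hξ (cross_dot_right _ _),
    hf.smul_left _ hξ (cross_dot_right _ _), hf.smul_left _ hξ (cross_dot_right _ _),
    Fin.sum_univ_three, hf.eval_crossInterp 0 hξ, hf.eval_crossInterp 1 hξ,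
    hf.eval_crossInterp 2 hξ]

theorem sum_X_mul_crossInterp (hf : IsBihomogeneous 1 q f) :
    ∑ k, X k * crossInterp q k f = 0 :=
  eq_of_eval_eq fun ξ hξ => by
    have := hf.apply_cross ξ hξ
    rw [cross_self, hf.zero] at this
    simpa using this.symm

/-- The vector identity `ξ × curl E = ∇ (ξ ⬝ E) - E - (ξ ⬝ ∇) E`, together with `ξ ⬝ E = 0` and
Euler's identity, recovers `E` as `ξ × A`. -/
theorem crossInterp_eq (hf : IsBihomogeneous 1 q f) (i : Fin 3) :
    crossInterp q i f =
      X (i + 1) * potential q (i + 2) f - X (i + 2) * potential q (i + 1) f := by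
  obtain ⟨a1, a2, a3, a4⟩ := fin_three_add i
  obtain ⟨n1, n2, n3⟩ := fin_three_ne i
  have h0 : pderiv i (∑ k, X k * crossInterp q k f) = 0 := by
    rw [hf.sum_X_mul_crossInterp, map_zero]
  have h1 := (crossInterp_isHomogeneous q i f).sum_X_mul_pderiv
  have hC := C_inv_mul_cast_add_two (σ := Fin 3) q
  rw [sum_fin_three_cyclic _ i] at h0 h1
  simp only [map_add, Derivation.leibniz, smul_eq_mul, pderiv_X_self, pderiv_X_of_ne n1.symm,
    pderiv_X_of_ne n2.symm] at h0
  rw [nsmul_eq_mul, Nat.cast_add, Nat.cast_one] at h1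
  simp only [potential_apply, smul_eq_C_mul, C_neg, a1, a2, a3, a4]
  set c := (C ((q : ℂ) + 2)⁻¹ : MvPolynomial (Fin 3) ℂ)
  linear_combination c * h0 - c * h1 - crossInterp q i f * hC

/-- A function of bidegree `(1, q)` on the cone is given by a polynomial vector field. -/
theorem eq_sum_potential (hf : IsBihomogeneous 1 q f) {x ξ : Vec3} (hξ : ξ ≠ 0)
    (hx : x ⬝ᵥ ξ = 0) : f x ξ = ∑ i, eval ξ (potential q i f) * x i := by
  obtain ⟨η, rfl⟩ := exists_cross_eq hξ hx
  rw [hf.apply_cross η hξ]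
  have h : ∀ k, eval ξ (crossInterp q k f) = ξ (k + 1) * eval ξ (potential q (k + 2) f) -
      ξ (k + 2) * eval ξ (potential q (k + 1) f) := fun k => by
    rw [hf.crossInterp_eq k]
    simp
  simp only [Fin.sum_univ_three, cross_apply, h, Matrix.cons_val_zero, Matrix.cons_val_one,
    Matrix.cons_val, zero_add]
  obtain ⟨a1, a2, -, -⟩ := fin_three_add 0
  obtain ⟨-, -, a3, a4⟩ := fin_three_add 0
  rw [zero_add, zero_add] at a1 a4
  rw [zero_add] at a2 a3
  rw [a1, a2, a3, a4]
  ring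

theorem potential_cyclic (hf : IsBihomogeneous 1 q f)
    (h : ∀ x ξ : Vec3, x ≠ 0 → ξ ≠ 0 → x ⬝ᵥ ξ = 0 → f x ξ = ∑ i : Fin 3, ξ (i + 1) ^ q * x i)
    (i : Fin 3) : potential q i f = X (i + 1) ^ q := by
  have hE : ∀ k, crossInterp q k f = X (k + 1) * X k ^ q - X (k + 2) ^ (q + 1) := fun k =>
    eq_of_eval_eq fun ξ hξ => by
      rw [hf.eval_crossInterp k hξ]
      have hval : f (Pi.single k 1 ⨯₃ ξ) ξ =
          ∑ i : Fin 3, ξ (i + 1) ^ q * (Pi.single k 1 ⨯₃ ξ) i := by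
        by_cases h0 : Pi.single k 1 ⨯₃ ξ = 0
        · rw [h0, hf.zero]
          simp
        · exact h _ _ h0 hξ (cross_dot_right _ _)
      obtain ⟨b1, b2, b3⟩ := single_cross k ξ
      obtain ⟨a1, -, a3, -⟩ := fin_three_add k
      rw [hval, sum_fin_three_cyclic _ k, b1, b2, b3, a1, a3]
      simp only [map_sub, map_mul, map_pow, eval_X]
      ring
  obtain ⟨a1, a2, a3, a4⟩ := fin_three_add i
  obtain ⟨n1, n2, n3⟩ := fin_three_ne i
  have hC := C_inv_mul_cast_add_two (σ := Fin 3) q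
  rw [potential_apply, hE, hE, smul_eq_C_mul, C_neg, a1, a2, a3, a4]
  simp only [map_sub, Derivation.leibniz, Derivation.leibniz_pow, smul_eq_mul, nsmul_eq_mul,
    pderiv_X_self, pderiv_X_of_ne n1, pderiv_X_of_ne n2, pderiv_X_of_ne n3, pderiv_X_of_ne n3.symm,
    Nat.add_sub_cancel, Nat.cast_add, Nat.cast_one]
  linear_combination X (i + 1) ^ q * hC

end IsBihomogeneous

/-! ### The vertical components of a section -/

theorem cross_cross_star (x u : Vec3) (ξ : Vec3) (h : x ⬝ᵥ ξ = 0) :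
    ξ ⨯₃ (x ⨯₃ u) = (ξ ⬝ᵥ u) • x := by
  rw [cross_cross_eq_smul_sub_smul', h, zero_smul, sub_zero]

open scoped ComplexOrder in
theorem dotProduct_star_ne_zero {ξ : Vec3} (hξ : ξ ≠ 0) : ξ ⬝ᵥ star ξ ≠ 0 := fun h =>
  hξ (dotProduct_self_star_eq_zero.1 h)

/-- A vector whose product with `x` vanishes is a multiple of `x`. -/
theorem eq_smul_of_cross_eq_zero {x y : Vec3} (hx : x ≠ 0) (h : x ⨯₃ y = 0) :
    y = ((y ⬝ᵥ star x) / (x ⬝ᵥ star x)) • x := by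
  have hxx := dotProduct_star_ne_zero hx
  have h1 := cross_cross_eq_smul_sub_smul x y (star x)
  rw [h, map_zero, LinearMap.zero_apply] at h1
  rw [div_eq_inv_mul, mul_smul, ← sub_eq_zero.1 h1.symm, inv_smul_smul₀ hxx]

theorem eulerSpace_le_contactSpace (z : Cone) : eulerSpace z ≤ contactSpace z := by
  refine Submodule.span_le.2 ?_
  rintro p (rfl | rfl)
  · exact ⟨by simp [z.2.2.2], z.2.2.2⟩
  · exact ⟨by simp [z.2.2.2], by simp⟩

theorem mem_contactSpace_of_mk_mem {z : Cone} {p : Vec3 × Vec3}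
    (h : (Submodule.Quotient.mk p : TangentFibre z) ∈ contactFibre z) : p ∈ contactSpace z := by
  obtain ⟨p', hp', h'⟩ := h
  have h1 : p - p' ∈ eulerSpace z := (Submodule.Quotient.eq _).1 h'.symm
  have := add_mem (eulerSpace_le_contactSpace z h1) hp'
  rwa [sub_add_cancel] at this

/-- The linear map `(v, w) ↦ ξ × w` on the tangent space at the point with coordinates `(x, ξ)`; its
kernel consists of the vectors tangent to the lift of the line `[ξ]`, as far as contact vectors are
concerned. -/
noncomputable def crossLine (z : Cone) : TangentFibre z →ₗ[ℂ] Vec3 :=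
  (eulerSpace z).liftQ (crossProduct z.1.2 ∘ₗ LinearMap.snd ℂ Vec3 Vec3) (by
    refine Submodule.span_le.2 ?_
    rintro p (rfl | rfl)
    · simp
    · simp)

theorem crossLine_mk (z : Cone) (p : Vec3 × Vec3) :
    crossLine z (Submodule.Quotient.mk p) = z.1.2 ⨯₃ p.2 := rfl

open Classical in
/-- The component of a vector field along the fibres of `π`, as a function of homogeneous
coordinates: for a contact vector `(v, w)` at `(x, ξ)` it is the scalar `d` such that `ξ × w = d x`.
It is set to be zero outside the cone. -/
noncomputable def fibreComponent : ((z : Cone) → TangentFibre z) →ₗ[ℂ] (Vec3 → Vec3 → ℂ) where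
  toFun X x ξ := if h : (x, ξ) ∈ Cone then
    (crossLine ⟨(x, ξ), h⟩ (X ⟨(x, ξ), h⟩) ⬝ᵥ star x) / (x ⬝ᵥ star x) else 0
  map_add' X Y := by
    ext x ξ
    simp only [Pi.add_apply]
    split_ifs with h
    · rw [map_add, add_dotProduct, add_div]
    · rw [add_zero]
  map_smul' c X := by
    ext x ξ
    simp only [Pi.smul_apply, RingHom.id_apply]
    split_ifs with h
    · rw [map_smul, smul_dotProduct, smul_eq_mul, smul_eq_mul, mul_div_assoc]
    · rw [smul_zero]

theorem fibreComponent_of_mem (X : (z : Cone) → TangentFibre z) (z : Cone) :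
    fibreComponent X z.1.1 z.1.2 =
      (crossLine z (X z) ⬝ᵥ star z.1.1) / (z.1.1 ⬝ᵥ star z.1.1) :=
  dif_pos z.2

theorem fibreComponent_of_notMem (X : (z : Cone) → TangentFibre z) {x ξ : Vec3}
    (h : (x, ξ) ∉ Cone) : fibreComponent X x ξ = 0 :=
  dif_neg h

theorem crossLine_eq {X : (z : Cone) → TangentFibre z} {z : Cone} (h : X z ∈ contactFibre z) :
    crossLine z (X z) = fibreComponent X z.1.1 z.1.2 • z.1.1 := by
  rw [fibreComponent_of_mem]
  refine eq_smul_of_cross_eq_zero z.2.1 ?_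
  obtain ⟨p, hp⟩ := Submodule.Quotient.mk_surjective _ (X z)
  rw [← hp] at h ⊢
  obtain ⟨h1, h2⟩ := mem_contactSpace_of_mk_mem h
  rw [h2, zero_add] at h1
  rw [crossLine_mk, cross_cross_eq_smul_sub_smul', h1, dotProduct_comm z.1.2, z.2.2.2, zero_smul,
    zero_smul, sub_zero]

theorem crossLine_scaleFibre (s t : ℂˣ) (z : Cone) (Y : TangentFibre z) :
    crossLine (coneScale s t z) (scaleFibre s t z Y) = ((t : ℂ) ^ 2) • crossLine z Y := by
  obtain ⟨p, rfl⟩ := Submodule.Quotient.mk_surjective _ Y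
  change ((t : ℂ) • z.1.2) ⨯₃ ((t : ℂ) • p.2) = _
  rw [crossLine_mk, map_smul, LinearMap.map_smul₂, smul_smul, sq]

theorem differentiableOn_cross {N : Set (Vec3 × Vec3)} {f g : Vec3 × Vec3 → Vec3}
    (hf : DifferentiableOn ℂ f N) (hg : DifferentiableOn ℂ g N) :
    DifferentiableOn ℂ (fun e => f e ⨯₃ g e) N := by
  have hf' := differentiableOn_pi.1 hf
  have hg' := differentiableOn_pi.1 hg
  rw [differentiableOn_pi]
  intro i
  simp only [cross_apply]
  fin_cases i
  · exact ((hf' 1).mul (hg' 2)).sub ((hf' 2).mul (hg' 1))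
  · exact ((hf' 2).mul (hg' 0)).sub ((hf' 0).mul (hg' 2))
  · exact ((hf' 0).mul (hg' 1)).sub ((hf' 1).mul (hg' 0))

/-- The line bundle of the vectors along the fibres of `π` is `𝒪(-1, 2)`. -/
theorem isBihomogeneous_fibreComponent {p b : ℕ} (X : Sections (p + 1) b) :
    IsBihomogeneous p (b + 2) (fibreComponent X.1) := by
  obtain ⟨X, hcontact, hequiv, hholo⟩ := X
  refine ⟨fun ξ => fibreComponent_of_notMem X fun h => h.1 rfl,
    fun s t x ξ hs ht hx hξ hxξ => ?_, fun x ξ hx hξ hxξ => ?_⟩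
  · obtain ⟨i, hi⟩ := Function.ne_iff.1 hx
    have hi : x i ≠ 0 := hi
    let z : Cone := ⟨(x, ξ), hx, hξ, hxξ⟩
    have h1 := crossLine_eq (hcontact (coneScale (Units.mk0 s hs) (Units.mk0 t ht) z))
    rw [hequiv, map_smul, crossLine_scaleFibre, crossLine_eq (hcontact z)] at h1
    have h2 : (s ^ (p + 1) * t ^ b) * (t ^ 2 * (fibreComponent X x ξ * x i)) =
        fibreComponent X (s • x) (t • ξ) * (s * x i) := congrFun h1 i
    change fibreComponent X (s • x) (t • ξ) = s ^ p * t ^ (b + 2) * fibreComponent X x ξ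
    have h3 : (s * x i) * (fibreComponent X (s • x) (t • ξ) -
        s ^ p * t ^ (b + 2) * fibreComponent X x ξ) = 0 := by
      linear_combination -h2
    exact sub_eq_zero.1 ((mul_eq_zero.1 h3).resolve_left (mul_ne_zero hs hi))
  · obtain ⟨i, hi⟩ := Function.ne_iff.1 hx
    have hi : x i ≠ 0 := hi
    obtain ⟨N, Y, hN, hmem, hY, hXY⟩ := hholo ⟨(x, ξ), hx, hξ, hxξ⟩
    have hcont : Continuous fun e : Vec3 × Vec3 => e.1 i := by fun_prop
    refine ⟨N ∩ {e | e.1 i ≠ 0}, fun e => (e.2 ⨯₃ (Y e).2) i / e.1 i,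
      hN.inter (isOpen_ne.preimage hcont), ⟨hmem, hi⟩, ?_, ?_⟩
    · have hden : DifferentiableOn ℂ (fun e : Vec3 × Vec3 => e.1 i) (N ∩ {e | e.1 i ≠ 0}) := by
        fun_prop
      have hnum := differentiableOn_pi.1 ((differentiableOn_cross (f := fun e => e.2)
        (by fun_prop) hY.snd).mono (Set.inter_subset_left (t := {e | e.1 i ≠ 0}))) i
      exact (hnum.mul (hden.inv fun e he => he.2)).congr fun e _ => div_eq_mul_inv _ _
    · intro y η hy hη hyη hyN
      have h1 := crossLine_eq (hcontact ⟨(y, η), hy, hη, hyη⟩)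
      rw [hXY _ hyN.1, crossLine_mk] at h1
      have h2 : (η ⨯₃ (Y (y, η)).2) i = fibreComponent X y η * y i := congrFun h1 i
      change fibreComponent X y η = (η ⨯₃ (Y (y, η)).2) i / y i
      rw [h2, mul_div_cancel_right₀ _ hyN.2]

/-- The vector along the fibre of `π` with a given component. -/
noncomputable def fibreVector (f : Vec3 → Vec3 → ℂ) (z : Cone) : Vec3 × Vec3 :=
  (0, (f z.1.1 z.1.2 / (z.1.2 ⬝ᵥ star z.1.2)) • (z.1.1 ⨯₃ star z.1.2))

theorem smul_cross_sub_mem_eulerSpace (z : Cone) (c : ℂ) {u : Vec3} (hu : z.1.2 ⬝ᵥ u = 0) :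
    ((0, c • (z.1.1 ⨯₃ u)) : Vec3 × Vec3) ∈ eulerSpace z := by
  have h := eq_smul_of_cross_eq_zero z.2.2.1 (y := z.1.1 ⨯₃ u) (by
    rw [cross_cross_star _ _ _ z.2.2.2, hu, zero_smul])
  rw [h, smul_smul]
  have h1 : ((0, z.1.2) : Vec3 × Vec3) ∈ eulerSpace z := Submodule.subset_span (Or.inr rfl)
  have h2 := Submodule.smul_mem _ (c * ((z.1.1 ⨯₃ u) ⬝ᵥ star z.1.2 / z.1.2 ⬝ᵥ star z.1.2)) h1
  rwa [Prod.smul_mk, smul_zero] at h2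

/-- Every bihomogeneous function of bidegree `(p, b + 2)` is the component of some section of
`𝒟 ⊗ 𝒪(p + 1, b)` along the fibres of `π`. -/
theorem exists_section_of_isBihomogeneous {p b : ℕ} {f : Vec3 → Vec3 → ℂ}
    (hf : IsBihomogeneous p (b + 2) f) : ∃ X : Sections (p + 1) b,
      ∀ x ξ : Vec3, x ≠ 0 → ξ ≠ 0 → x ⬝ᵥ ξ = 0 → fibreComponent X.1 x ξ = f x ξ := by
  refine ⟨⟨fun z => Submodule.Quotient.mk (fibreVector f z), fun z => ?_, fun s t z => ?_,
    fun z₀ => ?_⟩, fun x ξ hx hξ hxξ => ?_⟩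
  · refine ⟨fibreVector f z, ⟨?_, ?_⟩, rfl⟩
    · simp [fibreVector, dot_self_cross]
    · simp [fibreVector]
  · obtain ⟨⟨x, ξ⟩, hx, hξ, hxξ⟩ := z
    have hxs := hf.smul s t x ξ s.ne_zero t.ne_zero hx hξ hxξ
    have ht : (t : ℂ) ≠ 0 := t.ne_zero
    have hts : star (t : ℂ) ≠ 0 := star_ne_zero.2 ht
    have hξξ := dotProduct_star_ne_zero hξ
    change (Submodule.Quotient.mk _ : TangentFibre _) = Submodule.Quotient.mk _
    congr 1
    refine Prod.ext ?_ ?_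
    · change (0 : Vec3) = (_ : ℂ) • ((s : ℂ) • (0 : Vec3))
      rw [smul_zero, smul_zero]
    · change (f ((s : ℂ) • x) ((t : ℂ) • ξ) / (((t : ℂ) • ξ) ⬝ᵥ star ((t : ℂ) • ξ))) •
        (((s : ℂ) • x) ⨯₃ star ((t : ℂ) • ξ)) = ((s : ℂ) ^ (p + 1) * (t : ℂ) ^ b) • ((t : ℂ) •
          ((f x ξ / (ξ ⬝ᵥ star ξ)) • (x ⨯₃ star ξ)))
      rw [hxs, star_smul, smul_dotProduct, dotProduct_smul, map_smul, LinearMap.map_smul₂]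
      simp only [smul_smul, smul_eq_mul]
      refine congrArg (fun c : ℂ => c • (x ⨯₃ star ξ)) ?_
      have hξξ' : ξ ⬝ᵥ star ξ ≠ 0 := hξξ
      field_simp
      ring
  · obtain ⟨⟨x, ξ⟩, hx, hξ, hxξ⟩ := z₀
    obtain ⟨N, g, hN, hmem, hg, hfg⟩ := hf.holo x ξ hx hξ hxξ
    obtain ⟨i, hi⟩ := Function.ne_iff.1 hξ
    have hi : ξ i ≠ 0 := hi
    have hcont : Continuous fun e : Vec3 × Vec3 => e.2 i := by fun_prop
    refine ⟨N ∩ {e | e.2 i ≠ 0}, fun e => (0, (g e / e.2 i) • (e.1 ⨯₃ Pi.single i 1)),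
      hN.inter (isOpen_ne.preimage hcont), ⟨hmem, hi⟩, ?_, fun z hz => ?_⟩
    · have hden : DifferentiableOn ℂ (fun e : Vec3 × Vec3 => e.2 i) (N ∩ {e | e.2 i ≠ 0}) := by
        fun_prop
      have hnum := hg.mono (Set.inter_subset_left (t := {e : Vec3 × Vec3 | e.2 i ≠ 0}))
      have hquot : DifferentiableOn ℂ (fun e => g e / e.2 i) (N ∩ {e | e.2 i ≠ 0}) :=
        (hnum.mul (hden.inv fun e he => he.2)).congr fun e _ => div_eq_mul_inv _ _
      refine (differentiableOn_const 0).prodMk (hquot.fun_smul ?_)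
      · exact differentiableOn_cross (f := fun e => e.1) (by fun_prop) (by fun_prop)
    · rw [Submodule.Quotient.eq]
      have hξξ := dotProduct_star_ne_zero z.2.2.1
      have hzi : z.1.2 i ≠ 0 := hz.2
      have hfz : g z.1 = f z.1.1 z.1.2 := (hfg _ _ z.2.1 z.2.2.1 z.2.2.2 hz.1).symm
      have hdiff : fibreVector f z - (0, (g z.1 / z.1.2 i) • (z.1.1 ⨯₃ Pi.single i 1)) =
          (0, f z.1.1 z.1.2 • (z.1.1 ⨯₃ ((z.1.2 ⬝ᵥ star z.1.2)⁻¹ • star z.1.2 -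
            (z.1.2 i)⁻¹ • Pi.single i 1))) := by
        refine Prod.ext (sub_zero _) ?_
        change (f z.1.1 z.1.2 / _) • _ - _ = _
        rw [hfz, map_sub, map_smul, map_smul, smul_sub, smul_smul, smul_smul]
        rfl
      rw [hdiff]
      refine smul_cross_sub_mem_eulerSpace z _ ?_
      rw [dotProduct_sub, dotProduct_smul, dotProduct_smul, dotProduct_single, smul_eq_mul,
        smul_eq_mul, mul_one, inv_mul_cancel₀ hξξ, inv_mul_cancel₀ hzi, sub_self]
  · have hξξ := dotProduct_star_ne_zero hξ
    have hxx := dotProduct_star_ne_zero hx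
    rw [fibreComponent_of_mem _ ⟨(x, ξ), hx, hξ, hxξ⟩, crossLine_mk]
    change ((ξ ⨯₃ ((f x ξ / (ξ ⬝ᵥ star ξ)) • (x ⨯₃ star ξ))) ⬝ᵥ star x) / (x ⬝ᵥ star x) = f x ξ
    rw [map_smul, cross_cross_star _ _ _ hxξ, smul_smul, div_mul_cancel₀ _ hξξ, smul_dotProduct,
      smul_eq_mul, mul_div_cancel_right₀ _ hxx]

/-! ### Duality between points and lines -/

/-- The exchange of the coordinates of points and lines. -/
def swapCone (z : Cone) : Cone :=
  ⟨(z.1.2, z.1.1), z.2.2.1, z.2.1, by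
    have := z.2.2.2
    rwa [dotProduct_comm] at this⟩

/-- The differential of the exchange of points and lines. -/
noncomputable def swapFibre (z : Cone) : TangentFibre (swapCone z) →ₗ[ℂ] TangentFibre z :=
  (eulerSpace (swapCone z)).mapQ (eulerSpace z) (LinearEquiv.prodComm ℂ Vec3 Vec3).toLinearMap (by
    refine Submodule.span_le.2 ?_
    rintro p (rfl | rfl)
    · exact Submodule.subset_span (Or.inr rfl)
    · exact Submodule.subset_span (Or.inl rfl))

theorem swapFibre_mk (z : Cone) (p : Vec3 × Vec3) :
    swapFibre z (Submodule.Quotient.mk p) = Submodule.Quotient.mk p.swap := rfl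

theorem swapFibre_scaleFibre (a b : ℕ) (s t : ℂˣ) (z : Cone) (Y : TangentFibre (swapCone z)) :
    swapFibre (coneScale s t z) (((t : ℂ) ^ a * (s : ℂ) ^ b) • scaleFibre t s (swapCone z) Y) =
      ((s : ℂ) ^ b * (t : ℂ) ^ a) • scaleFibre s t z (swapFibre z Y) := by
  obtain ⟨p, rfl⟩ := Submodule.Quotient.mk_surjective _ Y
  rw [mul_comm]
  rfl

/-- The isomorphism of `H⁰(𝒟 ⊗ 𝒪(a, b))` with `H⁰(𝒟 ⊗ 𝒪(b, a))` induced by the exchange of points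
and lines. -/
noncomputable def swapSections (a b : ℕ) : Sections a b →ₗ[ℂ] Sections b a where
  toFun X := ⟨fun z => swapFibre z (X.1 (swapCone z)), by
    obtain ⟨X, hcontact, hequiv, hholo⟩ := X
    refine ⟨fun z => ?_, fun s t z => ?_, fun z₀ => ?_⟩
    · obtain ⟨p, hp⟩ := Submodule.Quotient.mk_surjective _ (X (swapCone z))
      have h := hcontact (swapCone z)
      rw [← hp] at h
      obtain ⟨h1, h2⟩ := mem_contactSpace_of_mk_mem h
      change swapFibre z (X (swapCone z)) ∈ _
      rw [← hp, swapFibre_mk]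
      refine ⟨p.swap, ⟨?_, ?_⟩, rfl⟩
      · change p.2 ⬝ᵥ z.1.2 + z.1.1 ⬝ᵥ p.1 = 0
        have h1 : p.1 ⬝ᵥ z.1.1 + z.1.2 ⬝ᵥ p.2 = 0 := h1
        rw [dotProduct_comm, add_comm, dotProduct_comm z.1.1]
        exact h1
      · have h1 : p.1 ⬝ᵥ z.1.1 + z.1.2 ⬝ᵥ p.2 = 0 := h1
        have h2 : p.1 ⬝ᵥ z.1.1 = 0 := h2
        rw [h2, zero_add, dotProduct_comm] at h1
        exact h1
    · exact (congrArg (swapFibre (coneScale s t z)) (hequiv t s (swapCone z))).trans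
        (swapFibre_scaleFibre a b s t z (X (swapCone z)))
    · obtain ⟨N, Y, hN, hmem, hY, hXY⟩ := hholo (swapCone z₀)
      refine ⟨Prod.swap ⁻¹' N, fun e => (Y e.swap).swap, hN.preimage continuous_swap, hmem, ?_,
        fun z hz => ?_⟩
      · have h1 : DifferentiableOn ℂ (fun e : Vec3 × Vec3 => Y e.swap) (Prod.swap ⁻¹' N) :=
          hY.comp (f := Prod.swap) (by
            exact (differentiable_snd.prodMk differentiable_fst).differentiableOn) fun e he => he
        exact h1.snd.prodMk h1.fst
      · change swapFibre z (X (swapCone z)) = _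
        rw [hXY (swapCone z) hz]
        rfl⟩
  map_add' X Y := Subtype.ext (funext fun z => map_add (swapFibre z) _ _)
  map_smul' c X := Subtype.ext (funext fun z => map_smul (swapFibre z) c _)

theorem swapSections_apply {a b : ℕ} (X : Sections a b) (z : Cone) :
    (swapSections a b X).1 z = swapFibre z (X.1 (swapCone z)) := rfl

theorem swapSections_swapSections {a b : ℕ} (X : Sections a b) :
    swapSections b a (swapSections a b X) = X := by
  refine Subtype.ext (funext fun z => ?_)
  rw [swapSections_apply, swapSections_apply]
  obtain ⟨p, hp⟩ := Submodule.Quotient.mk_surjective _ (X.1 z)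
  change swapFibre z (swapFibre (swapCone z) (X.1 z)) = X.1 z
  rw [← hp]
  rfl

/-! ### Invariance of the lifts of lines -/

theorem hasDerivAt_eval_line {ι : Type*} [Fintype ι] (P : MvPolynomial ι ℂ) (a v : ι → ℂ) :
    HasDerivAt (fun t : ℂ => eval (fun k => a k + t * v k) P)
      (∑ k, eval a (pderiv k P) * v k) 0 := by
  classical
  induction P using MvPolynomial.induction_on with
  | C c => simpa using hasDerivAt_const (0 : ℂ) c
  | add P Q hP hQ =>
    simpa [add_mul, Finset.sum_add_distrib] using hP.fun_add hQ
  | mul_X P i hP =>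
    have h1 : HasDerivAt (fun t : ℂ => a i + t * v i) (v i) 0 := by
      simpa using ((hasDerivAt_id (0 : ℂ)).mul_const (v i)).const_add (a i)
    have h2 := hP.fun_mul h1
    refine (h2.congr_of_eventuallyEq (Filter.Eventually.of_forall fun t => by simp)).congr_deriv ?_
    simp only [Derivation.leibniz, pderiv_X, map_add, smul_eq_mul, map_mul, eval_X, zero_mul,
      add_zero, add_mul, Finset.sum_add_distrib, Finset.sum_mul]
    rw [add_comm]
    congr 1
    · rw [Finset.sum_eq_single i]
      · simp
      · intro k _ hk
        simp [Pi.single_eq_of_ne' hk]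
      · simp
    · exact Finset.sum_congr rfl fun k _ => by ring

/-- A polynomial which vanishes along a line segment through `z` has derivative zero in its
direction. -/
theorem dirDeriv_eq_zero {P : CoordPoly} {C : Set ContactVariety} (hP : VanishesOn P C) {z : Cone}
    {p : Vec3 × Vec3} (h : ∀ᶠ t : ℂ in 𝓝 0, ∃ y : Cone, toContactVariety y ∈ C ∧
      y.1.1 = z.1.1 + t • p.1 ∧ y.1.2 = z.1.2 + t • p.2) : dirDeriv P z p = 0 := by
  refine (hasDerivAt_eval_line P (Sum.elim z.1.1 z.1.2) (Sum.elim p.1 p.2)).unique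
    ((hasDerivAt_const (0 : ℂ) (0 : ℂ)).congr_of_eventuallyEq ?_)
  filter_upwards [h] with t ⟨y, hyC, hy1, hy2⟩
  rw [← hP y hyC, hy1, hy2]
  refine congrArg (fun e => eval e P) (funext fun k => ?_)
  rcases k with k | k <;> rfl

/-- The linear form `u ⬝ ξ` in the coordinates `(x, ξ)`. -/
noncomputable def lineForm (u : Vec3) : CoordPoly := ∑ i, C (u i) * X (Sum.inr i)

theorem eval_lineForm (u : Vec3) (e : Vec3 × Vec3) :
    eval (Sum.elim e.1 e.2) (lineForm u) = u ⬝ᵥ e.2 := by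
  simp [lineForm, dotProduct]

theorem dirDeriv_lineForm (u : Vec3) (z : Cone) (p : Vec3 × Vec3) :
    dirDeriv (lineForm u) z p = u ⬝ᵥ p.2 := by
  simp [dirDeriv, lineForm, pderiv_X, dotProduct, Pi.single_apply, apply_ite]

theorem mem_lineLift {z : Cone} {l : DualPlane} :
    toContactVariety z ∈ lineLift l ↔ ∃ c : ℂ, z.1.2 = c • l.rep := by
  change Projectivization.mk ℂ z.1.2 z.2.2.1 = l ↔ _
  rw [← l.mk_rep, Projectivization.mk_eq_mk_iff']
  simp only [Projectivization.mk_rep, eq_comm]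

/-- The vector field `Y` is tangent to `C`. -/
def IsTangent (Y : (z : Cone) → TangentFibre z) (C : Set ContactVariety) : Prop :=
  ∀ P : CoordPoly, VanishesOn P C → ∀ z : Cone, toContactVariety z ∈ C →
    ∀ p : Vec3 × Vec3, Submodule.Quotient.mk p = Y z → dirDeriv P z p = 0

/-- The lift of a line is invariant exactly when the section has no component along the fibres of
`π` over the points of the line. Necessity is seen on the linear forms `u ⬝ ξ` with `u ⬝ l = 0`;
for the converse, a contact vector without this component is tangent to a curve in the lift. -/
theorem isTangent_lineLift_iff {p b : ℕ} (Y : Sections (p + 1) b) (l : DualPlane) :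
    IsTangent Y.1 (lineLift l) ↔
      ∀ x : Vec3, x ≠ 0 → x ⬝ᵥ l.rep = 0 → fibreComponent Y.1 x l.rep = 0 := by
  constructor
  · intro h x hx hxl
    let z : Cone := ⟨(x, l.rep), hx, l.rep_nonzero, hxl⟩
    obtain ⟨e, he⟩ := Submodule.Quotient.mk_surjective _ (Y.1 z)
    have hcross : l.rep ⨯₃ e.2 = 0 := by
      refine dotProduct_eq_zero _ fun η => ?_
      have h1 := h (lineForm (η ⨯₃ l.rep)) (fun y hy => ?_) z (mem_lineLift.2 ⟨1, by simp [z]⟩) e he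
      · rw [dirDeriv_lineForm, dotProduct_comm, triple_product_permutation] at h1
        rw [dotProduct_comm, ← h1]
      · obtain ⟨c, hc⟩ := mem_lineLift.1 hy
        rw [eval_lineForm, hc, dotProduct_smul, cross_dot_right, smul_zero]
    rw [fibreComponent_of_mem Y.1 z, ← he, crossLine_mk, hcross, zero_dotProduct, zero_div]
  · intro h P hP z hz e he
    obtain ⟨c, hc⟩ := mem_lineLift.1 hz
    have hc0 : c ≠ 0 := by
      rintro rfl
      exact z.2.2.1 (by rw [hc, zero_smul])
    have hcontact := Y.2.1 z
    have hzl : z.1.1 ⬝ᵥ l.rep = 0 := by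
      have h1 := z.2.2.2
      rw [hc, dotProduct_smul] at h1
      exact (smul_eq_zero.1 h1).resolve_left hc0
    have hzero : fibreComponent Y.1 z.1.1 z.1.2 = 0 := by
      have h1 := (isBihomogeneous_fibreComponent Y).smul 1 c z.1.1 l.rep one_ne_zero hc0 z.2.1
        l.rep_nonzero hzl
      rw [one_smul, ← hc, h _ z.2.1 hzl, mul_zero] at h1
      exact h1
    have h1 := crossLine_eq hcontact
    rw [← he] at hcontact
    obtain ⟨-, h2⟩ := mem_contactSpace_of_mk_mem hcontact
    rw [hzero, zero_smul, ← he, crossLine_mk] at h1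
    obtain ⟨μ, hμ⟩ : ∃ μ : ℂ, e.2 = μ • z.1.2 := ⟨_, eq_smul_of_cross_eq_zero z.2.2.1 h1⟩
    refine dirDeriv_eq_zero hP ?_
    have hx : ∀ᶠ t : ℂ in 𝓝 0, z.1.1 + t • e.1 ≠ 0 := by
      have : ContinuousAt (fun t : ℂ => z.1.1 + t • e.1) 0 := by fun_prop
      refine this.eventually_ne ?_
      simpa using z.2.1
    have hξ : ∀ᶠ t : ℂ in 𝓝 0, 1 + t * μ ≠ 0 := by
      have : ContinuousAt (fun t : ℂ => 1 + t * μ) 0 := by fun_prop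
      refine this.eventually_ne ?_
      simp
    filter_upwards [hx, hξ] with t hx hξ
    have h3 : z.1.2 + t • e.2 = (1 + t * μ) • z.1.2 := by
      rw [hμ, add_smul, one_smul, smul_smul]
    refine ⟨⟨(z.1.1 + t • e.1, z.1.2 + t • e.2), hx, ?_, ?_⟩, ?_, rfl, rfl⟩
    · rw [h3]
      exact smul_ne_zero hξ z.2.2.1
    · change (z.1.1 + t • e.1) ⬝ᵥ (z.1.2 + t • e.2) = 0
      have h2 : e.1 ⬝ᵥ z.1.2 = 0 := h2
      rw [h3, dotProduct_smul, add_dotProduct, smul_dotProduct, h2, z.2.2.2, smul_zero, add_zero,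
        smul_zero]
    · refine mem_lineLift.2 ⟨(1 + t * μ) * c, ?_⟩
      change z.1.2 + t • e.2 = _
      rw [h3, hc, smul_smul]

theorem dirDeriv_rename_swap (P : CoordPoly) (z : Cone) (p : Vec3 × Vec3) :
    dirDeriv (rename Sum.swap P) (swapCone z) p.swap = dirDeriv P z p := by
  have hinj : Function.Injective (Sum.swap : Fin 3 ⊕ Fin 3 → Fin 3 ⊕ Fin 3) :=
    Sum.swap_rightInverse.injective
  rw [dirDeriv, dirDeriv, ← (Equiv.sumComm (Fin 3) (Fin 3)).sum_comp]
  refine Finset.sum_congr rfl fun k _ => ?_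
  rw [Equiv.sumComm_apply, pderiv_rename hinj, eval_rename]
  rcases k with k | k <;> simp [swapCone]

theorem isTangent_swapSections_of_isTangent {a b : ℕ} {Y : Sections a b} {C C' : Set ContactVariety}
    (hC : ∀ z, toContactVariety z ∈ C' ↔ toContactVariety (swapCone z) ∈ C)
    (h : IsTangent Y.1 C) : IsTangent (swapSections a b Y).1 C' := by
  intro P hP z hz p hp
  rw [← dirDeriv_rename_swap]
  refine h _ (fun y hy => ?_) (swapCone z) ((hC z).1 hz) p.swap ?_
  · rw [eval_rename, ← hP (swapCone y) ((hC _).2 hy)]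
    congr 2
    ext k
    rcases k with k | k <;> rfl
  · have h1 := congrArg (swapFibre (swapCone z)) hp
    obtain ⟨e, he⟩ := Submodule.Quotient.mk_surjective _ (Y.1 (swapCone z))
    rw [swapSections_apply, ← he] at h1
    rw [← he]
    exact h1

theorem isTangent_pointFibre_iff {a p : ℕ} (Y : Sections a (p + 1)) (q : Plane) :
    IsTangent Y.1 (pointFibre q) ↔ ∀ x : Vec3, x ≠ 0 → x ⬝ᵥ q.rep = 0 →
      fibreComponent (swapSections a (p + 1) Y).1 x q.rep = 0 := by
  rw [← isTangent_lineLift_iff]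
  refine ⟨isTangent_swapSections_of_isTangent fun z => Iff.rfl, fun h => ?_⟩
  rw [← swapSections_swapSections Y]
  exact isTangent_swapSections_of_isTangent (C := lineLift q) (fun z => Iff.rfl) h

theorem lineLift_injective : Function.Injective lineLift := by
  intro l l' h
  obtain ⟨η, hη⟩ := exists_cross_ne_zero l.rep_nonzero
  let z : Cone := ⟨(η ⨯₃ l.rep, l.rep), hη, l.rep_nonzero, cross_dot_right _ _⟩
  have hz : toContactVariety z ∈ lineLift l := mem_lineLift.2 ⟨1, by simp [z]⟩
  have hz' : toContactVariety z ∈ lineLift l' := h ▸ hz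
  exact hz.symm.trans hz'

theorem pointFibre_injective : Function.Injective pointFibre := by
  intro l l' h
  refine lineLift_injective (Set.ext fun m => ?_)
  have h1 := Set.ext_iff.1 h ⟨(m.1.2, m.1.1), Projectivization.orthogonal_comm.1 m.2⟩
  exact h1

/-! ### Irreducible factors of homogeneous polynomials -/

theorem sameTop_homogeneousComponent {σ : Type*} (u : MvPolynomial σ ℂ) :
    SameTop u.totalDegree u (homogeneousComponent u.totalDegree u) := by
  have htop := (homogeneousComponent_isHomogeneous u.totalDegree u).totalDegree_le
  refine ⟨le_rfl, htop, or_iff_not_imp_left.2 fun hne => ?_⟩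
  have hsub : u - homogeneousComponent u.totalDegree u =
      ∑ i ∈ Finset.range u.totalDegree, homogeneousComponent i u := by
    have h := sum_homogeneousComponent u
    rw [Finset.sum_range_succ] at h
    exact (eq_sub_of_add_eq h).symm
  have hpos : 0 < u.totalDegree := by
    by_contra! h
    rw [Nat.le_zero.1 h, Finset.range_zero, Finset.sum_empty, ← Nat.le_zero.1 h] at hsub
    exact hne hsub
  rw [hsub]
  refine (totalDegree_finsetSum _ _).trans_lt ((Finset.sup_lt_iff hpos).2 fun i hi => ?_)
  exact (homogeneousComponent_isHomogeneous i u).totalDegree_le.trans_lt (Finset.mem_range.1 hi)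

/-- A homogeneous polynomial of positive degree has an irreducible factor which is homogeneous: the
product of the leading forms of two factors is again the given polynomial. -/
theorem exists_irreducible_homogeneous_dvd {σ : Type*} [Nonempty σ] (n : ℕ) (hn : 0 < n)
    (P : MvPolynomial σ ℂ) (hP : P.IsHomogeneous n) :
    ∃ (m : ℕ) (G : MvPolynomial σ ℂ), G.IsHomogeneous m ∧ Irreducible G ∧ G ∣ P := by
  induction n using Nat.strong_induction_on generalizing P with
  | _ n ih =>
    rcases eq_or_ne P 0 with rfl | hP0
    · exact ⟨1, X (Classical.arbitrary σ), isHomogeneous_X _ _, X_prime.irreducible, dvd_zero _⟩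
    by_cases hirr : Irreducible P
    · exact ⟨n, P, hP, hirr, dvd_rfl⟩
    have hunit : ∀ u : MvPolynomial σ ℂ, u ≠ 0 → ¬ IsUnit u → 0 < u.totalDegree := by
      intro u hu0 hu
      by_contra! h
      refine hu (isUnit_iff_totalDegree_of_isReduced.2 ⟨?_, by omega⟩)
      have hC := totalDegree_eq_zero_iff_eq_C.1 (Nat.le_zero.1 h)
      refine isUnit_iff_ne_zero.2 fun h0 => hu0 ?_
      rw [hC, h0, C_0]
    have hPunit : ¬ IsUnit P := fun h => by
      have := (isUnit_iff_totalDegree_of_isReduced.1 h).2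
      rw [hP.totalDegree hP0] at this
      omega
    rw [irreducible_iff] at hirr
    push Not at hirr
    obtain ⟨u, v, rfl, hu, hv⟩ := hirr hPunit
    have hu0 : u ≠ 0 := left_ne_zero_of_mul hP0
    have hv0 : v ≠ 0 := right_ne_zero_of_mul hP0
    have hdeg := totalDegree_mul_of_isDomain hu0 hv0
    rw [hP.totalDegree hP0] at hdeg
    have hvpos := hunit v hv0 hv
    have hupos := hunit u hu0 hu
    have hu' := homogeneousComponent_isHomogeneous u.totalDegree u
    have hv' := homogeneousComponent_isHomogeneous v.totalDegree v
    have heq : u * v = homogeneousComponent u.totalDegree u *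
        homogeneousComponent v.totalDegree v := by
      have h1 := ((sameTop_homogeneousComponent u).mul (sameTop_homogeneousComponent v)).2.2
      rw [← hdeg] at h1
      by_contra hne
      have h2 := hP.sub (hdeg ▸ hu'.mul hv')
      have h3 := h1.resolve_left (sub_ne_zero.2 hne)
      rw [h2.totalDegree (sub_ne_zero.2 hne)] at h3
      omega
    obtain ⟨m, G, hG, hGirr, hdvd⟩ := ih u.totalDegree (by omega) hupos _ hu'
    exact ⟨m, G, hG, hGirr, heq ▸ hdvd.mul_right _⟩

/-- A section whose component along the fibres of `π` has degree zero in `x` vanishes along that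
direction over an irreducible curve of lines. -/
theorem exists_irreducibleCurve {q : ℕ} (hq : 0 < q) {f : Vec3 → Vec3 → ℂ}
    (hf : IsBihomogeneous 0 q f) : ∃ Γ : Set DualPlane, IsIrreducibleCurve Γ ∧
      ∀ l ∈ Γ, ∀ x : Vec3, x ≠ 0 → x ⬝ᵥ l.rep = 0 → f x l.rep = 0 := by
  obtain ⟨P, hP, hfP⟩ := hf.exists_polynomial_of_degree_zero
  obtain ⟨m, G, hG, hirr, H, rfl⟩ := exists_irreducible_homogeneous_dvd q hq P hP
  refine ⟨_, ⟨m, G, hG, hirr, rfl⟩, fun l hl x hx hxl => ?_⟩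
  have hl : eval l.rep G = 0 := hl
  rw [hfP x l.rep hx l.rep_nonzero hxl, map_mul, hl, zero_mul]

/-! ### Counting invariant lines -/

/-- A linear form vanishes on the orthogonal of `ξ` exactly when it is a multiple of `ξ`. -/
theorem forall_dotProduct_eq_zero_iff {a ξ : Vec3} (hξ : ξ ≠ 0) :
    (∀ x : Vec3, x ≠ 0 → x ⬝ᵥ ξ = 0 → a ⬝ᵥ x = 0) ↔ ∃ c : ℂ, a = c • ξ := by
  constructor
  · intro h
    refine ⟨_, eq_smul_of_cross_eq_zero hξ (dotProduct_eq_zero _ fun η => ?_)⟩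
    rw [dotProduct_comm, triple_product_permutation, triple_product_permutation]
    rcases eq_or_ne (η ⨯₃ ξ) 0 with h0 | h0
    · rw [h0, dotProduct_zero]
    · exact h _ h0 (cross_dot_right _ _)
  · rintro ⟨c, rfl⟩ x - hx
    rw [smul_dotProduct, dotProduct_comm, hx, smul_zero]

/-- The member of the linear system with `A ξ = (ξ 1 ^ q, ξ 2 ^ q, ξ 0 ^ q)`, all of whose invariant
lines are simple. -/
theorem isBihomogeneous_cyclic (q : ℕ) :
    IsBihomogeneous 1 q fun x ξ => ∑ i : Fin 3, ξ (i + 1) ^ q * x i where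
  zero ξ := by simp
  smul s t x ξ _ _ _ _ _ := by
    simp only [Pi.smul_apply, smul_eq_mul, mul_pow, Finset.mul_sum]
    exact Finset.sum_congr rfl fun i _ => by ring
  holo x ξ _ _ _ := ⟨Set.univ, fun e => ∑ i : Fin 3, e.2 (i + 1) ^ q * e.1 i, isOpen_univ, trivial,
    by fun_prop, fun _ _ _ _ _ _ => rfl⟩

/-- In a linear family of sections of `𝒟 ⊗ 𝒪(2, b)` which contains one with the component
`∑ i, ξ (i + 1) ^ (b + 2) * x i`, the generic one vanishes along the fibres of `π` over
exactly `(b + 2) ^ 2 + (b + 2) + 1` lines. -/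
theorem holdsGenerically_ncard {V : Type} [AddCommGroup V] [Module ℂ V] {b : ℕ}
    (S : V →ₗ[ℂ] Sections 2 b) {v₀ : V} (hv₀ : ∀ x ξ : Vec3, x ≠ 0 → ξ ≠ 0 → x ⬝ᵥ ξ = 0 →
      fibreComponent (S v₀).1 x ξ = ∑ i : Fin 3, ξ (i + 1) ^ (b + 2) * x i) :
    HoldsGenerically fun F : Projectivization ℂ V => {l : DualPlane | ∀ x : Vec3, x ≠ 0 →
      x ⬝ᵥ l.rep = 0 → fibreComponent (S F.rep).1 x l.rep = 0}.ncard =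
        (b + 2) ^ 2 + (b + 2) + 1 := by
  let A : Fin 3 → V →ₗ[ℂ] MvPolynomial (Fin 3) ℂ := fun i =>
    potential (b + 2) i ∘ₗ fibreComponent ∘ₗ (Sections 2 b).subtype ∘ₗ S
  have hbih : ∀ v, IsBihomogeneous 1 (b + 2) (fibreComponent (S v).1) := fun v =>
    isBihomogeneous_fibreComponent (p := 1) (S v)
  have hA : ∀ i v, (A i v).IsHomogeneous (b + 2) := fun i v => potential_isHomogeneous _ _ _
  have hA₀ : ∀ i, A i v₀ = X (i + 1) ^ (b + 2) := (hbih v₀).potential_cyclic hv₀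
  obtain ⟨f, hf, hf₀, hfA⟩ := exists_polyFun_ncard_fixedPoints (by omega : 2 ≤ b + 2) A
    (fun i v => (hA i v).totalDegree_le) hA₀
  refine holdsGenerically_of_polyFun hf (v₀ := v₀) ?_ hf₀ fun v hv hfv => ?_
  · rintro rfl
    have h := hA₀ 0
    rw [map_zero] at h
    exact pow_ne_zero _ (X_ne_zero _) h.symm
  · obtain ⟨h1, h2⟩ := hfA v hfv
    refine Eq.trans (congrArg Set.ncard (Set.ext fun l => ?_))
      (ncard_fixedLines (by omega : 2 ≤ b + 2) (fun i => hA i v) h1 h2)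
    obtain ⟨c, hc⟩ := Projectivization.exists_smul_eq_mk_rep ℂ v hv
    have hcomp : ∀ x ξ : Vec3, fibreComponent (S (Projectivization.mk ℂ v hv).rep).1 x ξ =
        c * fibreComponent (S v).1 x ξ := by
      intro x ξ
      rw [← hc, Units.smul_def, map_smul, Submodule.coe_smul, map_smul]
      rfl
    have hval : ∀ x : Vec3, x ≠ 0 → x ⬝ᵥ l.rep = 0 → fibreComponent (S v).1 x l.rep =
        (fun i => eval l.rep (A i v)) ⬝ᵥ x := fun x _ hx =>
      (hbih v).eq_sum_potential l.rep_nonzero hx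
    have hiff : (∀ x : Vec3, x ≠ 0 → x ⬝ᵥ l.rep = 0 →
        fibreComponent (S (Projectivization.mk ℂ v hv).rep).1 x l.rep = 0) ↔
          ∀ x : Vec3, x ≠ 0 → x ⬝ᵥ l.rep = 0 → (fun i => eval l.rep (A i v)) ⬝ᵥ x = 0 := by
      refine forall_congr' fun x => imp_congr_right fun hx => imp_congr_right fun hxl => ?_
      rw [hcomp, hval x hx hxl, mul_eq_zero, or_iff_right c.ne_zero]
    refine hiff.trans ((forall_dotProduct_eq_zero_iff l.rep_nonzero).trans ?_)
    exact exists_congr fun c => funext_iff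

theorem isInvariant_lineLift_iff {a b : ℕ} (ha : 1 ≤ a) (F : SecondOrderEq a b) (l : DualPlane) :
    IsInvariant F (lineLift l) ↔
      ∀ x : Vec3, x ≠ 0 → x ⬝ᵥ l.rep = 0 → fibreComponent F.rep.1 x l.rep = 0 := by
  obtain ⟨p, rfl⟩ := Nat.exists_eq_add_of_le' ha
  exact isTangent_lineLift_iff F.rep l

theorem isInvariant_pointFibre_iff {a b : ℕ} (hb : 1 ≤ b) (F : SecondOrderEq a b) (q : Plane) :
    IsInvariant F (pointFibre q) ↔ ∀ x : Vec3, x ≠ 0 → x ⬝ᵥ q.rep = 0 →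
      fibreComponent (swapSections a b F.rep).1 x q.rep = 0 := by
  obtain ⟨p, rfl⟩ := Nat.exists_eq_add_of_le' hb
  exact isTangent_pointFibre_iff F.rep q

theorem ncard_image_and {φ : Projectivization ℂ Vec3 → Set ContactVariety} (hφ : φ.Injective)
    (p : Set ContactVariety → Prop) : {C | (∃ l, C = φ l) ∧ p C}.ncard = {l | p (φ l)}.ncard := by
  rw [← Set.ncard_image_of_injective _ hφ]
  refine congrArg Set.ncard (Set.ext fun C => ⟨?_, ?_⟩)
  · rintro ⟨⟨l, rfl⟩, h⟩
    exact ⟨l, h, rfl⟩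
  · rintro ⟨l, h, rfl⟩
    exact ⟨⟨l, rfl⟩, h⟩

theorem HoldsGenerically.mono {V : Type} [AddCommGroup V] [Module ℂ V]
    {p q : Projectivization ℂ V → Prop} (hp : HoldsGenerically p) (h : ∀ F, p F → q F) :
    HoldsGenerically q := by
  obtain ⟨U, hU, hne, hdense, hpU⟩ := hp
  exact ⟨U, hU, hne, hdense, fun F hF => h F (hpU F hF)⟩

theorem exists_section_cyclic (b : ℕ) : ∃ X : Sections 2 b, ∀ x ξ : Vec3, x ≠ 0 → ξ ≠ 0 →
    x ⬝ᵥ ξ = 0 → fibreComponent X.1 x ξ = ∑ i : Fin 3, ξ (i + 1) ^ (b + 2) * x i :=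
  exists_section_of_isBihomogeneous (isBihomogeneous_cyclic (b + 2))

theorem holdsGenerically_ncard_lineLift (b : ℕ) : HoldsGenerically fun F : SecondOrderEq 2 b =>
    {C : Set ContactVariety | (∃ l : DualPlane, C = lineLift l) ∧ IsInvariant F C}.ncard =
      (b + 2) ^ 2 + (b + 2) + 1 := by
  obtain ⟨X₀, hX₀⟩ := exists_section_cyclic b
  obtain ⟨S, hS⟩ : ∃ S : Sections 2 b →ₗ[ℂ] Sections 2 b, ∀ X, S X = X :=
    ⟨LinearMap.id, fun _ => rfl⟩
  refine (holdsGenerically_ncard S (v₀ := X₀) (by rwa [hS])).mono fun F hF => ?_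
  rw [hS] at hF
  refine (ncard_image_and lineLift_injective _).trans (Eq.trans ?_ hF)
  exact congrArg Set.ncard (Set.ext fun l => isInvariant_lineLift_iff one_le_two F l)

theorem holdsGenerically_ncard_pointFibre (a : ℕ) : HoldsGenerically fun F : SecondOrderEq a 2 =>
    {C : Set ContactVariety | (∃ q : Plane, C = pointFibre q) ∧ IsInvariant F C}.ncard =
      (a + 2) ^ 2 + (a + 2) + 1 := by
  obtain ⟨X₀, hX₀⟩ := exists_section_cyclic a
  refine (holdsGenerically_ncard (swapSections a 2) (v₀ := swapSections 2 a X₀)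
    (by rw [swapSections_swapSections]; exact hX₀)).mono fun F hF => ?_
  refine (ncard_image_and pointFibre_injective _).trans (Eq.trans ?_ hF)
  exact congrArg Set.ncard (Set.ext fun q => isInvariant_pointFibre_iff one_le_two F q)

end SecondOrderODE

theorem mainTheorem5 (a b : ℕ) (ha : 1 ≤ a) (hb : 1 ≤ b) :
    ((∀ F : SecondOrderODE.SecondOrderEq 1 b,
        ∃ Γ : Set SecondOrderODE.DualPlane, SecondOrderODE.IsIrreducibleCurve Γ ∧
          ∀ l ∈ Γ, SecondOrderODE.IsInvariant F (SecondOrderODE.lineLift l)) ∧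
      SecondOrderODE.HoldsGenerically fun F : SecondOrderODE.SecondOrderEq 2 b =>
        {C : Set SecondOrderODE.ContactVariety |
          (∃ l : SecondOrderODE.DualPlane, C = SecondOrderODE.lineLift l) ∧
            SecondOrderODE.IsInvariant F C}.ncard = (b + 2) ^ 2 + (b + 2) + 1) ∧
    ((∀ F : SecondOrderODE.SecondOrderEq a 1,
        ∃ Γ : Set SecondOrderODE.Plane, SecondOrderODE.IsIrreducibleCurve Γ ∧
          ∀ q ∈ Γ, SecondOrderODE.IsInvariant F (SecondOrderODE.pointFibre q)) ∧
      SecondOrderODE.HoldsGenerically fun F : SecondOrderODE.SecondOrderEq a 2 =>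
        {C : Set SecondOrderODE.ContactVariety |
          (∃ q : SecondOrderODE.Plane, C = SecondOrderODE.pointFibre q) ∧
            SecondOrderODE.IsInvariant F C}.ncard = (a + 2) ^ 2 + (a + 2) + 1) := by
  refine ⟨⟨fun F => ?_, SecondOrderODE.holdsGenerically_ncard_lineLift b⟩, fun F => ?_,
    SecondOrderODE.holdsGenerically_ncard_pointFibre a⟩
  · obtain ⟨Γ, hΓ, h⟩ := SecondOrderODE.exists_irreducibleCurve (by omega)
      (SecondOrderODE.isBihomogeneous_fibreComponent (p := 0) F.rep)
    exact ⟨Γ, hΓ, fun l hl => (SecondOrderODE.isInvariant_lineLift_iff le_rfl F l).2 (h l hl)⟩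
  · obtain ⟨Γ, hΓ, h⟩ := SecondOrderODE.exists_irreducibleCurve (by omega)
      (SecondOrderODE.isBihomogeneous_fibreComponent (p := 0)
        (SecondOrderODE.swapSections a 1 F.rep))
    exact ⟨Γ, hΓ, fun q hq => (SecondOrderODE.isInvariant_pointFibre_iff le_rfl F q).2 (h q hq)⟩
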